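/- Let $D$ be a triangulated category with Grothendieck group $K(D)$. A stability condition on $D$ is a pair $\sigma=(Z,P)$ of a group homomorphism $Z\colon K(D)\to\mathbb{C}$ (the central charge) and full additive subcategories $P(\phi)\subset D$ $(\phi\in\mathbb{R})$, closed under isomorphisms, such that: (a) if $0\ne E\in P(\phi)$ then $Z(E)\in\mathbb{R}_{>0}\exp(i\pi\phi)$; (b) $P(\phi+1)=P(\phi)[1]$; (c) $\operatorname{Hom}(A_1,A_2)=0$ if $A_j\in P(\phi_j)$ and $\phi_1>\phi_2$; (d) every $0\neq E\in D$ has a finite sequence of maps $0=E_0\to E_1\to\cdots\to E_m=E$ whose cones are nonzero objects $A_j\in P(\phi_j)$ with $\phi_1>\cdots>\phi_m$. The decomposition in (d) is unique up to isomorphism; put $\phi^+_\sigma(E)=\phi_1$, $\phi^-_\sigma(E)=\phi_m$, $m_\sigma(E)=\sum_j|Z(A_j)|$. For $I\subset\mathbb{R}$ let $P(I)$ be the extension-closed subcategory generated by the $P(\phi)$, $\phi\in I$; the heart of $\sigma$ is $P((0,1])$. Let $\operatorname{Stab}(D)$ be the set of locally finite stability conditions (those for which there is $\varepsilon$ with $0<\varepsilon<\tfrac12$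 such that each quasi-abelian category $P((\phi-\varepsilon,\phi+\varepsilon))$ is of finite length), with the topology induced by the generalized metric $$d(\sigma_1,\sigma_2)=\sup_{0\ne E\in D}\Big\{|\phi^-_{\sigma_2}(E)-\phi^-_{\sigma_1}(E)|,\ |\phi^+_{\sigma_2}(E)-\phi^+_{\sigma_1}(E)|,\ \Big|\log\frac{m_{\sigma_2}(E)}{m_{\sigma_1}(E)}\Big|\Big\}\in[0,\infty].$$ Let $\mathcal{A}\subset D$ be the heart of a bounded t-structure on $D$, and suppose that $\mathcal{A}$ is of finite length with exactly $n$ simple objects $S_1,\dots,S_n$ up to isomorphism. Let $U(\mathcal{A})\subset\operatorname{Stab}(D)$ be the subspace of stability conditions with heart $\mathcal{A}$, and let $H=\{r\exp(i\pi\phi):r>0,\ 0<\phi\le 1\}\subset\mathbb{C}$. Then the map $$U(\mathcal{A})\longrightarrow H^n,\qquad \sigma=(Z,P)\longmapsto (Z(S_1),\dots,Z(S_n)),$$ is well defined and a homeomorphism. Moreover, $Z\mapsto(Z(S_1),\dots,Z(S_n))$ is a linear isomorphism $\operatorname{Hom}(K(D),\mathbb{C})\to\mathbb{C}^n$, so that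 this homeomorphism is the restriction to $U(\mathcal{A})$ of the forgetful map $\sigma\mapsto Z$ written in linear coordinates. -/

import Mathlib

open CategoryTheory CategoryTheory.Limits CategoryTheory.Pretriangulated
  CategoryTheory.Triangulated

universe v u

namespace Bridgeland

section General

/-- An object has finite length if its partially ordered set of subobjects satisfies both chain
conditions; a category is of finite length if all its objects are. -/
def IsFiniteLengthCategory (A : Type u) [Category.{v} A] : Prop :=
  ∀ X : A, IsArtinianObject X ∧ IsNoetherianObject X

/-- The strict subobjects of an object, i.e. those whose inclusion is the kernel of a morphism,
ordered by inclusion. -/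
abbrev StrictSubobject {A : Type u} [Category.{v} A] [HasZeroMorphisms A] (X : A) :=
  {S : Subobject X // Nonempty (NormalMono S.arrow)}

/-- The finite length condition for quasi-abelian categories: chains of strict subobjects
satisfy both chain conditions. -/
def IsStrictFiniteLengthCategory (A : Type u) [Category.{v} A] [HasZeroMorphisms A] : Prop :=
  ∀ X : A, WellFoundedLT (StrictSubobject X) ∧ WellFoundedGT (StrictSubobject X)

/-- The half-plane `{r exp(iπφ) : r > 0, 0 < φ ≤ 1}`. -/
def H : Set ℂ :=
  {z | ∃ r φ : ℝ, 0 < r ∧ 0 < φ ∧ φ ≤ 1 ∧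
    z = (r : ℂ) * Complex.exp (Complex.I * (Real.pi : ℂ) * (φ : ℂ))}

end General

variable (D : Type u) [Category.{v} D] [Preadditive D] [HasZeroObject D] [HasShift D ℤ]
  [∀ n : ℤ, (shiftFunctor D n).Additive] [Pretriangulated D]

/-- The subgroup of relations `[Y] = [X] + [Z]` for distinguished triangles `X ⟶ Y ⟶ Z ⟶ X⟦1⟧`. -/
def triangleRelations : AddSubgroup (FreeAbelianGroup D) :=
  AddSubgroup.closure {x | ∃ T : Triangle D, T ∈ distTriang D ∧
    x = FreeAbelianGroup.of T.obj₂ - FreeAbelianGroup.of T.obj₁ - FreeAbelianGroup.of T.obj₃}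

/-- The Grothendieck group of a triangulated category. -/
abbrev K : Type u := FreeAbelianGroup D ⧸ triangleRelations D

variable {D}

/-- The class of an object in the Grothendieck group. -/
def K.of (E : D) : K D := QuotientAddGroup.mk (FreeAbelianGroup.of E)

/-- The extension-closed full subcategory generated by a family of objects. (Closure under
isomorphisms follows from the case of a triangle with a zero third object.) -/
inductive ExtensionClosure (Q : ObjectProperty D) : D → Prop
  | zero (X : D) (hX : IsZero X) : ExtensionClosure Q X
  | of (X : D) (hX : Q X) : ExtensionClosure Q X
  | ext (T : Triangle D) (hT : T ∈ distTriang D) (h₁ : ExtensionClosure Q T.obj₁)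
      (h₃ : ExtensionClosure Q T.obj₃) : ExtensionClosure Q T.obj₂

/-- For a family of subcategories `P φ` and a set `I` of phases, the extension-closed
subcategory `P(I)` generated by all `P φ` with `φ ∈ I`. -/
def phaseSubcategory (P : ℝ → ObjectProperty D) (I : Set ℝ) : ObjectProperty D :=
  ExtensionClosure fun X => ∃ φ ∈ I, P φ X

/-- A decomposition of an object `E`: a tower `0 = E₀ ⟶ E₁ ⟶ ⋯ ⟶ Eₙ₊₁ ≅ E` whose cones are
nonzero objects of `P (phase j)`, with strictly decreasing phases. -/
structure HNFiltration (P : ℝ → ObjectProperty D) (E : D) where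
  n : ℕ
  phase : Fin (n + 1) → ℝ
  phase_strictAnti : StrictAnti phase
  obj : Fin (n + 2) → D
  isZero_obj_zero : IsZero (obj 0)
  iso : obj (Fin.last (n + 1)) ≅ E
  factor : Fin (n + 1) → D
  factor_mem : ∀ j, P (phase j) (factor j)
  factor_nonzero : ∀ j, ¬ IsZero (factor j)
  f : ∀ j : Fin (n + 1), obj j.castSucc ⟶ obj j.succ
  g : ∀ j : Fin (n + 1), obj j.succ ⟶ factor j
  h : ∀ j : Fin (n + 1), factor j ⟶ (obj j.castSucc)⟦(1 : ℤ)⟧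
  distinguished : ∀ j, Triangle.mk (f j) (g j) (h j) ∈ distTriang D

variable (D)

/-- A stability condition on a triangulated category: a central charge `Z` and full additive
subcategories `P φ` (closed under isomorphisms), for `φ : ℝ`. -/
@[ext]
structure StabilityCondition where
  Z : K D →+ ℂ
  P : ℝ → ObjectProperty D
  closed_iso : ∀ φ, (P φ).IsClosedUnderIsomorphisms
  closed_finite_sum : ∀ φ, (P φ).IsClosedUnderFiniteProducts
  charge : ∀ (φ : ℝ) (E : D), P φ E → ¬ IsZero E →
    ∃ m : ℝ, 0 < m ∧ Z (K.of E) = (m : ℂ) * Complex.exp (Complex.I * (Real.pi : ℂ) * (φ : ℂ))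
  shift : ∀ (φ : ℝ) (E : D), P (φ + 1) (E⟦(1 : ℤ)⟧) ↔ P φ E
  hom_eq_zero : ∀ (φ₁ φ₂ : ℝ), φ₂ < φ₁ → ∀ (A₁ A₂ : D), P φ₁ A₁ → P φ₂ A₂ →
    ∀ f : A₁ ⟶ A₂, f = 0
  exists_hn : ∀ E : D, ¬ IsZero E → Nonempty (HNFiltration P E)

variable {D}

namespace StabilityCondition

/-- Local finiteness: for some `ε > 0`, all categories `P((φ - ε, φ + ε))` are of finite length.
The bound `ε < 1 / 2` makes these categories quasi-abelian. -/
def IsLocallyFinite (σ : StabilityCondition D) : Prop :=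
  ∃ ε : ℝ, 0 < ε ∧ ε < 1 / 2 ∧ ∀ φ : ℝ,
    IsStrictFiniteLengthCategory
      (phaseSubcategory σ.P (Set.Ioo (φ - ε) (φ + ε))).FullSubcategory

/-- The heart `P((0, 1])` of a stability condition. -/
def heart (σ : StabilityCondition D) : ObjectProperty D :=
  phaseSubcategory σ.P (Set.Ioc 0 1)

/-- The decomposition of a nonzero object, which is unique up to isomorphism. -/
noncomputable def hn (σ : StabilityCondition D) (E : D) (hE : ¬ IsZero E) :
    HNFiltration σ.P E :=
  (σ.exists_hn E hE).some

/-- The largest phase `φ⁺(E)` of a semistable factor of a nonzero object. -/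
noncomputable def phasePlus (σ : StabilityCondition D) (E : D) (hE : ¬ IsZero E) : ℝ :=
  (σ.hn E hE).phase 0

/-- The smallest phase `φ⁻(E)` of a semistable factor of a nonzero object. -/
noncomputable def phaseMinus (σ : StabilityCondition D) (E : D) (hE : ¬ IsZero E) : ℝ :=
  (σ.hn E hE).phase (Fin.last _)

/-- The mass of a nonzero object: the sum of `|Z|` over its semistable factors. -/
noncomputable def mass (σ : StabilityCondition D) (E : D) (hE : ¬ IsZero E) : ℝ :=
  ∑ j, ‖σ.Z (K.of ((σ.hn E hE).factor j))‖

lemma mass_pos (σ : StabilityCondition D) (E : D) (hE : ¬ IsZero E) : 0 < σ.mass E hE := by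
  refine Finset.sum_pos (fun j _ => ?_) ⟨0, Finset.mem_univ _⟩
  obtain ⟨m, hm, h⟩ := σ.charge _ _ ((σ.hn E hE).factor_mem j) ((σ.hn E hE).factor_nonzero j)
  rw [h, norm_pos_iff]
  exact mul_ne_zero (by exact_mod_cast hm.ne') (Complex.exp_ne_zero _)

/-- The contribution of a nonzero object to the distance of two stability conditions. -/
noncomputable def distAt (σ τ : StabilityCondition D) (E : D) (hE : ¬ IsZero E) : ℝ :=
  max (max |τ.phaseMinus E hE - σ.phaseMinus E hE| |τ.phasePlus E hE - σ.phasePlus E hE|)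
    |Real.log (τ.mass E hE / σ.mass E hE)|

lemma distAt_self (σ : StabilityCondition D) (E : D) (hE : ¬ IsZero E) :
    distAt σ σ E hE = 0 := by
  simp [distAt, (σ.mass_pos E hE).ne']

lemma distAt_comm (σ τ : StabilityCondition D) (E : D) (hE : ¬ IsZero E) :
    distAt σ τ E hE = distAt τ σ E hE := by
  simp only [distAt]
  rw [abs_sub_comm, abs_sub_comm (τ.phasePlus E hE), ← inv_div (σ.mass E hE), Real.log_inv,
    abs_neg]

lemma distAt_nonneg (σ τ : StabilityCondition D) (E : D) (hE : ¬ IsZero E) :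
    0 ≤ distAt σ τ E hE :=
  le_max_of_le_right (abs_nonneg _)

lemma distAt_triangle (σ τ ρ : StabilityCondition D) (E : D) (hE : ¬ IsZero E) :
    distAt σ ρ E hE ≤ distAt σ τ E hE + distAt τ ρ E hE := by
  have h (a b : StabilityCondition D) : Real.log (b.mass E hE / a.mass E hE) =
      Real.log (b.mass E hE) - Real.log (a.mass E hE) :=
    Real.log_div (b.mass_pos E hE).ne' (a.mass_pos E hE).ne'
  have key (x y z : ℝ) : |z - x| ≤ |y - x| + |z - y| := by
    rw [add_comm]; exact abs_sub_le z y x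
  simp only [distAt, h]
  refine max_le (max_le ?_ ?_) ?_
  · exact (key _ (τ.phaseMinus E hE) _).trans (add_le_add
      ((le_max_left _ _).trans (le_max_left _ _)) ((le_max_left _ _).trans (le_max_left _ _)))
  · exact (key _ (τ.phasePlus E hE) _).trans (add_le_add
      ((le_max_right _ _).trans (le_max_left _ _)) ((le_max_right _ _).trans (le_max_left _ _)))
  · exact (key _ (Real.log (τ.mass E hE)) _).trans
      (add_le_add (le_max_right _ _) (le_max_right _ _))

/-- The generalized metric on stability conditions, with values in `[0, ∞]`. -/
noncomputable instance : PseudoEMetricSpace (StabilityCondition D) where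
  edist σ τ := ⨆ (E : D) (hE : ¬ IsZero E), ENNReal.ofReal (distAt σ τ E hE)
  edist_self σ := by simp [distAt_self]
  edist_comm σ τ := by simp only [distAt_comm]
  edist_triangle σ τ ρ := by
    refine iSup₂_le fun E hE => ?_
    refine (ENNReal.ofReal_le_ofReal (distAt_triangle σ τ ρ E hE)).trans ?_
    rw [ENNReal.ofReal_add (distAt_nonneg _ _ _ _) (distAt_nonneg _ _ _ _)]
    exact add_le_add (le_iSup₂ (f := fun E hE => ENNReal.ofReal (distAt σ τ E hE)) E hE)
      (le_iSup₂ (f := fun E hE => ENNReal.ofReal (distAt τ ρ E hE)) E hE)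

end StabilityCondition

variable (D)

/-- The space of locally finite stability conditions, with the topology of the metric. -/
abbrev Stab := {σ : StabilityCondition D // σ.IsLocallyFinite}

variable {D}

/-- The set `U(A)` of locally finite stability conditions with heart `A`. -/
def U (A : ObjectProperty D) : Set (Stab D) :=
  {σ | σ.1.heart = A}

end Bridgeland

/-! ### The heart as an abelian category; its short exact sequences as triangles. -/

namespace CategoryTheory.Triangulated.TStructure

variable {D : Type u} [Category.{v} D] [Preadditive D] [HasZeroObject D] [HasShift D ℤ]
  [∀ n : ℤ, (shiftFunctor D n).Additive] [Pretriangulated D] (t : TStructure D)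

/-! A stability condition with heart `A` is the same as a charge on `K(D)` that maps the nonzero
objects of `A` into `H` and admits Harder-Narasimhan filtrations in `A`. Indeed the slices of phase
in `(0, 1]` consist of the semistable objects of `A` (`P_iff_semistable`) and all others are shifts
of these, so the charge determines everything (`eq_stabilityCondition`). Conversely, the shifts of
semistable objects form slices, and the truncation triangles glue the filtrations of the cohomology
objects into one tower (`stabilityCondition`).

Finite length makes the conditions on the charge numerical. Jordan-Hölder multiplicities are
additive (`exists_multiplicities`), and an alternating sum over cohomology extends additive
functions from `A` to `K(D)` (`exists_extension`); hence a charge is an arbitrary vector of values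
at the simple objects (`bijective_eval_simples`). If these values lie in `H`, so does the charge of
every nonzero object, since `H` is closed under addition. The quotients of a given object have
finitely many charges, so Harder-Narasimhan filtrations exist (`exists_filtration`). The phases in
`A` are bounded below by some positive number, which leaves a gap above each integer; so a short
interval of phases meets a single shift of `A`, and local finiteness follows
(`isLocallyFinite_stabilityCondition`).

For continuity of the map, a simple object `S` is semistable for every `σ` in `U(A)`; its mass and
phase are the polar coordinates of `Z(S)` and are continuous by definition of the metric. For the
inverse, finitely many points of `H` lie in a closed sector of angle less than `π`, where sums
cannot cancel; so a small change at the simple objects is a small relative change at all objects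
simultaneously (`exists_norm_sub_le`). Then phases of semistable factors move little, because
morphisms vanish between slices that are far enough apart (`slice_hom_eq_zero`). Masses are lengths
of convex Harder-Narasimhan polygons, and `Filtration.sum_along_le` compares the two polygons of one
object (`Filtration.mass_le`). Both bounds enter `edist_le`. -/

lemma _root_.CategoryTheory.Pretriangulated.distinguished_of_iso {X Y Z X' Y' Z' : D}
    {f : X ⟶ Y} {g : Y ⟶ Z} {h : Z ⟶ X⟦(1 : ℤ)⟧}
    {f' : X' ⟶ Y'} {g' : Y' ⟶ Z'} {h' : Z' ⟶ X'⟦(1 : ℤ)⟧}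
    (H : Triangle.mk f g h ∈ distTriang D) (a : X' ≅ X) (b : Y' ≅ Y) (c : Z' ≅ Z)
    (h₁ : f' ≫ b.hom = a.hom ≫ f) (h₂ : g' ≫ c.hom = b.hom ≫ g)
    (h₃ : h' ≫ a.hom⟦(1 : ℤ)⟧' = c.hom ≫ h) : Triangle.mk f' g' h' ∈ distTriang D :=
  isomorphic_distinguished _ H _ (Triangle.isoMk _ _ a b c h₁ h₂ h₃)

lemma heart_of_triangle {T : Triangle D} (hT : T ∈ distTriang D) (h₁ : t.heart T.obj₁)
    (h₃ : t.heart T.obj₃) : t.heart T.obj₂ := by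
  rw [mem_heart_iff] at *
  exact ⟨t.isLE₂ T hT 0 h₁.1 h₃.1, t.isGE₂ T hT 0 h₁.2 h₃.2⟩

lemma heart_of_isZero {X : D} (hX : IsZero X) : t.heart X := by
  rw [mem_heart_iff]
  exact ⟨t.isLE_of_isZero hX 0, t.isGE_of_isZero hX 0⟩

/-- A property of objects closed under isomorphisms, extensions and containing zero is closed
under finite products. -/
lemma _root_.CategoryTheory.ObjectProperty.isClosedUnderFiniteProducts_of_ext
    (P : ObjectProperty D) [P.IsClosedUnderIsomorphisms] (h0 : ∀ X, IsZero X → P X)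
    (hext : ∀ T ∈ distTriang D, P T.obj₁ → P T.obj₃ → P T.obj₂) :
    P.IsClosedUnderFiniteProducts := by
  have : P.ContainsZero := ⟨⟨_, isZero_zero D, h0 _ (isZero_zero D)⟩⟩
  have : P.IsClosedUnderBinaryProducts :=
    { limitsOfShape_le := by
        rintro X ⟨p⟩
        refine P.prop_of_iso ?_ (hext _ (binaryProductTriangle_distinguished _ _)
          (p.prop_diag_obj (.mk .left)) (p.prop_diag_obj (.mk .right)))
        exact IsLimit.conePointUniqueUpToIso (prodIsProd _ _)
          ((IsLimit.postcomposeHomEquiv (diagramIsoPair p.diag) _).2 p.isLimit) }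
  exact .mk'

instance : t.heart.IsClosedUnderFiniteProducts :=
  t.heart.isClosedUnderFiniteProducts_of_ext (fun _ => t.heart_of_isZero)
    fun _ hT => t.heart_of_triangle hT

lemma heart_hom_eq_zero ⦃X Y : t.heart.FullSubcategory⦄ ⦃n : ℤ⦄
    (f : t.heart.ι.obj X ⟶ (t.heart.ι.obj Y)⟦n⟧) (hn : n < 0) : f = 0 := by
  have := ((t.mem_heart_iff _).1 X.property).1
  have : t.IsGE (t.heart.ι.obj Y) 0 := ((t.mem_heart_iff _).1 Y.property).2
  exact t.zero_of_isLE_of_isGE f 0 (-n) (by lia) ‹_› (t.isGE_shift _ 0 n (-n))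

/-- The cone of a morphism of the heart lives in degrees `-1` and `0`. Truncating it gives a
triangle whose outer terms are, up to a shift, the kernel and the cokernel; this is the criterion
for the heart to be abelian. -/
lemma heart_admissible : AbelianSubcategory.admissibleMorphism t.heart.ι = ⊤ := by
  ext X Y f
  simp only [MorphismProperty.top_apply, iff_true]
  intro C f₂ f₃ hT
  have hX := (t.mem_heart_iff _).1 X.property
  have hY := (t.mem_heart_iff _).1 Y.property
  have h1 : t.IsLE C 0 := by
    have := hX.1
    have := t.isLE_shift X.obj 0 1 (-1)
    have := t.isLE_of_le (X.obj⟦(1 : ℤ)⟧) (-1) 0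
    exact t.isLE₂ _ (rot_of_distTriang _ hT) 0 hY.1 this
  have h2 : t.IsGE C (-1) := by
    have h := hX.2
    have h' := hY.2
    exact t.isGE₂ _ (rot_of_distTriang _ hT) (-1) (t.isGE_of_ge Y.obj (-1) 0)
      (t.isGE_shift X.obj 0 1 (-1))
  obtain ⟨K', Q, hK, hQ, α, β, γ, h⟩ := t.exists_triangle C (-1) 0 (by lia)
  rw [le_iff_isLE] at hK
  rw [ge_iff_isGE] at hQ
  have hK' : t.IsGE K' (-1) := by
    refine t.isGE₂ _ (inv_rot_of_distTriang _ h) (-1) ?_ h2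
    have := t.isGE_shift Q 0 (-1) 1
    exact t.isGE_of_ge (Q⟦(-1 : ℤ)⟧) (-1) 1
  have hQ' : t.IsLE Q 0 := by
    refine t.isLE₂ _ (rot_of_distTriang _ h) 0 h1 ?_
    have := t.isLE_shift K' (-1) 1 (-2)
    exact t.isLE_of_le (K'⟦(1 : ℤ)⟧) (-2) 0
  let e : K'⟦(-1 : ℤ)⟧⟦(1 : ℤ)⟧ ≅ K' := (shiftEquiv D (1 : ℤ)).counitIso.app K'
  refine ⟨⟨K'⟦(-1 : ℤ)⟧, (t.mem_heart_iff _).2 ⟨t.isLE_shift K' (-1) (-1) 0,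
    t.isGE_shift K' (-1) (-1) 0⟩⟩, ⟨Q, (t.mem_heart_iff _).2 ⟨hQ', hQ⟩⟩,
    e.hom ≫ α, β, γ ≫ e.inv⟦(1 : ℤ)⟧', ?_⟩
  exact distinguished_of_iso h e (Iso.refl _) (Iso.refl _) (by simp) (by simp)
    (by rw [Category.assoc, ← Functor.map_comp]; simp)

noncomputable instance [IsTriangulated D] : Abelian t.heart.FullSubcategory :=
  AbelianSubcategory.abelian t.heart.ι t.heart_hom_eq_zero t.heart_admissible

variable [IsTriangulated D]

/-- An epimorphism of the heart is completed to a triangle by some object of the heart, which is a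
kernel; uniqueness of kernels identifies it with `S.X₁`. -/
lemma exists_triangle_of_shortExact {S : ShortComplex t.heart.FullSubcategory}
    (hS : S.ShortExact) : ∃ δ : S.X₃.obj ⟶ S.X₁.obj⟦(1 : ℤ)⟧,
      Triangle.mk S.f.hom S.g.hom δ ∈ distTriang D := by
  have := hS.epi_g
  obtain ⟨X₁, i, δ, h⟩ := AbelianSubcategory.exists_distinguished_triangle_of_epi
    t.heart_hom_eq_zero t.heart_admissible S.g
  obtain ⟨e, he⟩ : ∃ e : S.X₁ ≅ X₁, e.hom ≫ i = S.f :=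
    ⟨_, IsLimit.conePointUniqueUpToIso_hom_comp hS.fIsKernel
      (AbelianSubcategory.isLimitKernelForkOfDistTriang t.heart_hom_eq_zero _ _ _ h)
      WalkingParallelPair.zero⟩
  refine ⟨δ ≫ (t.heart.ι.map e.inv)⟦(1 : ℤ)⟧', ?_⟩
  refine distinguished_of_iso h (t.heart.ι.mapIso e) (Iso.refl _) (Iso.refl _) ?_ ?_ ?_
  · rw [← he]; exact Category.comp_id _
  · exact (Category.comp_id _).trans (Category.id_comp _).symm
  · have : (t.heart.ι.map e.inv)⟦(1 : ℤ)⟧' ≫ ((t.heart.ι.mapIso e).hom)⟦(1 : ℤ)⟧' = 𝟙 _ := by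
      rw [← Functor.map_comp, Functor.mapIso_hom, ← Functor.map_comp, e.inv_hom_id,
        Functor.map_id, Functor.map_id]
    rw [Category.assoc, this]
    exact (Category.comp_id _).trans (Category.id_comp _).symm

lemma shortExact_of_triangle {X Y Z : t.heart.FullSubcategory} (f : X ⟶ Y) (g : Y ⟶ Z)
    (δ : Z.obj ⟶ X.obj⟦(1 : ℤ)⟧) (h : Triangle.mk f.hom g.hom δ ∈ distTriang D) :
    ∃ w, (ShortComplex.mk f g w).ShortExact := by
  have w : f ≫ g = 0 := t.heart.ι.map_injective (by
    rw [Functor.map_comp, Functor.map_zero]; exact comp_distTriang_mor_zero₁₂ _ h)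
  have h1 : IsLimit (KernelFork.ofι f w) :=
    AbelianSubcategory.isLimitKernelForkOfDistTriang t.heart_hom_eq_zero f g δ h
  have h2 : IsColimit (CokernelCofork.ofπ g w) :=
    AbelianSubcategory.isColimitCokernelCoforkOfDistTriang t.heart_hom_eq_zero f g δ h
  have hf : Mono f := mono_of_isLimit_fork h1
  have hg : Epi g := epi_of_isColimit_cofork h2
  exact ⟨w, { exact := ShortComplex.exact_of_f_is_kernel (ShortComplex.mk f g w) h1
              mono_f := hf
              epi_g := hg }⟩

end CategoryTheory.Triangulated.TStructure

/-! ### Dévissage along truncations and the cohomology functor of the t-structure. -/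

namespace CategoryTheory.Triangulated.TStructure

variable {D : Type u} [Category.{v} D] [Preadditive D] [HasZeroObject D] [HasShift D ℤ]
  [∀ n : ℤ, (shiftFunctor D n).Additive] [Pretriangulated D] (t : TStructure D)

/-- Dévissage for bounded objects: the induction step adds one cohomology object on the right. -/
lemma bounded_induction (Q : ℤ → D → Prop) (h0 : ∀ b X, IsZero X → Q b X)
    (step : ∀ (b : ℤ) (T : Triangle D), T ∈ distTriang D → t.IsLE T.obj₁ (b - 1) →
      Q (b - 1) T.obj₁ → t.IsLE T.obj₃ b → t.IsGE T.obj₃ b → Q b T.obj₂)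
    (a b : ℤ) (E : D) (hb : t.IsLE E b) (ha : t.IsGE E a) : Q b E := by
  -- Induction on a bound for the number of degrees in `[a, b]`; for `n = 0` the interval is empty
  -- and the object is zero.
  obtain ⟨n, hn⟩ : ∃ n : ℕ, b < a + n := ⟨(b - a + 1).toNat, by lia⟩
  induction n generalizing b E with
  | zero => exact h0 b E (t.isZero E b a (by simpa using hn))
  | succ n ih =>
    by_cases hab : b < a
    · exact h0 b E (t.isZero E b a hab)
    obtain ⟨X, Y, hX, hY, f, g, h, hT⟩ := t.exists_triangle E (b - 1) b (by lia)
    rw [le_iff_isLE] at hX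
    rw [ge_iff_isGE] at hY
    have hY' : t.IsLE Y b := by
      refine t.isLE₂ _ (rot_of_distTriang _ hT) b hb ?_
      have := t.isLE_shift X (b - 1) 1 (b - 2)
      exact t.isLE_of_le (X⟦(1 : ℤ)⟧) (b - 2) b
    have hX' : t.IsGE X a := by
      refine t.isGE₂ _ (inv_rot_of_distTriang _ hT) a ?_ ha
      have := t.isGE_shift Y b (-1) (b + 1)
      exact t.isGE_of_ge (Y⟦(-1 : ℤ)⟧) a (b + 1)
    exact step b _ hT hX (ih (b - 1) X hX hX' (by push_cast at hn; lia)) hY' hY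

lemma bounded_induction' (ht : ∀ X, t.bounded X) (Q : D → Prop) (h0 : ∀ X, IsZero X → Q X)
    (step : ∀ (b : ℤ) (T : Triangle D), T ∈ distTriang D → t.IsLE T.obj₁ (b - 1) →
      Q T.obj₁ → t.IsLE T.obj₃ b → t.IsGE T.obj₃ b → Q T.obj₂) (E : D) : Q E := by
  obtain ⟨⟨a, ha⟩, ⟨b, hb⟩⟩ := ht E
  exact t.bounded_induction (fun _ => Q) (fun _ => h0) step a b E hb ha

section Cohomology

/-- The cohomology functor in degree zero, as an endofunctor. -/
noncomputable def H₀ : D ⥤ D := t.truncLT 1 ⋙ t.truncGE 0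

lemma isLE_truncGE_of_isLE (X : D) [t.IsLE X 0] : t.IsLE ((t.truncGE 0).obj X) 0 := by
  refine t.isLE₂ _ (rot_of_distTriang _ (t.triangleLTGE_distinguished 0 X)) 0 ‹_› ?_
  have : t.IsLE ((t.truncLT 0).obj X) (-1) := t.isLE_truncLT_obj _ _ _
  have := t.isLE_shift ((t.truncLT 0).obj X) (-1) 1 (-2)
  exact t.isLE_of_le (((t.truncLT 0).obj X)⟦(1 : ℤ)⟧) (-2) 0

lemma H₀_isLE (X : D) : t.IsLE (t.H₀.obj X) 0 := by
  have : t.IsLE ((t.truncLT 1).obj X) 0 := t.isLE_truncLT_obj X 1 0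
  exact t.isLE_truncGE_of_isLE _

lemma H₀_isGE (X : D) : t.IsGE (t.H₀.obj X) 0 := t.isGE_truncGE_obj _ _ _

/-- The truncation `≤ 0` maps to the object and to its cohomology in degree zero. -/
lemma exists_truncation (X : D) : ∃ (N : D) (a : N ⟶ (t.truncLT 1).obj X)
    (d : t.H₀.obj X ⟶ N⟦(1 : ℤ)⟧) (π : (t.truncLT 1).obj X ⟶ t.H₀.obj X),
    π = (t.truncGEπ 0).app ((t.truncLT 1).obj X) ∧ t.IsLE N (-1) ∧
      Triangle.mk a π d ∈ distTriang D :=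
  ⟨_, _, _, _, rfl, t.isLE_truncLT_obj _ _ _, t.triangleLTGE_distinguished 0 _⟩

variable {t}

/-- Exactness of cohomology in terms of generalized elements: an element of the middle term that
dies on the right comes from the left after passing to a cover `p`. The covers arise as fibres of
maps to objects concentrated in negative degrees, which the heart does not see. -/
lemma exists_lift_H₀ {X Y Z : D} {f : X ⟶ Y} {g : Y ⟶ Z} {h : Z ⟶ X⟦(1 : ℤ)⟧}
    (hT : Triangle.mk f g h ∈ distTriang D) {A : D} (hA : t.heart A)
    (y : A ⟶ t.H₀.obj Y) (hy : y ≫ t.H₀.map g = 0) :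
    ∃ (R : D) (_ : t.heart R) (p : R ⟶ A) (x : R ⟶ t.H₀.obj X),
      (∀ (M : D) (m : A ⟶ M), t.heart M → p ≫ m = 0 → m = 0) ∧
        p ≫ y = x ≫ t.H₀.map f := by
  obtain ⟨hA0, hA1⟩ := (t.mem_heart_iff _).1 hA
  obtain ⟨N, a, d, πY, eY, hN, hY⟩ := t.exists_truncation Y
  obtain ⟨N', a', d', πZ, eZ, hN', hZ⟩ := t.exists_truncation Z
  obtain ⟨_, _, _, πX, eX, _, _⟩ := t.exists_truncation X
  obtain ⟨iX, hiX⟩ : ∃ i : (t.truncLT 1).obj X ⟶ X, i = (t.truncLTι 1).app X := ⟨_, rfl⟩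
  obtain ⟨iY, hiY⟩ : ∃ i : (t.truncLT 1).obj Y ⟶ Y, i = (t.truncLTι 1).app Y := ⟨_, rfl⟩
  obtain ⟨iZ, hiZ⟩ : ∃ i : (t.truncLT 1).obj Z ⟶ Z, i = (t.truncLTι 1).app Z := ⟨_, rfl⟩
  have nf : (t.truncLT 1).map f ≫ iY = iX ≫ f := by
    rw [hiX, hiY]; exact (t.truncLTι 1).naturality f
  have ng : (t.truncLT 1).map g ≫ iZ = iY ≫ g := by
    rw [hiY, hiZ]; exact (t.truncLTι 1).naturality g
  have pf : (t.truncLT 1).map f ≫ πY = πX ≫ t.H₀.map f := by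
    rw [eX, eY]; exact (t.truncGEπ 0).naturality _
  have pg : (t.truncLT 1).map g ≫ πZ = πY ≫ t.H₀.map g := by
    rw [eY, eZ]; exact (t.truncGEπ 0).naturality _
  -- `T'` plays the role of the pullback of `A` along the map from the truncation `≤ 0` of `Y` to
  -- its cohomology.
  obtain ⟨T', j, q, hT'⟩ := distinguished_cocone_triangle₂ (y ≫ d)
  obtain ⟨b, hb⟩ : ∃ b : T' ⟶ (t.truncLT 1).obj Y, q ≫ y = b ≫ πY := by
    obtain ⟨b, -, hb2⟩ := complete_distinguished_triangle_morphism₂ _ _ hT' hY (𝟙 N) y (by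
      erw [Functor.map_id]; exact Category.comp_id _)
    exact ⟨b, hb2⟩
  have hT'0 : t.IsLE T' 0 := t.isLE₂ _ hT' 0 (t.isLE_of_le N (-1) 0) hA0
  obtain ⟨c, hc⟩ : ∃ c : T' ⟶ N', b ≫ (t.truncLT 1).map g = c ≫ a' :=
    Triangle.coyoneda_exact₂ _ hZ (b ≫ (t.truncLT 1).map g) (by
      change (b ≫ (t.truncLT 1).map g) ≫ πZ = 0
      rw [Category.assoc, pg, ← Category.assoc, ← hb, Category.assoc, hy, comp_zero])
  -- On the fibre of `c` the map to `Z` vanishes, so the map to `Y` lifts to `X`.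
  obtain ⟨T₁, r, e, hT₁⟩ := distinguished_cocone_triangle₁ c
  have hT₁0 : t.IsLE T₁ 0 := by
    refine t.isLE₂ _ (inv_rot_of_distTriang _ hT₁) 0 ?_ hT'0
    exact t.isLE_shift N' (-1) (-1) 0
  have hrc : r ≫ c = 0 := comp_distTriang_mor_zero₁₂ _ hT₁
  have hg : (r ≫ b ≫ iY) ≫ g = 0 := by
    rw [Category.assoc, Category.assoc, ← ng, ← Category.assoc b, hc, Category.assoc,
      ← Category.assoc, hrc, zero_comp]
  obtain ⟨x₀, hx₀⟩ : ∃ x₀ : T₁ ⟶ X, r ≫ b ≫ iY = x₀ ≫ f := Triangle.coyoneda_exact₂ _ hT _ hg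
  obtain ⟨x₁, hx₁⟩ : ∃ x₁ : T₁ ⟶ (t.truncLT 1).obj X, x₁ ≫ iX = x₀ :=
    ⟨t.liftTruncLT x₀ 0 1 (by lia), by rw [hiX]; exact t.liftTruncLT_ι x₀ 0 1 (by lia)⟩
  have hrb : r ≫ b = x₁ ≫ (t.truncLT 1).map f := by
    have hT₁1 : t.IsLE T₁ (1 - 1) := hT₁0
    apply t.to_truncLT_obj_ext
    rw [← hiY, Category.assoc, hx₀, Category.assoc, nf, ← hx₁, Category.assoc]
  obtain ⟨p₁, hp₁⟩ : ∃ p : T₁ ⟶ (t.truncGE 0).obj T₁, p = (t.truncGEπ 0).app T₁ := ⟨_, rfl⟩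
  have hGX := t.H₀_isGE X
  have hGY := t.H₀_isGE Y
  obtain ⟨p, hp⟩ : ∃ p : (t.truncGE 0).obj T₁ ⟶ A, p₁ ≫ p = r ≫ q :=
    ⟨t.descTruncGE (r ≫ q) 0, by rw [hp₁]; exact t.π_descTruncGE _ _⟩
  obtain ⟨x, hx⟩ : ∃ x : (t.truncGE 0).obj T₁ ⟶ t.H₀.obj X, p₁ ≫ x = x₁ ≫ πX :=
    ⟨t.descTruncGE (x₁ ≫ πX) 0, by rw [hp₁]; exact t.π_descTruncGE _ _⟩
  refine ⟨(t.truncGE 0).obj T₁, (t.mem_heart_iff _).2 ⟨t.isLE_truncGE_of_isLE T₁, inferInstance⟩,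
    p, x, ?_, ?_⟩
  -- `p` is an epimorphism of the heart: the obstructions factor through `N'` and `N⟦1⟧`, which have
  -- no nonzero maps to the heart for degree reasons.
  · intro M m hM hm
    obtain ⟨hM0, hM1⟩ := (t.mem_heart_iff _).1 hM
    have h1 : r ≫ q ≫ m = 0 := by
      rw [← Category.assoc, ← hp, Category.assoc, hm, comp_zero]
    obtain ⟨m', hm'⟩ := Triangle.yoneda_exact₂ _ hT₁ (q ≫ m) h1
    have h2 : m' = 0 := t.zero_of_isLE_of_isGE m' (-1) 0 (by lia) hN' hM1
    rw [h2, comp_zero] at hm'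
    obtain ⟨m'', hm''⟩ := Triangle.yoneda_exact₃ _ hT' m hm'
    have h3 : m'' = 0 := t.zero_of_isLE_of_isGE m'' (-2) 0 (by lia)
      (t.isLE_shift N (-1) 1 (-2)) hM1
    rw [hm'', h3]; exact comp_zero
  · apply t.from_truncGE_obj_ext
    rw [← hp₁, ← Category.assoc, ← Category.assoc, hp, hx, Category.assoc, hb,
      ← Category.assoc, hrb, Category.assoc, Category.assoc, pf]

variable (t)

/-- The cohomology functor in degree zero, with values in the heart. -/
noncomputable def heartCohomology : D ⥤ t.heart.FullSubcategory :=
  t.heart.lift t.H₀ fun X => (t.mem_heart_iff _).2 ⟨t.H₀_isLE X, t.H₀_isGE X⟩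

instance : t.H₀.Additive := by unfold H₀; infer_instance

instance : t.heartCohomology.Additive where
  map_add {X Y f g} := t.heart.ι.map_injective (by
    change t.H₀.map (f + g) = t.H₀.map f + t.H₀.map g
    exact Functor.map_add _)

noncomputable instance [IsTriangulated D] : t.heartCohomology.IsHomological where
  exact T hT := by
    rw [ShortComplex.exact_iff_exact_up_to_refinements]
    intro A y hy
    obtain ⟨R, hR, p, x, hp, hpy⟩ := exists_lift_H₀ hT A.property y.hom
      (congrArg (fun f => f.hom) hy)
    refine ⟨⟨R, hR⟩, ObjectProperty.homMk p, ?_, ObjectProperty.homMk x, ?_⟩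
    · exact Preadditive.epi_of_cancel_zero _ fun {M} m hm =>
        t.heart.ι.map_injective (hp M.obj m.hom M.property (congrArg (fun f => f.hom) hm))
    · exact t.heart.ι.map_injective hpy

/-- On the heart, cohomology in degree zero is the identity. -/
noncomputable def heartCohomologyIso (X : t.heart.FullSubcategory) :
    t.heartCohomology.obj X.obj ≅ X := t.heart.ι.preimageIso (by
  have h := (t.mem_heart_iff _).1 X.property
  have := h.1
  have := h.2
  have h1 : IsIso ((t.truncLTι 1).app X.obj) :=
    (t.isLE_iff_isIso_truncLTι_app 0 1 (by lia) X.obj).1 h.1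
  have h2 : IsIso ((t.truncGEπ 0).app X.obj) := inferInstance
  exact (t.truncGE 0).mapIso (asIso ((t.truncLTι 1).app X.obj)) ≪≫
    (asIso ((t.truncGEπ 0).app X.obj)).symm)

lemma isZero_of_isZero_obj {X : t.heart.FullSubcategory} (hX : IsZero X.obj) : IsZero X := by
  rw [IsZero.iff_id_eq_zero] at *
  exact t.heart.ι.map_injective hX

lemma isZero_heartCohomology_of_isLE (X : D) [t.IsLE X (-1)] :
    IsZero (t.heartCohomology.obj X) := by
  have : t.IsLE ((t.truncLT 1).obj X) (-1) := inferInstance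
  exact t.isZero_of_isZero_obj (t.isZero_truncGE_obj_of_isLE (-1) 0 (by lia) _)

lemma isZero_heartCohomology_of_isGE (X : D) [t.IsGE X 1] :
    IsZero (t.heartCohomology.obj X) :=
  t.isZero_of_isZero_obj ((t.truncGE 0).map_isZero (t.isZero_truncLT_obj_of_isGE 1 X))

end Cohomology

end CategoryTheory.Triangulated.TStructure

/-! ### Additive functions and their extension by Euler characteristics. -/

namespace CategoryTheory

/-- A function on the objects of an abelian category is additive if it is additive on short exact
sequences. -/
def IsAdditiveOn {A : Type*} [Category* A] [Abelian A] {G : Type*} [AddCommGroup G]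
    (l : A → G) : Prop :=
  ∀ S : ShortComplex A, S.ShortExact → l S.X₂ = l S.X₁ + l S.X₃

namespace IsAdditiveOn

variable {A : Type*} [Category* A] [Abelian A] {G : Type*} [AddCommGroup G]
  {l : A → G} (hl : IsAdditiveOn l)

include hl

lemma eq_zero {X : A} (hX : IsZero X) : l X = 0 := by
  have h : (ShortComplex.mk (0 : X ⟶ X) (0 : X ⟶ X) zero_comp).ShortExact :=
    { exact := ShortComplex.exact_of_isZero_X₂ _ hX
      mono_f := ⟨fun _ _ _ => hX.eq_of_tgt _ _⟩
      epi_g := ⟨fun _ _ _ => hX.eq_of_src _ _⟩ }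
  simpa using hl _ h

lemma mono {X Y : A} (f : X ⟶ Y) [Mono f] : l Y = l X + l (cokernel f) :=
  hl (ShortComplex.mk f (cokernel.π f) (cokernel.condition f))
    { exact := ShortComplex.exact_of_g_is_cokernel _ (cokernelIsCokernel f) }

lemma epi {X Y : A} (f : X ⟶ Y) [Epi f] : l X = l (kernel f) + l Y :=
  hl (ShortComplex.mk (kernel.ι f) f (kernel.condition f))
    { exact := ShortComplex.exact_of_f_is_kernel _ (kernelIsKernel f) }

lemma iso {X Y : A} (e : X ≅ Y) : l X = l Y := by
  rw [hl.epi e.hom, hl.eq_zero (isZero_kernel_of_mono _), zero_add]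

lemma image {X Y : A} (f : X ⟶ Y) : l X = l (kernel f) + l (Limits.image f) := by
  rw [hl.epi (factorThruImage f), hl.iso (kernelFactorThruImage f)]

lemma exact {S : ShortComplex A} (hS : S.Exact) :
    l S.X₂ = l (Limits.image S.f) + l (Limits.image S.g) := by
  rw [hl.image S.g, ← hl.iso (kernelSubobjectIso S.g), ← hl.iso (imageSubobjectIso S.f),
    (ShortComplex.exact_iff_image_eq_kernel S).1 hS]

end IsAdditiveOn

/-- Each correction `a k` occurs in the degrees `k` and `k + 1`, with opposite signs, so the
corrections cancel. -/
lemma finsum_negOnePow_eq_add {G : Type*} [AddCommGroup G] {x y z a : ℤ → G} (hx : x.support.Finite)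
    (hz : z.support.Finite) (ha : a.support.Finite)
    (h : ∀ k, y k = x k + z k - a k - a (k - 1)) :
    ∑ᶠ k : ℤ, (k.negOnePow : ℤ) • y k =
      ∑ᶠ k : ℤ, (k.negOnePow : ℤ) • x k + ∑ᶠ k : ℤ, (k.negOnePow : ℤ) • z k := by
  have hfin {w : ℤ → G} (hw : w.support.Finite) :
      (fun k : ℤ => (k.negOnePow : ℤ) • w k).HasFiniteSupport :=
    hw.subset fun k hk h0 => hk (by simp [h0])
  have ha' : (fun k : ℤ => (k.negOnePow : ℤ) • a (k - 1)).HasFiniteSupport := by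
    refine (ha.image (fun k => k + 1)).subset fun k hk => ⟨k - 1, fun h0 => hk (by simp [h0]), ?_⟩
    simp
  have key : ∑ᶠ k : ℤ, (k.negOnePow : ℤ) • a (k - 1) = - ∑ᶠ k : ℤ, (k.negOnePow : ℤ) • a k := by
    rw [← finsum_comp_equiv (Equiv.addRight (1 : ℤ)), ← finsum_neg_distrib]
    simp [Int.negOnePow_succ]
  have : ∀ k : ℤ, (k.negOnePow : ℤ) • y k = ((k.negOnePow : ℤ) • x k + (k.negOnePow : ℤ) • z k) -
      ((k.negOnePow : ℤ) • a k + (k.negOnePow : ℤ) • a (k - 1)) := fun k => by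
    rw [h, smul_sub, smul_sub, smul_add]; abel
  have e := finsum_sub_distrib ((hfin hx).add (hfin hz)) ((hfin ha).add ha')
  simp only [Pi.add_apply] at e
  rw [finsum_congr this, e, finsum_add_distrib (hfin hx) (hfin hz), finsum_add_distrib (hfin ha) ha', key]
  abel

namespace Triangulated.TStructure

variable {D : Type u} [Category.{v} D] [Preadditive D] [HasZeroObject D] [HasShift D ℤ]
  [∀ n : ℤ, (shiftFunctor D n).Additive] [Pretriangulated D] [IsTriangulated D] (t : TStructure D)
  {G : Type*} [AddCommGroup G] (l : t.heart.FullSubcategory → G)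

noncomputable instance : t.heartCohomology.ShiftSequence ℤ := .tautological _ _

/-- The alternating sum of the values of `l` on the cohomology objects. -/
noncomputable def eulerChar (X : D) : G :=
  ∑ᶠ k : ℤ, (k.negOnePow : ℤ) • l ((t.heartCohomology.shift k).obj X)

omit [IsTriangulated D] in
lemma isZero_shift_heartCohomology {X : D} {k : ℤ} (h : t.IsLE X (k - 1) ∨ t.IsGE X (k + 1)) :
    IsZero ((t.heartCohomology.shift k).obj X) := by
  change IsZero (t.heartCohomology.obj (X⟦k⟧))
  rcases h with h | h
  · have := t.isLE_shift X (k - 1) k (-1)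
    exact t.isZero_heartCohomology_of_isLE _
  · have := t.isGE_shift X (k + 1) k 1
    exact t.isZero_heartCohomology_of_isGE _

omit [IsTriangulated D] in
lemma finite_shift_heartCohomology (ht : ∀ X, t.bounded X) (X : D) :
    {k : ℤ | ¬ IsZero ((t.heartCohomology.shift k).obj X)}.Finite := by
  obtain ⟨⟨a, ha⟩, ⟨b, hb⟩⟩ := ht X
  refine (Set.finite_Icc a b).subset fun k hk => ?_
  by_contra h
  refine hk (t.isZero_shift_heartCohomology ?_)
  rw [Set.mem_Icc, not_and_or] at h
  rcases h with h | h
  · exact Or.inr (t.isGE_of_ge X (k + 1) a)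
  · exact Or.inl (t.isLE_of_le X b (k - 1))

variable {l}

/-- The long exact sequence is cut at its images. The images of the connecting morphisms are the
defects of additivity in single degrees, and they cancel in the alternating sum. -/
lemma eulerChar_triangle (ht : ∀ X, t.bounded X) (hl : IsAdditiveOn l) (T : Triangle D)
    (hT : T ∈ distTriang D) :
    t.eulerChar l T.obj₂ = t.eulerChar l T.obj₁ + t.eulerChar l T.obj₃ := by
  have hfin (X : D) : (fun k => l ((t.heartCohomology.shift k).obj X)).support.Finite :=
    (t.finite_shift_heartCohomology ht X).subset fun k hk h0 => hk (hl.eq_zero h0)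
  let F := t.heartCohomology
  refine finsum_negOnePow_eq_add (hfin _) (hfin _)
    (a := fun k => l (image (F.homologySequenceδ T k (k + 1) rfl))) ?_ ?_
  · refine (t.finite_shift_heartCohomology ht T.obj₃).subset fun k hk h0 => hk (hl.eq_zero ?_)
    rw [IsZero.iff_id_eq_zero, ← cancel_epi (factorThruImage _)]
    exact h0.eq_of_src _ _
  · intro k
    have h1 := hl.exact (F.homologySequence_exact₁ T hT (k - 1) k (by lia))
    have h2 := hl.exact (F.homologySequence_exact₂ T hT k)
    have h3 := hl.exact (F.homologySequence_exact₃ T hT k (k + 1) rfl)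
    dsimp only at h1 h2 h3
    -- The same connecting morphism, with its target degree written as `k - 1 + 1` and as `k`.
    have h4 : l (image (F.homologySequenceδ T (k - 1) (k - 1 + 1) rfl)) =
        l (image (F.homologySequenceδ T (k - 1) k (by lia))) := by
      congr! 2 <;> lia
    rw [h1, h2, h3, h4]
    abel

lemma eulerChar_heart (hl : IsAdditiveOn l) (X : t.heart.FullSubcategory) :
    t.eulerChar l X.obj = l X := by
  obtain ⟨h0, h1⟩ := (t.mem_heart_iff _).1 X.property
  rw [eulerChar, finsum_eq_single _ (0 : ℤ)]
  · rw [Int.negOnePow_zero, Units.val_one, one_smul]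
    exact hl.iso (t.heartCohomology.mapIso ((shiftFunctorZero D ℤ).app X.obj) ≪≫
      t.heartCohomologyIso X)
  · intro k hk
    rw [hl.eq_zero, smul_zero]
    refine t.isZero_shift_heartCohomology ?_
    rcases lt_or_gt_of_ne hk with h | h
    · exact Or.inr (t.isGE_of_ge X.obj (k + 1) 0)
    · exact Or.inl (t.isLE_of_le X.obj 0 (k - 1))

/-- An additive function on the heart of a bounded t-structure extends to the Grothendieck
group of the triangulated category. -/
lemma exists_extension (ht : ∀ X, t.bounded X) (hl : IsAdditiveOn l) :
    ∃ W : Bridgeland.K D →+ G, ∀ X : t.heart.FullSubcategory, W (Bridgeland.K.of X.obj) = l X := by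
  refine ⟨QuotientAddGroup.lift _ (FreeAbelianGroup.lift (t.eulerChar l)) ?_, fun X => ?_⟩
  · rw [Bridgeland.triangleRelations, AddSubgroup.closure_le]
    rintro _ ⟨T, hT, rfl⟩
    simp [t.eulerChar_triangle ht hl T hT]
  · rw [Bridgeland.K.of, QuotientAddGroup.lift_mk, FreeAbelianGroup.lift_apply_of,
      t.eulerChar_heart hl]

end Triangulated.TStructure

end CategoryTheory

/-! ### Composition series and Jordan-Hölder multiplicities. -/

namespace CategoryTheory

variable {A : Type u} [Category.{v} A] [Abelian A]

/-- A nonzero noetherian object of an abelian category has a simple quotient. -/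
lemma exists_simple_quotient (E : A) [IsNoetherianObject E] (hE : ¬ IsZero E) :
    ∃ (Q : A) (g : E ⟶ Q), Simple Q ∧ Epi g := by
  have hwf : WellFoundedGT (Subobject E) := inferInstance
  -- For the well-founded relation `>` a minimal element is a maximal proper subobject; its cokernel
  -- is the simple quotient.
  obtain ⟨Y, hY, hmax⟩ := hwf.wf.has_min {Y : Subobject E | Y ≠ ⊤} ⟨⊥, fun h => hE (by
    rw [IsZero.iff_id_eq_zero]
    have : (⊥ : Subobject E).arrow = 0 := Subobject.bot_arrow
    have h1 : IsIso (⊥ : Subobject E).arrow := by rw [h]; infer_instance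
    rw [← cancel_epi (⊥ : Subobject E).arrow, this]; simp)⟩
  refine ⟨cokernel Y.arrow, cokernel.π Y.arrow, ?_, inferInstance⟩
  refine simple_of_cosimple _ fun {R} q _ => ⟨fun hq h0 => ?_, fun hq => ?_⟩
  · refine hY ?_
    have hz : cokernel.π Y.arrow = 0 := by
      rw [← cancel_mono q, h0, comp_zero, comp_zero]
    have : Epi Y.arrow := Preadditive.epi_of_cokernel_zero hz
    have : IsIso Y.arrow := isIso_of_mono_of_epi _
    exact Subobject.eq_top_of_isIso_arrow Y
  · have hle : Y ≤ kernelSubobject (cokernel.π Y.arrow ≫ q) :=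
      le_kernelSubobject _ _ (by rw [← Category.assoc, cokernel.condition, zero_comp])
    have hne : kernelSubobject (cokernel.π Y.arrow ≫ q) ≠ ⊤ := fun h => hq (by
      have h1 : IsIso (kernelSubobject (cokernel.π Y.arrow ≫ q)).arrow := by
        rw [h]; infer_instance
      have h2 := kernelSubobject_arrow_comp (cokernel.π Y.arrow ≫ q)
      rwa [← cancel_epi (cokernel.π Y.arrow),
        ← cancel_epi (kernelSubobject (cokernel.π Y.arrow ≫ q)).arrow, comp_zero, comp_zero])
    have heq : kernelSubobject (cokernel.π Y.arrow ≫ q) = Y := by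
      by_contra h
      exact hmax _ hne (lt_of_le_of_ne hle (Ne.symm h))
    have : Mono q := Preadditive.mono_of_cancel_zero _ fun {T} g hg => by
      obtain ⟨T', π, _, e, he⟩ := surjective_up_to_refinements_of_epi (cokernel.π Y.arrow) g
      have h1 : e ≫ cokernel.π Y.arrow ≫ q = 0 := by
        rw [← Category.assoc, ← he, Category.assoc, hg, comp_zero]
      have h2 : Y.Factors e := by
        rw [← heq]; exact (kernelSubobject_factors_iff _ _).2 h1
      rw [← cancel_epi π, he, ← Y.factorThru_arrow e h2, Category.assoc, cokernel.condition,
        comp_zero, comp_zero]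
    exact isIso_of_mono_of_epi q

section Composition

variable {ι : Type*} [DecidableEq ι] (S : ι → A)

/-- `HasComposition S E m` holds if `E` has a composition series where each `S i` occurs `m i`
times as a factor. -/
inductive HasComposition : A → (ι → ℕ) → Prop
  | zero (X : A) (hX : IsZero X) : HasComposition X 0
  | step {X E : A} (i : ι) (f : X ⟶ E) (g : E ⟶ S i) (w : f ≫ g = 0)
      (h : (ShortComplex.mk f g w).ShortExact) (m : ι → ℕ) (hX : HasComposition X m) :
      HasComposition E (m + Pi.single i 1)

variable {S}

lemma shortExact_kernel {X Y : A} (g : X ⟶ Y) [Epi g] :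
    (ShortComplex.mk (kernel.ι g) g (kernel.condition g)).ShortExact :=
  { exact := ShortComplex.exact_of_f_is_kernel _ (kernelIsKernel g) }

lemma HasComposition.of_iso {X Y : A} {m : ι → ℕ} (h : HasComposition S X m) (e : X ≅ Y) :
    HasComposition S Y m := by
  cases h with
  | zero _ hX => exact .zero _ (hX.of_iso e.symm)
  | step i f g w hse m hm =>
    refine .step i (f ≫ e.hom) (e.inv ≫ g) (by simp [w]) ?_ m hm
    have e' : ShortComplex.mk f g w ≅ ShortComplex.mk (f ≫ e.hom) (e.inv ≫ g) (by simp [w]) :=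
      ShortComplex.isoMk (Iso.refl _) e (Iso.refl _) (by simp) (by simp)
    exact ShortComplex.shortExact_of_iso e' hse

lemma HasComposition.eq_zero (hS : ∀ i, Simple (S i)) {X : A} {m : ι → ℕ}
    (h : HasComposition S X m) (hX : IsZero X) : m = 0 := by
  cases h with
  | zero => rfl
  | step i f g w hse m hm =>
    have := hse.epi_g
    exact absurd (IsZero.of_epi g hX) (Simple.not_isZero (S i))

lemma HasComposition.simple (hS : ∀ i, Simple (S i))
    (hinj : ∀ i j, Nonempty (S i ≅ S j) → i = j) {i : ι} {m : ι → ℕ}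
    (h : HasComposition S (S i) m) : m = Pi.single i 1 := by
  have := hS i
  generalize hE : S i = E at h
  cases h with
  | zero _ hX => exact absurd (hE ▸ hX) (Simple.not_isZero (S i))
  | step j f g w hse m hm =>
    subst hE
    have := hS j
    have h1 : Epi g := hse.epi_g
    have h2 : Mono f := hse.mono_f
    have hg : g ≠ 0 := fun h0 => Simple.not_isZero (S j) (IsZero.of_epi_eq_zero g h0)
    have h3 : IsIso g := isIso_of_epi_of_nonzero hg
    have hij := hinj i j ⟨asIso g⟩
    have hf : f = 0 := by rw [← cancel_mono g]; simpa using w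
    rw [hm.eq_zero hS (IsZero.of_mono_eq_zero f hf), zero_add, hij]

/-- Induction on the composition series. The restriction to `X` of the projection to the top factor
`S i` is zero or epi; accordingly the factor is counted in `Q` or in `X`, and the induction
hypothesis applies to a short exact sequence with middle term `Y`. -/
lemma HasComposition.split (hS : ∀ i, Simple (S i)) {E : A} {m : ι → ℕ}
    (h : HasComposition S E m) : ∀ {X Q : A} (f : X ⟶ E) (g : E ⟶ Q) (w : f ≫ g = 0),
    (ShortComplex.mk f g w).ShortExact →
      ∃ m₁ m₂, HasComposition S X m₁ ∧ HasComposition S Q m₂ ∧ m = m₁ + m₂ := by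
  induction h with
  | zero E hE =>
    intro X Q f g w h
    have : Mono f := h.mono_f
    have : Epi g := h.epi_g
    exact ⟨0, 0, .zero _ (IsZero.of_mono f hE), .zero _ (IsZero.of_epi g hE), by simp⟩
  | @step Y E i j p w' hse m hY ih =>
    intro X Q f g w h
    have : Mono f := h.mono_f
    have : Epi g := h.epi_g
    have : Mono j := hse.mono_f
    have : Epi p := hse.epi_g
    have := hS i
    -- If `X` maps to zero, it lies in `Y`, and the quotient of `Y` by `X` is the kernel of the
    -- induced map `Q ⟶ S i`.
    by_cases hr : f ≫ p = 0
    · obtain ⟨f', hf'⟩ : ∃ f' : X ⟶ Y, f' ≫ j = f := ⟨hse.exact.lift f hr, hse.exact.lift_f f hr⟩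
      obtain ⟨d, hd⟩ : ∃ d : Q ⟶ S i, g ≫ d = p := ⟨h.exact.desc p hr, h.exact.g_desc p hr⟩
      have : Epi d := by
        have : Epi (g ≫ d) := by rw [hd]; infer_instance
        exact epi_of_epi g d
      have hjd : (j ≫ g) ≫ d = 0 := by rw [Category.assoc, hd, w']
      have hf'm : Mono f' := by
        have : Mono (f' ≫ j) := by rw [hf']; infer_instance
        exact mono_of_mono f' j
      have hepi : Epi (kernel.lift d (j ≫ g) hjd) := by
        rw [epi_iff_surjective_up_to_refinements]
        intro T y
        obtain ⟨T', π, hπ, e, he⟩ := surjective_up_to_refinements_of_epi g (y ≫ kernel.ι d)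
        have h1 : e ≫ p = 0 := by
          rw [← hd, ← Category.assoc, ← he, Category.assoc, Category.assoc, kernel.condition,
            comp_zero, comp_zero]
        refine ⟨T', π, hπ, hse.exact.lift e h1, ?_⟩
        have h2 : hse.exact.lift e h1 ≫ j = e := hse.exact.lift_f e h1
        rw [← cancel_mono (kernel.ι d), Category.assoc, he, Category.assoc, kernel.lift_ι,
          ← Category.assoc, h2]
      have hw : f' ≫ kernel.lift d (j ≫ g) hjd = 0 := by
        rw [← cancel_mono (kernel.ι d), Category.assoc, kernel.lift_ι, ← Category.assoc, hf', w,
          zero_comp]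
      have hex : (ShortComplex.mk f' (kernel.lift d (j ≫ g) hjd) hw).ShortExact :=
        { exact := by
            rw [ShortComplex.exact_iff_exact_up_to_refinements]
            intro T y hy
            have h1 : (y ≫ j) ≫ g = 0 := by
              have h0 : (y ≫ kernel.lift d (j ≫ g) hjd) ≫ kernel.ι d = 0 :=
                (congrArg (· ≫ kernel.ι d) hy).trans zero_comp
              rwa [Category.assoc, kernel.lift_ι, ← Category.assoc] at h0
            refine ⟨T, 𝟙 T, inferInstance, h.exact.lift _ h1, ?_⟩
            have h2 : h.exact.lift _ h1 ≫ f = y ≫ j := h.exact.lift_f _ h1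
            dsimp only
            rw [← cancel_mono j, Category.id_comp, Category.assoc, hf', h2] }
      obtain ⟨m₁, m₂, hm₁, hm₂, hm⟩ := ih _ _ hw hex
      refine ⟨m₁, m₂ + Pi.single i 1, hm₁, .step i _ _ _ (shortExact_kernel d) _ hm₂, ?_⟩
      rw [hm, add_assoc]
    -- Otherwise `Y` still surjects onto `Q`, with kernel the kernel of `X ⟶ S i`.
    · have hr' : Epi (f ≫ p) := epi_of_nonzero_to_simple hr
      obtain ⟨u, hu⟩ : ∃ u : kernel (f ≫ p) ⟶ Y, u ≫ j = kernel.ι (f ≫ p) ≫ f := by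
        have h1 : (kernel.ι (f ≫ p) ≫ f) ≫ p = 0 := by rw [Category.assoc, kernel.condition]
        exact ⟨hse.exact.lift _ h1, hse.exact.lift_f _ h1⟩
      have hum : Mono u := by
        have : Mono (u ≫ j) := by rw [hu]; infer_instance
        exact mono_of_mono u j
      have hw : u ≫ j ≫ g = 0 := by
        rw [← Category.assoc, hu, Category.assoc, w, comp_zero]
      have hepi : Epi (j ≫ g) := by
        rw [epi_iff_surjective_up_to_refinements]
        intro T y
        obtain ⟨T', π, hπ, e, he⟩ := surjective_up_to_refinements_of_epi g y
        obtain ⟨T'', π', hπ', x, hx⟩ := surjective_up_to_refinements_of_epi (f ≫ p) (e ≫ p)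
        have h1 : (π' ≫ e - x ≫ f) ≫ p = 0 := by
          rw [Preadditive.sub_comp, Category.assoc, Category.assoc, hx, sub_self]
        have h2 : hse.exact.lift _ h1 ≫ j = π' ≫ e - x ≫ f := hse.exact.lift_f _ h1
        refine ⟨T'', π' ≫ π, inferInstance, hse.exact.lift _ h1, ?_⟩
        rw [← Category.assoc (hse.exact.lift _ h1), h2, Preadditive.sub_comp, Category.assoc,
          Category.assoc, Category.assoc, w, comp_zero, sub_zero, he]
      have hex : (ShortComplex.mk u (j ≫ g) hw).ShortExact :=
        { exact := by
            rw [ShortComplex.exact_iff_exact_up_to_refinements]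
            intro T y hy
            have h1 : (y ≫ j) ≫ g = 0 := by rw [Category.assoc]; exact hy
            have h2 : h.exact.lift _ h1 ≫ f = y ≫ j := h.exact.lift_f _ h1
            have h3 : h.exact.lift _ h1 ≫ f ≫ p = 0 := by
              rw [← Category.assoc, h2, Category.assoc, w', comp_zero]
            refine ⟨T, 𝟙 T, inferInstance, kernel.lift _ _ h3, ?_⟩
            dsimp only
            rw [← cancel_mono j, Category.id_comp, Category.assoc, hu, ← Category.assoc,
              kernel.lift_ι, h2] }
      obtain ⟨m₁, m₂, hm₁, hm₂, hm⟩ := ih _ _ hw hex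
      refine ⟨m₁ + Pi.single i 1, m₂, .step i _ _ _ (shortExact_kernel _) _ hm₁, hm₂, ?_⟩
      rw [hm, add_right_comm]

/-- One series is split along the top step of the other; the part on the simple quotient is forced,
and induction handles the kernel. -/
lemma HasComposition.unique (hS : ∀ i, Simple (S i))
    (hinj : ∀ i j, Nonempty (S i ≅ S j) → i = j) {E : A} {m m' : ι → ℕ}
    (h : HasComposition S E m) (h' : HasComposition S E m') : m = m' := by
  induction h' generalizing m with
  | zero E hE => exact h.eq_zero hS hE
  | step i f g w hse m' hm ih =>
    obtain ⟨m₁, m₂, h₁, h₂, rfl⟩ := h.split hS f g w hse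
    rw [ih h₁, h₂.simple hS hinj]

lemma exists_hasComposition (hA : ∀ X : A, IsArtinianObject X ∧ IsNoetherianObject X)
    (hsurj : ∀ T : A, Simple T → ∃ i, Nonempty (T ≅ S i)) (E : A) :
    ∃ m, HasComposition S E m := by
  have hwf : WellFoundedLT (Subobject E) := by
    have := (hA E).1
    infer_instance
  suffices h : ∀ Y : Subobject E, ∃ m, HasComposition S (Y : A) m by
    obtain ⟨m, hm⟩ := h ⊤
    exact ⟨m, hm.of_iso (asIso (⊤ : Subobject E).arrow)⟩
  intro Y
  induction Y using hwf.induction with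
  | ind Y ih =>
    by_cases hY : IsZero (Y : A)
    · exact ⟨0, .zero _ hY⟩
    have := (hA (Y : A)).2
    obtain ⟨Q, g, hQ, hg⟩ := exists_simple_quotient _ hY
    obtain ⟨i, ⟨e⟩⟩ := hsurj Q hQ
    -- The kernel of the simple quotient, as a subobject of `E`, is strictly smaller than `Y`; the
    -- Artinian condition makes this descent terminate.
    have hle : Subobject.mk (kernel.ι (g ≫ e.hom) ≫ Y.arrow) ≤ Y :=
      Subobject.mk_le_of_comm (kernel.ι (g ≫ e.hom)) rfl
    have hne : Subobject.mk (kernel.ι (g ≫ e.hom) ≫ Y.arrow) ≠ Y := fun h => by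
      have h1 : Y ≤ Subobject.mk (kernel.ι (g ≫ e.hom) ≫ Y.arrow) := h.ge
      have h2 := Subobject.ofLEMk_comp h1
      rw [← Category.assoc] at h2
      have h3 : Y.ofLEMk _ h1 ≫ kernel.ι (g ≫ e.hom) = 𝟙 _ := by
        rw [← cancel_mono Y.arrow, h2, Category.id_comp]
      have h4 : g ≫ e.hom = 0 := by
        rw [← Category.id_comp (g ≫ e.hom), ← h3, Category.assoc, kernel.condition, comp_zero]
      have h5 : g = 0 := by
        rw [← cancel_mono e.hom, h4, zero_comp]
      exact Simple.not_isZero Q (IsZero.of_epi_eq_zero g h5)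
    obtain ⟨m, hm⟩ := ih _ (lt_of_le_of_ne hle hne)
    exact ⟨_, .step i _ _ _ (shortExact_kernel (g ≫ e.hom)) m
      (hm.of_iso (Subobject.underlyingIso _))⟩

lemma HasComposition.eq_sum [Fintype ι] {G : Type*} [AddCommGroup G] {l : A → G}
    (hl : IsAdditiveOn l) {E : A} {m : ι → ℕ} (h : HasComposition S E m) :
    l E = ∑ i, m i • l (S i) := by
  induction h with
  | zero E hE => simp [hl.eq_zero hE]
  | step i f g w hse m hm ih =>
    have h1 := hl _ hse
    dsimp only at h1
    simp [h1, ih, add_smul, Finset.sum_add_distrib, Pi.single_apply]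

/-- The Jordan-Hölder multiplicities of the objects of an abelian category of finite length. -/
lemma exists_multiplicities [Fintype ι] (hA : ∀ X : A, IsArtinianObject X ∧ IsNoetherianObject X)
    (hS : ∀ i, Simple (S i)) (hinj : ∀ i j, Nonempty (S i ≅ S j) → i = j)
    (hsurj : ∀ T : A, Simple T → ∃ i, Nonempty (T ≅ S i)) :
    ∃ c : A → ι → ℕ, (∀ T : ShortComplex A, T.ShortExact → c T.X₂ = c T.X₁ + c T.X₃) ∧
      (∀ i, c (S i) = Pi.single i 1) ∧ (∀ X, c X = 0 → IsZero X) ∧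
      ∀ l : A → ℂ, IsAdditiveOn l → ∀ X, l X = ∑ i, c X i • l (S i) := by
  choose c hc using exists_hasComposition hA hsurj
  refine ⟨c, fun T hT => ?_, fun i => (hc _).simple hS hinj, fun X hX => ?_,
    fun l hl X => (hc X).eq_sum hl⟩
  · obtain ⟨m₁, m₂, h₁, h₂, hm⟩ := (hc T.X₂).split hS T.f T.g T.zero hT
    rw [hm, h₁.unique hS hinj (hc _), h₂.unique hS hinj (hc _)]
  · have h := hc X
    rw [hX] at h
    generalize hm : (0 : ι → ℕ) = m at h
    cases h with
    | zero _ h => exact h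
    | step i f g w hse m _ => simpa using congrFun hm i

end Composition

end CategoryTheory

/-! ### The Grothendieck group and its basis of simple objects. -/

namespace Bridgeland

open ZeroObject

variable {D : Type u} [Category.{v} D] [Preadditive D] [HasZeroObject D] [HasShift D ℤ]
  [∀ n : ℤ, (shiftFunctor D n).Additive] [Pretriangulated D]

lemma K.of_triangle {T : Triangle D} (hT : T ∈ distTriang D) :
    K.of T.obj₂ = K.of T.obj₁ + K.of T.obj₃ := by
  rw [← sub_eq_zero, ← sub_sub]
  exact (QuotientAddGroup.eq_zero_iff _).2 (AddSubgroup.subset_closure ⟨T, hT, rfl⟩)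

lemma K.of_isZero {X : D} (hX : IsZero X) : K.of X = 0 := by
  have h : Triangle.mk (𝟙 X) (0 : X ⟶ X) (0 : X ⟶ X⟦(1 : ℤ)⟧) ∈ distTriang D :=
    distinguished_of_iso (contractible_distinguished X) (Iso.refl _) (Iso.refl _)
      (hX.iso (isZero_zero D)) rfl (hX.eq_of_src _ _) (hX.eq_of_src _ _)
  simpa using K.of_triangle h

lemma K.of_iso {X Y : D} (e : X ≅ Y) : K.of X = K.of Y := by
  have h : Triangle.mk e.hom (0 : Y ⟶ (0 : D)) (0 : (0 : D) ⟶ X⟦(1 : ℤ)⟧) ∈ distTriang D :=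
    distinguished_of_iso (contractible_distinguished X) (Iso.refl _) e.symm (Iso.refl _)
      (by simp) ((isZero_zero D).eq_of_tgt _ _) ((isZero_zero D).eq_of_src _ _)
  have : K.of Y = K.of X + K.of (0 : D) := K.of_triangle h
  rw [this, K.of_isZero (isZero_zero D), add_zero]

lemma K.of_shift_one (X : D) : K.of (X⟦(1 : ℤ)⟧) = - K.of X := by
  have : K.of (0 : D) = K.of X + K.of (X⟦(1 : ℤ)⟧) :=
    K.of_triangle (rot_of_distTriang _ (contractible_distinguished X))
  rw [K.of_isZero (isZero_zero D)] at this
  exact (neg_eq_of_add_eq_zero_right this.symm).symm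

lemma K.of_shift (X : D) (n : ℤ) : K.of (X⟦n⟧) = (n.negOnePow : ℤ) • K.of X := by
  have hs (m : ℤ) : K.of (X⟦m + 1⟧) = - K.of (X⟦m⟧) := by
    rw [← K.of_shift_one, K.of_iso ((shiftFunctorAdd D m 1).app X)]; rfl
  induction n using Int.induction_on with
  | zero => rw [K.of_iso ((shiftFunctorZero D ℤ).app X)]; simp
  | succ n ih => rw [hs, ih, Int.negOnePow_succ]; simp
  | pred n ih =>
    have h := hs (-n - 1)
    rw [sub_add_cancel, ih] at h
    rw [Int.negOnePow_sub, Int.negOnePow_one, ← neg_neg (K.of _), ← h]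
    simp

lemma K.hom_ext {G : Type*} [AddCommGroup G] {W W' : K D →+ G}
    (h : ∀ X, W (K.of X) = W' (K.of X)) : W = W' := by
  refine QuotientAddGroup.addMonoidHom_ext _ (FreeAbelianGroup.lift_ext _ _ fun X => h X)

/-- Truncation triangles express every class through shifts of objects of the heart, and a shift
only changes the sign of a class. -/
lemma K.hom_ext_heart (t : TStructure D) (ht : ∀ X, t.bounded X) {G : Type*} [AddCommGroup G]
    {W W' : K D →+ G} (h : ∀ X, t.heart X → W (K.of X) = W' (K.of X)) : W = W' := by
  refine K.hom_ext fun X => ?_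
  refine t.bounded_induction' ht (fun X => W (K.of X) = W' (K.of X))
    (fun X hX => by simp [K.of_isZero hX]) (fun b T hT _ h₁ h₃ h₃' => ?_) X
  have e := h (T.obj₃⟦b⟧) ((t.mem_heart_iff _).2
    ⟨t.isLE_shift _ b b 0, t.isGE_shift _ b b 0⟩)
  rw [K.of_shift, map_zsmul, map_zsmul] at e
  have e' : W (K.of T.obj₃) = W' (K.of T.obj₃) := by
    rcases Int.units_eq_one_or b.negOnePow with hb | hb <;> simpa [hb] using e
  rw [K.of_triangle hT, map_add, map_add, h₁, e']

variable [IsTriangulated D]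

lemma isAdditiveOn (t : TStructure D) {G : Type*} [AddCommGroup G] (W : K D →+ G) :
    IsAdditiveOn fun X : t.heart.FullSubcategory => W (K.of X.obj) := fun S hS => by
  obtain ⟨δ, h⟩ := t.exists_triangle_of_shortExact hS
  have : K.of S.X₂.obj = K.of S.X₁.obj + K.of S.X₃.obj := K.of_triangle h
  exact (congrArg W this).trans (map_add _ _ _)

/-- The Grothendieck group of a triangulated category with a bounded t-structure whose heart has
finite length is free on the classes of the simple objects of the heart. -/
lemma bijective_eval_simples (t : TStructure D) (ht : ∀ X, t.bounded X)
    (hA : IsFiniteLengthCategory t.heart.FullSubcategory) {n : ℕ}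
    (S : Fin n → t.heart.FullSubcategory) (hS : ∀ i, Simple (S i))
    (hS_inj : ∀ i j, Nonempty (S i ≅ S j) → i = j)
    (hS_surj : ∀ T : t.heart.FullSubcategory, Simple T → ∃ i, Nonempty (T ≅ S i)) :
    Function.Bijective (fun (W : K D →+ ℂ) (i : Fin n) => W (K.of (S i).obj)) := by
  obtain ⟨c, hc, hcS, -, hl⟩ := exists_multiplicities hA hS hS_inj hS_surj
  constructor
  · intro W W' h
    refine K.hom_ext_heart t ht fun X hX => ?_
    have h1 := hl _ (isAdditiveOn t W) ⟨X, hX⟩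
    have h2 := hl _ (isAdditiveOn t W') ⟨X, hX⟩
    dsimp only at h1 h2
    rw [h1, h2]
    exact Finset.sum_congr rfl fun i _ => by rw [show W _ = W' _ from congrFun h i]
  · intro w
    obtain ⟨W, hW⟩ := t.exists_extension ht (l := fun X => ∑ i, c X i • w i) fun T hT => by
      simp [hc T hT, add_smul, Finset.sum_add_distrib]
    refine ⟨W, funext fun i => ?_⟩
    dsimp only
    rw [hW, hcS]
    simp [Pi.single_apply]

end Bridgeland

/-! ### Plane geometry of the half-plane `H`. -/

namespace Bridgeland

open Complex

/-- The unit vector `exp(iπφ)`. -/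
noncomputable def ray (φ : ℝ) : ℂ := exp (I * (Real.pi : ℂ) * (φ : ℂ))

/-- The linear form `z ↦ Im (z exp(-iπφ))`, which is positive on phases slightly larger than `φ`. -/
noncomputable def above (φ : ℝ) (z : ℂ) : ℝ := (z * ray (-φ)).im

/-- The linear form `z ↦ Re (z exp(-iπφ))`. -/
noncomputable def along (φ : ℝ) (z : ℂ) : ℝ := (z * ray (-φ)).re

/-- The phase of a point of `H`. -/
noncomputable def phase (z : ℂ) : ℝ := z.arg / Real.pi

lemma ray_eq (φ : ℝ) : ray φ = ↑(Real.cos (Real.pi * φ)) + ↑(Real.sin (Real.pi * φ)) * I := by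
  rw [ray, mul_assoc, mul_comm I, exp_mul_I]; push_cast; rfl

lemma ray_re (φ : ℝ) : (ray φ).re = Real.cos (Real.pi * φ) := by
  rw [ray_eq]; simp [-ofReal_cos, -ofReal_sin]

lemma ray_im (φ : ℝ) : (ray φ).im = Real.sin (Real.pi * φ) := by
  rw [ray_eq]; simp [-ofReal_cos, -ofReal_sin]

lemma norm_ray (φ : ℝ) : ‖ray φ‖ = 1 := by
  rw [ray, mul_assoc, mul_comm, ← ofReal_mul, norm_exp_ofReal_mul_I]

lemma ray_add (φ ψ : ℝ) : ray (φ + ψ) = ray φ * ray ψ := by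
  rw [ray, ray, ray, ← exp_add]; push_cast; ring_nf

lemma ray_int (k : ℤ) : ray k = (k.negOnePow : ℤ) := by
  rw [ray]
  rcases Int.even_or_odd k with h | h
  · rw [Int.negOnePow_even k h]
    obtain ⟨m, rfl⟩ := h
    rw [exp_eq_one_iff.2 ⟨m, by push_cast; ring⟩]; simp
  · rw [Int.negOnePow_odd k h]
    obtain ⟨m, rfl⟩ := h
    rw [show I * (Real.pi : ℂ) * ((2 * m + 1 : ℤ) : ℝ) = Real.pi * I + m * (2 * Real.pi * I) by
      push_cast; ring, exp_add, exp_pi_mul_I, exp_int_mul_two_pi_mul_I]; simp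

lemma above_add (φ : ℝ) (z w : ℂ) : above φ (z + w) = above φ z + above φ w := by
  simp [above, add_mul]

lemma along_add (φ : ℝ) (z w : ℂ) : along φ (z + w) = along φ z + along φ w := by
  simp only [along, add_mul, add_re]

lemma along_sub (φ : ℝ) (z w : ℂ) : along φ (z - w) = along φ z - along φ w := by
  simp only [along, sub_mul, sub_re]

@[simp] lemma above_zero (φ : ℝ) : above φ 0 = 0 := by simp [above]

@[simp] lemma along_zero (φ : ℝ) : along φ 0 = 0 := by simp [along]

lemma above_ray (φ ψ r : ℝ) : above φ (r * ray ψ) = r * Real.sin (Real.pi * (ψ - φ)) := by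
  rw [above, mul_assoc, ← ray_add, im_ofReal_mul, ray_im]; ring_nf

lemma along_ray (φ ψ r : ℝ) : along φ (r * ray ψ) = r * Real.cos (Real.pi * (ψ - φ)) := by
  rw [along, mul_assoc, ← ray_add, re_ofReal_mul, ray_re]; ring_nf

lemma along_le_norm (φ : ℝ) (z : ℂ) : along φ z ≤ ‖z‖ := by
  refine (re_le_norm _).trans ?_
  rw [norm_mul, norm_ray, mul_one]

lemma mem_H_iff {z : ℂ} : z ∈ H ↔ ∃ r φ : ℝ, 0 < r ∧ 0 < φ ∧ φ ≤ 1 ∧ z = r * ray φ := Iff.rfl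

lemma ne_zero_of_mem_H {z : ℂ} (hz : z ∈ H) : z ≠ 0 := by
  obtain ⟨r, φ, hr, -, -, rfl⟩ := hz
  exact mul_ne_zero (by exact_mod_cast hr.ne') (exp_ne_zero _)

lemma arg_ray {r φ : ℝ} (hr : 0 < r) (h0 : 0 < φ) (h1 : φ ≤ 1) :
    arg (r * ray φ) = Real.pi * φ := by
  have hπ := Real.pi_pos
  rw [ray_eq, ofReal_cos, ofReal_sin]
  exact arg_mul_cos_add_sin_mul_I hr ⟨by nlinarith, by nlinarith⟩

lemma phase_ray {r φ : ℝ} (hr : 0 < r) (h0 : 0 < φ) (h1 : φ ≤ 1) : phase (r * ray φ) = φ := by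
  rw [phase, arg_ray hr h0 h1]; field_simp

lemma phase_pos {z : ℂ} (hz : z ∈ H) : 0 < phase z := by
  obtain ⟨r, φ, hr, h0, h1, rfl⟩ := mem_H_iff.1 hz
  rwa [phase_ray hr h0 h1]

lemma phase_le_one {z : ℂ} (hz : z ∈ H) : phase z ≤ 1 := by
  obtain ⟨r, φ, hr, h0, h1, rfl⟩ := mem_H_iff.1 hz
  rwa [phase_ray hr h0 h1]

lemma eq_norm_mul_ray {z : ℂ} (hz : z ∈ H) : z = ‖z‖ * ray (phase z) := by
  obtain ⟨r, φ, hr, h0, h1, rfl⟩ := mem_H_iff.1 hz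
  rw [phase_ray hr h0 h1, norm_mul, norm_ray, norm_real, mul_one, Real.norm_of_nonneg hr.le]

/-- Cartesian coordinates make the closure of `H` under addition visible. -/
lemma mem_H_iff' {z : ℂ} : z ∈ H ↔ 0 < z.im ∨ z.im = 0 ∧ z.re < 0 := by
  have hπ := Real.pi_pos
  constructor
  · rintro ⟨r, φ, hr, h0, h1, rfl⟩
    change 0 < (r * ray φ).im ∨ (r * ray φ).im = 0 ∧ (r * ray φ).re < 0
    rw [im_ofReal_mul, re_ofReal_mul, ray_im, ray_re]
    rcases h1.lt_or_eq with h | rfl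
    · exact Or.inl (mul_pos hr (Real.sin_pos_of_pos_of_lt_pi (by positivity) (by nlinarith)))
    · right; simp [hr]
  · intro h
    have hz : z ≠ 0 := by rintro rfl; simp at h
    have hpos : 0 < z.arg := by
      refine lt_of_le_of_ne (arg_nonneg_iff.2 (by rcases h with h | h <;> linarith)) fun h0 => ?_
      have := arg_eq_zero_iff.1 h0.symm
      rcases h with h | h <;> linarith
    refine ⟨‖z‖, z.arg / Real.pi, norm_pos_iff.2 hz, by positivity,
      (div_le_one hπ).2 (arg_le_pi z), ?_⟩
    conv_lhs => rw [← norm_mul_exp_arg_mul_I z]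
    congr 2
    push_cast
    field_simp

lemma add_mem_H {z w : ℂ} (hz : z ∈ H) (hw : w ∈ H) : z + w ∈ H := by
  rw [mem_H_iff'] at *
  simp only [add_im, add_re]
  grind

lemma above_eq {z : ℂ} (hz : z ∈ H) (φ : ℝ) :
    above φ z = ‖z‖ * Real.sin (Real.pi * (phase z - φ)) := by
  conv_lhs => rw [eq_norm_mul_ray hz]
  exact above_ray _ _ _

lemma along_eq {z : ℂ} (hz : z ∈ H) (φ : ℝ) :
    along φ z = ‖z‖ * Real.cos (Real.pi * (phase z - φ)) := by
  conv_lhs => rw [eq_norm_mul_ray hz]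
  exact along_ray _ _ _

lemma above_pos {z : ℂ} (hz : z ∈ H) {φ : ℝ} (h0 : 0 < φ) (h : φ < phase z) :
    0 < above φ z := by
  have hπ := Real.pi_pos
  have h3 := phase_le_one hz
  rw [above_eq hz]
  exact mul_pos (norm_pos_iff.2 (ne_zero_of_mem_H hz))
    (Real.sin_pos_of_pos_of_lt_pi (by nlinarith) (by nlinarith))

lemma above_neg {z : ℂ} (hz : z ∈ H) {φ : ℝ} (h1 : φ ≤ 1) (h : phase z < φ) :
    above φ z < 0 := by
  have hπ := Real.pi_pos
  have h3 := phase_pos hz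
  rw [above_eq hz]
  exact mul_neg_of_pos_of_neg (norm_pos_iff.2 (ne_zero_of_mem_H hz))
    (Real.sin_neg_of_neg_of_neg_pi_lt (by nlinarith) (by nlinarith))

lemma above_phase {z : ℂ} (hz : z ∈ H) : above (phase z) z = 0 := by
  rw [above_eq hz]; simp

/-- Phases are not additive, but `above φ` is. Translating comparisons of phases into signs turns
every seesaw argument below into linear arithmetic. -/
lemma above_pos_iff {z : ℂ} (hz : z ∈ H) {φ : ℝ} (h0 : 0 < φ) (h1 : φ ≤ 1) :
    0 < above φ z ↔ φ < phase z := by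
  refine ⟨fun h => ?_, above_pos hz h0⟩
  by_contra! h'
  rcases h'.lt_or_eq with h' | rfl
  · linarith [above_neg hz h1 h']
  · rw [above_phase hz] at h; exact lt_irrefl _ h

lemma above_eq_zero_iff {z : ℂ} (hz : z ∈ H) {φ : ℝ} (h0 : 0 < φ) (h1 : φ ≤ 1) :
    above φ z = 0 ↔ phase z = φ := by
  refine ⟨fun h => ?_, fun h => h ▸ above_phase hz⟩
  rcases lt_trichotomy (phase z) φ with h' | h' | h'
  · linarith [above_neg hz h1 h']
  · exact h'
  · linarith [above_pos hz h0 h']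

lemma above_nonneg_iff {z : ℂ} (hz : z ∈ H) {φ : ℝ} (h0 : 0 < φ) (h1 : φ ≤ 1) :
    0 ≤ above φ z ↔ φ ≤ phase z := by
  rw [le_iff_lt_or_eq, above_pos_iff hz h0 h1, eq_comm, above_eq_zero_iff hz h0 h1,
    le_iff_lt_or_eq, eq_comm (a := φ)]

end Bridgeland

/-! ### Semistability and Harder-Narasimhan filtrations in an abelian category. -/

namespace Bridgeland

open Complex

lemma along_eq_re_im (φ : ℝ) (z : ℂ) :
    along φ z = z.re * Real.cos (Real.pi * φ) + z.im * Real.sin (Real.pi * φ) := by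
  rw [along, mul_re, ray_re, ray_im, mul_neg, Real.cos_neg, Real.sin_neg]; ring

lemma above_eq_re_im (φ : ℝ) (z : ℂ) :
    above φ z = z.im * Real.cos (Real.pi * φ) - z.re * Real.sin (Real.pi * φ) := by
  rw [above, mul_im, ray_re, ray_im, mul_neg, Real.cos_neg, Real.sin_neg]; ring

/-- The formula for a difference of cosines. It reduces a rotation of the measuring direction to the
sign of `z` with respect to the bisecting direction. -/
lemma along_sub_along (φ φ₀ : ℝ) (z : ℂ) :
    along φ z - along φ₀ z =
      2 * Real.sin (Real.pi * ((φ - φ₀) / 2)) * above ((φ₀ + φ) / 2) z := by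
  rw [along_eq_re_im, along_eq_re_im, above_eq_re_im]
  obtain ⟨a, ha⟩ : ∃ a, a = Real.pi * ((φ₀ + φ) / 2) := ⟨_, rfl⟩
  obtain ⟨b, hb⟩ : ∃ b, b = Real.pi * ((φ - φ₀) / 2) := ⟨_, rfl⟩
  rw [show Real.pi * φ = a + b by rw [ha, hb]; ring, show Real.pi * φ₀ = a - b by rw [ha, hb]; ring,
    ← ha, ← hb, Real.cos_add, Real.cos_sub, Real.sin_add, Real.sin_sub]
  ring

/-- The difference between the norm and the component in direction `φ` of a vector of phase at
least `φ`. -/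
noncomputable def excess (φ : ℝ) (x : ℂ) : ℝ := if φ ≤ phase x then ‖x‖ - along φ x else 0

lemma excess_nonneg (φ : ℝ) (x : ℂ) : 0 ≤ excess φ x := by
  rw [excess]
  split_ifs
  · linarith [along_le_norm φ x]
  · exact le_rfl

/-- By `along_sub_along` the left side is the positive part of `along φ x - along φ₀ x`. For phase
at least `φ` this is exactly the drop in excess; for phase in `[φ₀, φ)` it is bounded by `‖x‖ -
along φ₀ x`; below `φ₀` it vanishes. -/
lemma max_above_le_excess {x : ℂ} (hx : x ∈ H) {φ φ₀ : ℝ} (h0 : 0 < φ₀) (h : φ₀ ≤ φ)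
    (h1 : φ ≤ 1) :
    2 * Real.sin (Real.pi * ((φ - φ₀) / 2)) * max 0 (above ((φ₀ + φ) / 2) x) ≤
      excess φ₀ x - excess φ x := by
  have hπ := Real.pi_pos
  have e := along_sub_along φ φ₀ x
  have hs : 0 ≤ Real.sin (Real.pi * ((φ - φ₀) / 2)) :=
    Real.sin_nonneg_of_nonneg_of_le_pi (by nlinarith) (by nlinarith)
  have n1 := along_le_norm φ x
  have n2 := along_le_norm φ₀ x
  rw [excess, excess, mul_max_of_nonneg _ _ (by linarith), mul_zero, ← e]
  have hm : 0 < along φ x - along φ₀ x → φ₀ < phase x := fun hpos => by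
    rw [e] at hpos
    have h2 : 0 < above ((φ₀ + φ) / 2) x := by
      by_contra! h'
      nlinarith
    have := (above_pos_iff hx (by linarith) (by linarith)).1 h2
    linarith
  have hm' : φ ≤ phase x → 0 ≤ along φ x - along φ₀ x := fun h' => by
    rw [e]
    exact mul_nonneg (by linarith)
      ((above_nonneg_iff hx (by linarith) (by linarith)).2 (by linarith))
  split_ifs with h2 h3 h3
  · have := hm' h3
    exact max_le (by linarith) (by linarith)
  · exact max_le (by linarith) (by linarith)
  · linarith
  · refine max_le (by linarith) ?_
    by_contra! h4
    exact h2 (hm (by linarith)).le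

variable {A : Type u} [Category.{v} A] [Abelian A]

/-- The semistable objects of phase `φ ∈ (0, 1]`, and the zero objects. -/
structure Semistable (z : A → ℂ) (φ : ℝ) (X : A) : Prop where
  pos : 0 < φ
  le_one : φ ≤ 1
  above_eq : above φ (z X) = 0
  above_nonneg : ∀ {Q : A} (p : X ⟶ Q) [Epi p], 0 ≤ above φ (z Q)

/-- A filtration of an object whose factors satisfy `P φ` for strictly decreasing `φ`; the list
starts with the last factor. -/
inductive Filtration (P : ℝ → A → Prop) : A → List (ℝ × A) → Prop
  | zero (X : A) (hX : IsZero X) : Filtration P X []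
  | step {X E B : A} (f : X ⟶ E) (g : E ⟶ B) (w : f ≫ g = 0)
      (h : (ShortComplex.mk f g w).ShortExact) (φ : ℝ) (hB : P φ B) (hB' : ¬ IsZero B)
      (l : List (ℝ × A)) (hl : ∀ p ∈ l, φ < p.1) (hX : Filtration P X l) :
      Filtration P E ((φ, B) :: l)

lemma Filtration.forall_mem {P : ℝ → A → Prop} {E : A} {l : List (ℝ × A)}
    (h : Filtration P E l) : ∀ p ∈ l, P p.1 p.2 ∧ ¬ IsZero p.2 := by
  induction h with
  | zero => simp
  | step f g w h φ hB hB' l hl hX ih =>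
    simp only [List.mem_cons, forall_eq_or_imp]
    exact ⟨⟨hB, hB'⟩, ih⟩

lemma Filtration.sum {P : ℝ → A → Prop} {E : A} {l : List (ℝ × A)}
    (h : Filtration P E l) {G : Type*} [AddCommGroup G] {m : A → G} (hm : IsAdditiveOn m) :
    m E = (l.map fun p => m p.2).sum := by
  induction h with
  | zero X hX => simpa using hm.eq_zero hX
  | step f g w h φ hB hB' l hl hX ih =>
    have := hm _ h
    dsimp only at this
    rw [List.map_cons, List.sum_cons, ← ih, this, add_comm]

section

variable {z w : A → ℂ} (hz : IsAdditiveOn z) (hw : IsAdditiveOn w)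

include hz

lemma semistable_of_isZero {φ : ℝ} (h0 : 0 < φ) (h1 : φ ≤ 1) {X : A} (hX : IsZero X) :
    Semistable z φ X where
  pos := h0
  le_one := h1
  above_eq := by rw [hz.eq_zero hX, above_zero]
  above_nonneg p _ := by rw [hz.eq_zero (IsZero.of_epi p hX), above_zero]

lemma Semistable.above_nonpos {φ : ℝ} {X Y : A} (h : Semistable z φ Y) (f : X ⟶ Y) [Mono f] :
    above φ (z X) ≤ 0 := by
  have h1 := h.above_eq
  rw [hz.mono f, above_add] at h1
  linarith [h.above_nonneg (cokernel.π f)]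

/-- A quotient of an extension is an extension of a quotient of `T.X₃` by the image of `T.X₁`. -/
lemma Semistable.above_nonneg_of_kernel {φ : ℝ} {T : ShortComplex A} (hT : T.ShortExact)
    (h₁ : Semistable z φ T.X₁) (h₃ : Semistable z φ T.X₃) {Q : A} (p : T.X₂ ⟶ Q) [Epi p] :
    0 ≤ above φ (z Q) := by
  have := hT.epi_g
  have hk : T.f ≫ p ≫ cokernel.π (T.f ≫ p) = 0 := by
    rw [← Category.assoc, cokernel.condition]
  have hd : T.g ≫ hT.exact.desc _ hk = p ≫ cokernel.π (T.f ≫ p) := hT.exact.g_desc _ hk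
  have : Epi (hT.exact.desc _ hk) := by
    have : Epi (T.g ≫ hT.exact.desc _ hk) := by rw [hd]; infer_instance
    exact epi_of_epi T.g _
  have e : z Q = z (kernel (cokernel.π (T.f ≫ p))) + z (cokernel (T.f ≫ p)) :=
    hz.epi (cokernel.π (T.f ≫ p))
  rw [e, above_add]
  exact add_nonneg (h₁.above_nonneg (Abelian.factorThruImage (T.f ≫ p)))
    (h₃.above_nonneg (hT.exact.desc _ hk))

lemma Semistable.ext {φ : ℝ} {T : ShortComplex A} (hT : T.ShortExact)
    (h₁ : Semistable z φ T.X₁) (h₃ : Semistable z φ T.X₃) : Semistable z φ T.X₂ where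
  pos := h₁.pos
  le_one := h₁.le_one
  above_eq := by rw [hz T hT, above_add, h₁.above_eq, h₃.above_eq, add_zero]
  above_nonneg p _ := h₁.above_nonneg_of_kernel hz hT h₃ p

omit hz

omit [Abelian A] in
lemma Semistable.phase_eq {φ : ℝ} {X : A} (h : Semistable z φ X) (hX : z X ∈ H) :
    phase (z X) = φ :=
  (above_eq_zero_iff hX h.pos h.le_one).1 h.above_eq

include hw in
/-- A nonzero morphism between semistable objects for two central charges gives an object which
bounds the phases of both. -/
lemma Semistable.exists_of_hom_ne_zero (hzH : ∀ X, ¬ IsZero X → z X ∈ H)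
    (hwH : ∀ X, ¬ IsZero X → w X ∈ H) {φ ψ : ℝ} {X Y : A}
    (hX : Semistable z ψ X) (hY : Semistable w φ Y) (f : X ⟶ Y) (hf : f ≠ 0) :
    ∃ I : A, ¬ IsZero I ∧ ψ ≤ phase (z I) ∧ phase (w I) ≤ φ := by
  have hI : ¬ IsZero (Abelian.image f) := fun h => hf (by
    rw [← Abelian.image.fac f, h.eq_of_tgt (Abelian.factorThruImage f) 0, zero_comp])
  refine ⟨_, hI, (above_nonneg_iff (hzH _ hI) hX.pos hX.le_one).1
    (hX.above_nonneg (Abelian.factorThruImage f)), ?_⟩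
  have h1 := hY.above_nonpos hw (Abelian.image.ι f)
  by_contra! h2
  linarith [above_pos (hwH _ hI) hY.pos h2]

include hz in
/-- Every nonzero object has a semistable quotient of minimal phase whose kernel has only
quotients of larger phase. -/
lemma exists_semistable_quotient (hzH : ∀ X, ¬ IsZero X → z X ∈ H) {len : A → ℤ}
    (hlen : IsAdditiveOn len) (hlen0 : ∀ X, 0 ≤ len X) (hlenZ : ∀ X, len X = 0 → IsZero X)
    (hfin : ∀ E : A, {x | ∃ (Q : A) (p : E ⟶ Q), Epi p ∧ z Q = x}.Finite)
    (E : A) (hE : ¬ IsZero E) :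
    ∃ (Q : A) (p : E ⟶ Q), Epi p ∧ ¬ IsZero Q ∧ Semistable z (phase (z Q)) Q ∧
      ∀ (R : A) (r : kernel p ⟶ R), Epi r → ¬ IsZero R → phase (z Q) < phase (z R) := by
  -- The minimal phase is attained because quotients of `E` take finitely many charges; among the
  -- quotients of minimal phase one of maximal length is chosen afterwards.
  obtain ⟨Q₀, ⟨p₀, hp₀, hQ₀⟩, hmin⟩ : ∃ Q₀, (∃ p₀ : E ⟶ Q₀, Epi p₀ ∧ ¬ IsZero Q₀) ∧
      ∀ Q (p : E ⟶ Q), Epi p → ¬ IsZero Q → phase (z Q₀) ≤ phase (z Q) := by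
    obtain ⟨_, ⟨Q₀, p₀, h₀, hQ₀, rfl⟩, hm⟩ := Set.exists_min_image
      {x | ∃ (Q : A) (p : E ⟶ Q), Epi p ∧ ¬ IsZero Q ∧ z Q = x} phase
      ((hfin E).subset fun x ⟨Q, p, h, _, h'⟩ => ⟨Q, p, h, h'⟩)
      ⟨z E, E, 𝟙 E, inferInstance, hE, rfl⟩
    exact ⟨Q₀, ⟨p₀, h₀, hQ₀⟩, fun Q p hp hQ => hm _ ⟨Q, p, hp, hQ, rfl⟩⟩
  obtain ⟨Q, p, hp, hQ, hQφ, hmax⟩ : ∃ (Q : A) (p : E ⟶ Q), Epi p ∧ ¬ IsZero Q ∧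
      phase (z Q) = phase (z Q₀) ∧ ∀ Q' (p' : E ⟶ Q'), Epi p' → ¬ IsZero Q' →
        phase (z Q') = phase (z Q₀) → len Q' ≤ len Q := by
    obtain ⟨_, ⟨Q, p, hp, hQ, hQφ, rfl⟩, hm⟩ := Set.exists_max_image
      {x | ∃ (Q : A) (p : E ⟶ Q), Epi p ∧ ¬ IsZero Q ∧ phase (z Q) = phase (z Q₀) ∧ len Q = x}
      (fun x => x) ((Set.finite_Icc 0 (len E)).subset (by
        rintro _ ⟨Q, p, hp, -, -, rfl⟩
        exact ⟨hlen0 _, by linarith [hlen.epi p, hlen0 (kernel p)]⟩))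
      ⟨len Q₀, Q₀, p₀, hp₀, hQ₀, rfl, rfl⟩
    exact ⟨Q, p, hp, hQ, hQφ, fun Q' p' h1 h2 h3 => hm _ ⟨Q', p', h1, h2, h3, rfl⟩⟩
  have h0 := phase_pos (hzH Q hQ)
  have h1 := phase_le_one (hzH Q hQ)
  refine ⟨Q, p, hp, hQ, ⟨h0, h1, above_phase (hzH Q hQ), fun {R} q _ => ?_⟩, fun R r hr hR => ?_⟩
  · by_cases hR : IsZero R
    · rw [hz.eq_zero hR, above_zero]
    · rw [above_nonneg_iff (hzH R hR) h0 h1, hQφ]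
      exact hmin R (p ≫ q) inferInstance hR
  -- Dividing `E` by the kernel of `r` gives a quotient with the charge and the length of `Q` and
  -- `R` together. It is longer than `Q`, so its phase is strictly larger, and hence so is that of
  -- `R`.
  · have key : ∀ {G : Type} [AddCommGroup G] {m : A → G}, IsAdditiveOn m →
        m (cokernel (kernel.ι r ≫ kernel.ι p)) = m Q + m R := fun {G} _ {m} hm => by
      have e1 := hm.mono (kernel.ι r ≫ kernel.ι p)
      have e2 := hm.epi p
      have e3 := hm.epi r
      rw [e2, e3] at e1
      have e4 : m (kernel r) + (m R + m Q) =
        m (kernel r) + m (cokernel (kernel.ι r ≫ kernel.ι p)) := by rw [← e1]; abel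
      rw [← add_left_cancel e4, add_comm]
    have hlR : 0 < len R := lt_of_le_of_ne (hlen0 R) fun h => hR (hlenZ _ h.symm)
    have hl := key hlen
    have hne : ¬ IsZero (cokernel (kernel.ι r ≫ kernel.ι p)) := fun h => by
      rw [hlen.eq_zero h] at hl
      linarith [hlen0 Q]
    have h2 := hmin _ (cokernel.π (kernel.ι r ≫ kernel.ι p)) inferInstance hne
    have h3 : phase (z Q) < phase (z (cokernel (kernel.ι r ≫ kernel.ι p))) := by
      rw [hQφ]
      refine lt_of_le_of_ne h2 fun h => ?_
      linarith [hmax _ (cokernel.π (kernel.ι r ≫ kernel.ι p)) inferInstance hne h.symm]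
    have h4 := above_pos (hzH _ hne) h0 h3
    rw [key hz, above_add, above_phase (hzH Q hQ), zero_add] at h4
    exact (above_pos_iff (hzH R hR) h0 h1).1 h4

include hz in
/-- The existence of Harder-Narasimhan filtrations. -/
lemma exists_filtration (hzH : ∀ X, ¬ IsZero X → z X ∈ H) {len : A → ℤ}
    (hlen : IsAdditiveOn len) (hlen0 : ∀ X, 0 ≤ len X) (hlenZ : ∀ X, len X = 0 → IsZero X)
    (hfin : ∀ E : A, {x | ∃ (Q : A) (p : E ⟶ Q), Epi p ∧ z Q = x}.Finite) (E : A) :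
    ∃ l, Filtration (Semistable z) E l := by
  -- Induction on length. The additional lower bound on the phases of the factors is what makes them
  -- strictly decreasing when the next quotient is attached.
  suffices h : ∀ (n : ℕ) (E : A), len E ≤ n → ∃ l, Filtration (Semistable z) E l ∧
      ∀ φ : ℝ, (∀ (R : A) (r : E ⟶ R), Epi r → ¬ IsZero R → φ < phase (z R)) →
        ∀ p ∈ l, φ < p.1 by
    obtain ⟨l, hl, -⟩ := h (len E).toNat E (Int.self_le_toNat _)
    exact ⟨l, hl⟩
  intro n
  induction n with
  | zero =>
    intro E hE
    exact ⟨[], .zero _ (hlenZ _ (le_antisymm (by simpa using hE) (hlen0 E))), by simp⟩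
  | succ n ih =>
    intro E hE
    by_cases hE0 : IsZero E
    · exact ⟨[], .zero _ hE0, by simp⟩
    obtain ⟨Q, p, hp, hQ, hQs, hR⟩ := exists_semistable_quotient hz hzH hlen hlen0 hlenZ hfin E hE0
    have hlQ : 0 < len Q := lt_of_le_of_ne (hlen0 Q) fun h => hQ (hlenZ _ h.symm)
    obtain ⟨l, hl, hlφ⟩ := ih (kernel p) (by
      have := hlen.epi p
      push_cast at hE
      linarith)
    refine ⟨_, .step _ _ _ (shortExact_kernel p) _ hQs hQ l (hlφ _ hR) hl, fun φ hφ => ?_⟩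
    simp only [List.mem_cons, forall_eq_or_imp]
    have := hφ Q p hp hQ
    exact ⟨this, fun q hq => this.trans (hlφ _ hR q hq)⟩

end

/-! ### Comparison of the lengths of Harder-Narasimhan polygons. -/

section Mass

variable {z w : A → ℂ} (hz : IsAdditiveOn z) (hw : IsAdditiveOn w)

include hw

/-- `F` cuts out a subobject of each factor. If the phase of the factor is at most `θ`, this
subobject contributes nothing positive; otherwise it contributes at most as much as the factor,
since the remaining quotient has phase above `θ` or is zero. -/
lemma Filtration.above_le_sum (hwH : ∀ X, ¬ IsZero X → w X ∈ H) {E : A} {l : List (ℝ × A)}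
    (h : Filtration (Semistable w) E l) {θ : ℝ} (h0 : 0 < θ) (h1 : θ ≤ 1) :
    ∀ {F : A} (i : F ⟶ E) [Mono i],
      above θ (w F) ≤ (l.map fun b => max 0 (above θ (w b.2))).sum := by
  induction h with
  | zero X hX =>
    intro F i _
    simp [hw.eq_zero (IsZero.of_mono i hX)]
  | @step X E B f g hfg hse φ hB hB' l hl hX ih =>
    intro F i _
    have := hse.mono_f
    have hk : (kernel.ι (i ≫ g) ≫ i) ≫ g = 0 := by rw [Category.assoc, kernel.condition]
    have hj : hse.exact.lift _ hk ≫ f = kernel.ι (i ≫ g) ≫ i := hse.exact.lift_f _ hk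
    have : Mono (hse.exact.lift _ hk) := by
      have : Mono (hse.exact.lift _ hk ≫ f) := by rw [hj]; infer_instance
      exact mono_of_mono _ f
    have h3 := ih (hse.exact.lift _ hk)
    have h2 : above θ (w (image (i ≫ g))) ≤ max 0 (above θ (w B)) := by
      by_cases hI : IsZero (image (i ≫ g))
      · simp [hw.eq_zero hI]
      have h4 := hB.above_nonpos hw (image.ι (i ≫ g))
      rcases le_or_gt φ θ with hφ | hφ
      · refine le_max_of_le_left ?_
        by_contra! h5
        linarith [above_pos (hwH _ hI) hB.pos
          (hφ.trans_lt ((above_pos_iff (hwH _ hI) h0 h1).1 h5))]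
      · refine le_max_of_le_right ?_
        rw [hw.mono (image.ι (i ≫ g)), above_add]
        refine le_add_of_nonneg_right ?_
        by_cases hC : IsZero (cokernel (image.ι (i ≫ g)))
        · simp [hw.eq_zero hC]
        · have h4 := hB.above_nonneg (cokernel.π (image.ι (i ≫ g)))
          rw [above_nonneg_iff (hwH _ hC) hB.pos hB.le_one] at h4
          exact (above_pos (hwH _ hC) h0 (hφ.trans_le h4)).le
    rw [hw.image (i ≫ g), above_add, List.map_cons, List.sum_cons]
    linarith

lemma Filtration.along_sub_le (hwH : ∀ X, ¬ IsZero X → w X ∈ H) {E : A} {l : List (ℝ × A)}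
    (h : Filtration (Semistable w) E l) {F : A} (i : F ⟶ E) [Mono i] {φ φ₀ : ℝ}
    (h0 : 0 < φ₀) (hφ : φ₀ ≤ φ) (h1 : φ ≤ 1) :
    along φ (w F) - along φ₀ (w F) ≤
      (l.map fun b => excess φ₀ (w b.2)).sum - (l.map fun b => excess φ (w b.2)).sum := by
  have hπ := Real.pi_pos
  have hs : 0 ≤ Real.sin (Real.pi * ((φ - φ₀) / 2)) :=
    Real.sin_nonneg_of_nonneg_of_le_pi (by nlinarith) (by nlinarith)
  rw [along_sub_along]
  refine (mul_le_mul_of_nonneg_left (h.above_le_sum hw hwH (θ := (φ₀ + φ) / 2) (by linarith)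
    (by linarith) i) (by linarith)).trans ?_
  rw [← List.sum_map_mul_left, le_sub_iff_add_le, ← List.sum_map_add]
  exact List.sum_le_sum fun b hb => le_sub_iff_add_le.1
    (max_above_le_excess (hwH _ (h.forall_mem b hb).2) h0 hφ h1)

/-- The length of the Harder-Narasimhan polygon of a subobject, measured along a filtration
for another central charge. -/
lemma Filtration.sum_along_le_add (hwH : ∀ X, ¬ IsZero X → w X ∈ H) {E : A} {l' : List (ℝ × A)}
    (h' : Filtration (Semistable w) E l') {F : A} {l : List (ℝ × A)}
    (h : Filtration (Semistable z) F l) (i : F ⟶ E) [Mono i] {φ₀ : ℝ} (h0 : 0 < φ₀)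
    (hφ₀ : ∀ a ∈ l, φ₀ ≤ a.1) :
    (l.map fun a => along a.1 (w a.2)).sum ≤
      along φ₀ (w F) + (l'.map fun b => excess φ₀ (w b.2)).sum := by
  induction h generalizing φ₀ with
  | zero X hX =>
    simpa [hw.eq_zero hX] using List.sum_nonneg fun x hx => by
      obtain ⟨b, -, rfl⟩ := List.mem_map.1 hx
      exact excess_nonneg _ _
  | @step X F B f g hfg hse φ hB hB' l hl hX ih =>
    have := hse.mono_f
    -- At `F` the direction is turned from `φ₀` to the phase `φ` of the last factor, which costs at
    -- most the drop in excess; then `B` is split off and the argument continues with `X` from the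
    -- direction `φ`.
    have h1 := ih (f ≫ i) hB.pos fun a ha => (hl a ha).le
    have h2 := h'.along_sub_le hw hwH i h0 (hφ₀ _ (List.mem_cons_self ..)) hB.le_one
    have h3 : w F = w X + w B := hw _ hse
    rw [List.map_cons, List.sum_cons]
    have h4 : along φ (w F) = along φ (w X) + along φ (w B) := by rw [h3, along_add]
    linarith

/-- For a direction `φ₀` below all the finitely many phases involved, each excess is the norm minus
the component along `φ₀`, and these components add up to that of `w E`. -/
lemma Filtration.sum_along_le (hwH : ∀ X, ¬ IsZero X → w X ∈ H) {E : A} {l l' : List (ℝ × A)}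
    (h' : Filtration (Semistable w) E l') (h : Filtration (Semistable z) E l) :
    (l.map fun a => along a.1 (w a.2)).sum ≤ (l'.map fun b => ‖w b.2‖).sum := by
  obtain ⟨φ₀, h0, h1⟩ : ∃ φ₀ : ℝ, 0 < φ₀ ∧ ∀ x ∈ l.map (fun a => a.1) ++
      l'.map (fun b => phase (w b.2)), φ₀ ≤ x := by
    have hpos : ∀ x ∈ l.map (fun a => a.1) ++ l'.map (fun b => phase (w b.2)), 0 < x := by
      intro x hx
      rw [List.mem_append, List.mem_map, List.mem_map] at hx
      obtain ⟨a, ha, rfl⟩ | ⟨b, hb, rfl⟩ := hx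
      · exact (h.forall_mem a ha).1.pos
      · exact phase_pos (hwH _ (h'.forall_mem b hb).2)
    generalize l.map (fun a => a.1) ++ l'.map (fun b => phase (w b.2)) = L at hpos
    induction L with
    | nil => exact ⟨1, one_pos, by simp⟩
    | cons a L ih =>
      obtain ⟨m, hm, hL⟩ := ih fun x hx => hpos x (List.mem_cons_of_mem _ hx)
      refine ⟨min a m, lt_min (hpos a (List.mem_cons_self ..)) hm, ?_⟩
      simp only [List.mem_cons, forall_eq_or_imp]
      exact ⟨min_le_left _ _, fun x hx => (min_le_right _ _).trans (hL x hx)⟩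
  refine (h'.sum_along_le_add hw hwH h (𝟙 E) h0 fun a ha => h1 _
    (List.mem_append_left _ (List.mem_map_of_mem ha))).trans ?_
  have e : (l'.map fun b => excess φ₀ (w b.2)) = l'.map fun b => ‖w b.2‖ - along φ₀ (w b.2) :=
    List.map_congr_left fun b hb => if_pos (h1 _ (List.mem_append_right _
      (List.mem_map_of_mem (f := fun b : ℝ × A => phase (w b.2)) hb)))
  have e' : along φ₀ (w E) = (l'.map fun b => along φ₀ (w b.2)).sum :=
    h'.sum (m := fun X => along φ₀ (w X)) fun T hT => by
      dsimp only
      rw [hw T hT, along_add]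
  rw [e, e', ← List.sum_map_add]
  exact List.sum_le_sum fun b _ => by linarith

/-- Masses vary continuously with the central charge. -/
lemma Filtration.mass_le (hzH : ∀ X, ¬ IsZero X → z X ∈ H) (hwH : ∀ X, ¬ IsZero X → w X ∈ H)
    {η : ℝ} (hη : ∀ X, ‖w X - z X‖ ≤ η * ‖z X‖) {E : A} {l l' : List (ℝ × A)}
    (h' : Filtration (Semistable w) E l') (h : Filtration (Semistable z) E l) :
    (1 - η) * (l.map fun a => ‖z a.2‖).sum ≤ (l'.map fun b => ‖w b.2‖).sum := by
  refine le_trans ?_ (h'.sum_along_le hw hwH h)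
  rw [← List.sum_map_mul_left]
  refine List.sum_le_sum fun a ha => ?_
  obtain ⟨h1, h2⟩ := h.forall_mem a ha
  -- In the direction of its own phase, `z a.2` is measured by its full norm; replacing `z` by `w`
  -- loses at most the fraction `η`.
  have h3 := along_eq (hzH _ h2) a.1
  rw [h1.phase_eq (hzH _ h2), sub_self, mul_zero, Real.cos_zero, mul_one] at h3
  have h4 := along_le_norm a.1 (z a.2 - w a.2)
  rw [norm_sub_rev, along_sub] at h4
  linarith [hη a.2]

end Mass

end Bridgeland

/-! ### Towers in the triangulated category and their uniqueness. -/

namespace Bridgeland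

variable {D : Type u} [Category.{v} D] [Preadditive D] [HasZeroObject D] [HasShift D ℤ]
  [∀ n : ℤ, (shiftFunctor D n).Additive] [Pretriangulated D]

/-- A tower of distinguished triangles whose cones satisfy `P φ` for strictly decreasing `φ`;
the list starts with the last cone. -/
inductive Tower (P : ℝ → ObjectProperty D) : D → List (ℝ × D) → Prop
  | zero (X : D) (hX : IsZero X) : Tower P X []
  | step {X E B : D} (f : X ⟶ E) (g : E ⟶ B) (h : B ⟶ X⟦(1 : ℤ)⟧)
      (hT : Triangle.mk f g h ∈ distTriang D) (φ : ℝ) (hB : P φ B) (hB' : ¬ IsZero B)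
      (l : List (ℝ × D)) (hl : ∀ p ∈ l, φ < p.1) (hX : Tower P X l) : Tower P E ((φ, B) :: l)

variable {P : ℝ → ObjectProperty D}

lemma Tower.of_iso {E E' : D} {l : List (ℝ × D)} (h : Tower P E l) (e : E ≅ E') :
    Tower P E' l := by
  cases h with
  | zero _ hX => exact .zero _ (hX.of_iso e.symm)
  | step f g h hT φ hB hB' l hl hX =>
    exact .step (f ≫ e.hom) (e.inv ≫ g) h
      (distinguished_of_iso hT (Iso.refl _) e.symm (Iso.refl _) (by simp) (by simp) (by simp))
      φ hB hB' l hl hX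

lemma Tower.forall_mem {E : D} {l : List (ℝ × D)} (h : Tower P E l) :
    ∀ p ∈ l, P p.1 p.2 ∧ ¬ IsZero p.2 := by
  induction h with
  | zero => simp
  | step f g h hT φ hB hB' l hl hX ih =>
    simp only [List.mem_cons, forall_eq_or_imp]
    exact ⟨⟨hB, hB'⟩, ih⟩

open ZeroObject in
lemma Tower.single {E : D} {φ : ℝ} (h : P φ E) (hE : ¬ IsZero E) : Tower P E [(φ, E)] := by
  refine .step (X := 0) 0 (𝟙 E) 0 ?_ φ h hE [] (by simp) (.zero _ (isZero_zero D))
  exact contractible_distinguished₁ E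

lemma Tower.prop_of_ext {E : D} {l : List (ℝ × D)} (h : Tower P E l) (Q : ObjectProperty D)
    (h0 : ∀ X, IsZero X → Q X) (hQ : ∀ p ∈ l, Q p.2)
    (hext : ∀ T ∈ distTriang D, Q T.obj₁ → Q T.obj₃ → Q T.obj₂) : Q E := by
  induction h with
  | zero X hX => exact h0 X hX
  | step f g h hT φ hB hB' l hl hX ih =>
    simp only [List.mem_cons, forall_eq_or_imp] at hQ
    exact hext _ hT (ih hQ.2) hQ.1

lemma Tower.shift {E : D} {l : List (ℝ × D)} (h : Tower P E l) (n : ℤ) {P' : ℝ → ObjectProperty D}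
    (hP : ∀ φ X, P φ X → P' (φ + n) (X⟦n⟧)) :
    Tower P' (E⟦n⟧) (l.map fun p => (p.1 + n, p.2⟦n⟧)) := by
  induction h with
  | zero X hX => exact .zero _ ((shiftFunctor D n).map_isZero hX)
  | @step X E B f g h hT φ hB hB' l hl hX ih =>
    refine .step _ _ _ (Triangle.shift_distinguished _ hT n) _ (hP _ _ hB) (fun h0 => hB' ?_) _
      ?_ ih
    · exact ((shiftFunctor D (-n)).map_isZero h0).of_iso ((shiftEquiv D n).unitIso.app B)
    · intro p hp
      obtain ⟨q, hq, rfl⟩ := List.mem_map.1 hp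
      linarith [hl q hq]

section Hom

variable (hhom : ∀ (φ₁ φ₂ : ℝ), φ₂ < φ₁ → ∀ (A₁ A₂ : D), P φ₁ A₁ → P φ₂ A₂ →
    ∀ f : A₁ ⟶ A₂, f = 0)

lemma Tower.prop_hom_src {E : D} {l : List (ℝ × D)} (h : Tower P E l) {Y : D}
    (hQ : ∀ p ∈ l, ∀ f : p.2 ⟶ Y, f = 0) (f : E ⟶ Y) : f = 0 := by
  refine h.prop_of_ext (fun X => ∀ f : X ⟶ Y, f = 0) (fun X hX f => hX.eq_of_src f 0) hQ ?_ f
  intro T hT h₁ h₃ f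
  obtain ⟨g, hg⟩ := Triangle.yoneda_exact₂ T hT f (h₁ _)
  rw [hg, h₃ g, comp_zero]

lemma Tower.prop_hom_tgt {E : D} {l : List (ℝ × D)} (h : Tower P E l) {Y : D}
    (hQ : ∀ p ∈ l, ∀ f : Y ⟶ p.2, f = 0) (f : Y ⟶ E) : f = 0 := by
  refine h.prop_of_ext (fun X => ∀ f : Y ⟶ X, f = 0) (fun X hX f => hX.eq_of_tgt f 0) hQ ?_ f
  intro T hT h₁ h₃ f
  obtain ⟨g, hg⟩ := Triangle.coyoneda_exact₂ T hT f (h₃ _)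
  rw [hg, h₁ g, zero_comp]

include hhom

lemma Tower.hom_eq_zero {E B : D} {l : List (ℝ × D)} (h : Tower P E l) {φ : ℝ} (hB : P φ B)
    (hl : ∀ p ∈ l, φ < p.1) (f : E ⟶ B) : f = 0 :=
  h.prop_hom_src (fun p hp => hhom p.1 φ (hl p hp) _ _ (h.forall_mem p hp).1 hB) f

/-- The morphisms from the shift of an object to an object of smaller phase vanish. -/
lemma Tower.shift_hom_eq_zero (hsh : ∀ φ X, P φ X → P (φ + 1) (X⟦(1 : ℤ)⟧)) {X B : D}
    {l : List (ℝ × D)} (hX : Tower P X l) {φ : ℝ} (hB : P φ B) (hl : ∀ p ∈ l, φ < p.1)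
    (f : X⟦(1 : ℤ)⟧ ⟶ B) : f = 0 := by
  refine (hX.shift 1 (P' := P) (by simpa using hsh)).hom_eq_zero hhom hB (fun p hp => ?_) f
  obtain ⟨q, hq, rfl⟩ := List.mem_map.1 hp
  have := hl q hq
  push_cast
  linarith

/-- If `g` vanished, the identity of `B` would factor through `X⟦1⟧`, all of whose phases exceed `φ
+ 1`. -/
lemma Tower.ne_zero_of_step (hsh : ∀ φ X, P φ X → P (φ + 1) (X⟦(1 : ℤ)⟧)) {E X B : D} {f : X ⟶ E}
    {g : E ⟶ B} {d : B ⟶ X⟦(1 : ℤ)⟧} (hT : Triangle.mk f g d ∈ distTriang D) {φ : ℝ}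
    (hB : P φ B) (hB' : ¬ IsZero B) {l : List (ℝ × D)} (hl : ∀ p ∈ l, φ < p.1)
    (hX : Tower P X l) : g ≠ 0 := by
  intro hg
  obtain ⟨s, hs'⟩ : ∃ s : X⟦(1 : ℤ)⟧ ⟶ B, 𝟙 B = d ≫ s :=
    Triangle.yoneda_exact₃ _ hT (𝟙 B) (by exact (congrArg (· ≫ 𝟙 B) hg).trans zero_comp)
  rw [hX.shift_hom_eq_zero hhom hsh hB hl s, comp_zero] at hs'
  exact hB' ((IsZero.iff_id_eq_zero _).2 hs')

/-- The cones of a tower are unique. -/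
lemma Tower.unique (hsh : ∀ φ X, P φ X → P (φ + 1) (X⟦(1 : ℤ)⟧)) {E : D} {l l' : List (ℝ × D)}
    (h : Tower P E l) (h' : Tower P E l') :
    (l.map fun p => (p.1, K.of p.2)) = l'.map fun p => (p.1, K.of p.2) := by
  have hle {E X B : D} {f : X ⟶ E} {g : E ⟶ B} {d : B ⟶ X⟦(1 : ℤ)⟧}
      (hT : Triangle.mk f g d ∈ distTriang D) {φ : ℝ} (hB : P φ B) (hB' : ¬ IsZero B)
      {l l' : List (ℝ × D)} (hl : ∀ p ∈ l, φ < p.1) (hX : Tower P X l) (hE : Tower P E l') :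
      ∃ p ∈ l', p.1 ≤ φ := by
    by_contra! hlt
    exact hX.ne_zero_of_step hhom hsh hT hB hB' hl (hE.hom_eq_zero hhom hB hlt g)
  have hlift {E X B X' B' : D} {f : X ⟶ E} {g : E ⟶ B} {d : B ⟶ X⟦(1 : ℤ)⟧}
      (hT : Triangle.mk f g d ∈ distTriang D) {f' : X' ⟶ E} {g' : E ⟶ B'} {d' : B' ⟶ X'⟦(1 : ℤ)⟧}
      (hT' : Triangle.mk f' g' d' ∈ distTriang D) {φ : ℝ} (hB : P φ B) (hB' : P φ B')
      {l : List (ℝ × D)} (hl : ∀ p ∈ l, φ < p.1) (hX : Tower P X l) :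
      (∃ a : B ⟶ B', g' = g ≫ a) ∧ ∃ u : X ⟶ X', f = u ≫ f' :=
    ⟨Triangle.yoneda_exact₂ _ hT g' (hX.hom_eq_zero hhom hB' hl _),
      Triangle.coyoneda_exact₂ _ hT' f (hX.hom_eq_zero hhom hB' hl _)⟩
  have hid {E X B : D} {f : X ⟶ E} {g : E ⟶ B} {d : B ⟶ X⟦(1 : ℤ)⟧}
      (hT : Triangle.mk f g d ∈ distTriang D) {φ : ℝ} (hB : P φ B)
      {l : List (ℝ × D)} (hl : ∀ p ∈ l, φ < p.1) (hX : Tower P X l) :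
      (∀ a : B ⟶ B, g ≫ a = g → a = 𝟙 B) ∧ ∀ u : X ⟶ X, u ≫ f = f → u = 𝟙 X := by
    refine ⟨fun a ha => ?_, fun u hu => ?_⟩
    · obtain ⟨s, hs'⟩ : ∃ s : X⟦(1 : ℤ)⟧ ⟶ B, a - 𝟙 B = d ≫ s :=
        Triangle.yoneda_exact₃ _ hT (a - 𝟙 B) (by
          change g ≫ (a - 𝟙 B) = 0
          rw [Preadditive.comp_sub, ha, Category.comp_id, sub_self])
      rwa [hX.shift_hom_eq_zero hhom hsh hB hl s, comp_zero, sub_eq_zero] at hs'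
    · obtain ⟨s, hs'⟩ : ∃ s : X⟦(1 : ℤ)⟧ ⟶ B, (u - 𝟙 X)⟦(1 : ℤ)⟧' = s ≫ d :=
        Triangle.coyoneda_exact₁ _ hT ((u - 𝟙 X)⟦(1 : ℤ)⟧') (by
          change (u - 𝟙 X)⟦(1 : ℤ)⟧' ≫ f⟦(1 : ℤ)⟧' = 0
          rw [← Functor.map_comp, Preadditive.sub_comp, hu, Category.id_comp, sub_self,
            Functor.map_zero])
      rw [hX.shift_hom_eq_zero hhom hsh hB hl s, zero_comp] at hs'
      rw [← sub_eq_zero]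
      exact (shiftFunctor D (1 : ℤ)).map_injective (by rw [hs', Functor.map_zero])
  induction h generalizing l' with
  | zero X hX =>
    cases h' with
    | zero => rfl
    | step f g d hT φ hB hB' l hl hX' =>
      obtain ⟨p, hp, -⟩ := hle hT hB hB' hl hX' (.zero _ hX)
      simp at hp
  | @step X E B f g d hT φ hB hB' l hl hX ih =>
    have hE : Tower P E ((φ, B) :: l) := .step f g d hT φ hB hB' l hl hX
    cases h' with
    | zero _ hE0 =>
      obtain ⟨p, hp, -⟩ := hle hT hB hB' hl hX (.zero _ hE0)
      simp at hp
    | @step X' _ B₂ f' g' d' hT' φ' hB₂ hB₂' l' hl' hX' =>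
      have hE' : Tower P E ((φ', B₂) :: l') := .step f' g' d' hT' φ' hB₂ hB₂' l' hl' hX'
      obtain ⟨p, hp, hpφ⟩ := hle hT hB hB' hl hX hE'
      obtain ⟨q, hq, hqφ⟩ := hle hT' hB₂ hB₂' hl' hX' hE
      have h1 : φ' ≤ p.1 := by
        rcases List.mem_cons.1 hp with rfl | hp
        · exact le_rfl
        · exact (hl' p hp).le
      have h2 : φ ≤ q.1 := by
        rcases List.mem_cons.1 hq with rfl | hq
        · exact le_rfl
        · exact (hl q hq).le
      -- Each last phase is the smallest in its tower, and neither tower can have only phases larger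
      -- than the last phase of the other.
      obtain rfl : φ = φ' := by linarith
      obtain ⟨⟨a, ha⟩, u, hu⟩ := hlift hT hT' hB hB₂ hl hX
      obtain ⟨⟨b, hb⟩, y, hy⟩ := hlift hT' hT hB₂ hB hl' hX'
      -- The comparison morphisms are mutually inverse because an endomorphism compatible with the
      -- triangle over the identity of `E` is an identity.
      have i1 := hid hT hB hl hX
      have i2 := hid hT' hB₂ hl' hX'
      have e1 : B ≅ B₂ := ⟨a, b, i1.1 _ (by rw [← Category.assoc, ← ha, ← hb]),
        i2.1 _ (by rw [← Category.assoc, ← hb, ← ha])⟩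
      have e2 : X ≅ X' := ⟨u, y, i1.2 _ (by rw [Category.assoc, ← hy, ← hu]),
        i2.2 _ (by rw [Category.assoc, ← hu, ← hy])⟩
      rw [List.map_cons, List.map_cons, ih (hX'.of_iso e2.symm), K.of_iso e1]

end Hom

/-- Towers can be concatenated. -/
lemma Tower.concat [IsTriangulated D] {X E Y : D} {l₁ l₂ : List (ℝ × D)} (h₁ : Tower P X l₁)
    (h₂ : Tower P Y l₂) {f : X ⟶ E} {g : E ⟶ Y} {d : Y ⟶ X⟦(1 : ℤ)⟧}
    (hT : Triangle.mk f g d ∈ distTriang D) (h : ∀ p ∈ l₁, ∀ q ∈ l₂, q.1 < p.1) :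
    Tower P E (l₂ ++ l₁) := by
  induction h₂ generalizing E with
  | zero Y hY =>
    have : IsIso f := (Triangle.isZero₃_iff_isIso₁ _ hT).1 hY
    exact h₁.of_iso (asIso f)
  | @step Y' Y B j p e hT' φ hB hB' l hl hY ih =>
    -- By the octahedral axiom the fibre `E'` of the composite `E ⟶ Y ⟶ B` is an extension of `Y'`
    -- by `X`.
    obtain ⟨E', i, k, hT''⟩ := distinguished_cocone_triangle₁ (g ≫ p)
    have o := someOctahedron' rfl hT hT' hT''
    refine .step i (g ≫ p) k hT'' φ hB hB' _ ?_ (ih o.mem fun p hp q hq => h p hp q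
      (List.mem_cons_of_mem _ hq))
    intro q hq
    rcases List.mem_append.1 hq with hq | hq
    · exact hl q hq
    · exact h q hq _ (List.mem_cons_self ..)

lemma tower_ofFn (m : ℕ) (obj : Fin (m + 1) → D) (phase : Fin m → ℝ) (factor : Fin m → D)
    (hphase : StrictAnti phase) (h0 : IsZero (obj 0)) (hmem : ∀ j, P (phase j) (factor j))
    (hne : ∀ j, ¬ IsZero (factor j)) (f : ∀ j : Fin m, obj j.castSucc ⟶ obj j.succ)
    (g : ∀ j : Fin m, obj j.succ ⟶ factor j)
    (h : ∀ j : Fin m, factor j ⟶ (obj j.castSucc)⟦(1 : ℤ)⟧)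
    (hT : ∀ j, Triangle.mk (f j) (g j) (h j) ∈ distTriang D) :
    Tower P (obj (Fin.last m)) (List.ofFn fun j => (phase j, factor j)).reverse := by
  induction m with
  | zero => simpa using Tower.zero _ h0
  | succ m ih =>
    rw [List.ofFn_succ_last, List.reverse_append, List.reverse_singleton, List.singleton_append]
    refine .step _ _ _ (hT (Fin.last m)) _ (hmem _) (hne _) _ ?_
      (ih (fun j => obj j.castSucc) (fun j => phase j.castSucc) (fun j => factor j.castSucc)
        (fun i j hij => hphase (Fin.castSucc_lt_castSucc_iff.2 hij)) h0 (fun j => hmem _)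
        (fun j => hne _) (fun j => f j.castSucc) (fun j => g j.castSucc) (fun j => h j.castSucc)
        fun j => hT j.castSucc)
    intro p hp
    rw [List.mem_reverse, List.mem_ofFn] at hp
    obtain ⟨i, rfl⟩ := hp
    exact hphase (Fin.castSucc_lt_last i)

lemma HNFiltration.tower {E : D} (F : HNFiltration P E) :
    Tower P E (List.ofFn fun j => (F.phase j, F.factor j)).reverse :=
  (tower_ofFn _ F.obj F.phase F.factor F.phase_strictAnti F.isZero_obj_zero F.factor_mem
    F.factor_nonzero F.f F.g F.h F.distinguished).of_iso F.iso

/-- Families indexed by `ℕ`, irrelevant beyond `m`, can be extended by `Function.update` without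
transport along dependent types. -/
lemma Tower.exists_sequence {E : D} {l : List (ℝ × D)} (h : Tower P E l) :
    ∃ (m : ℕ) (obj fac : ℕ → D) (ph : ℕ → ℝ), IsZero (obj 0) ∧ obj m = E ∧
      (∀ j < m, P (ph j) (fac j) ∧ ¬ IsZero (fac j) ∧ (∃ p ∈ l, p.1 = ph j) ∧
        ∃ (f : obj j ⟶ obj (j + 1)) (g : obj (j + 1) ⟶ fac j) (d : fac j ⟶ (obj j)⟦(1 : ℤ)⟧),
          Triangle.mk f g d ∈ distTriang D) ∧ ∀ i j, i < j → j < m → ph j < ph i := by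
  induction h with
  | zero X hX => exact ⟨0, fun _ => X, fun _ => X, fun _ => 0, hX, rfl, by simp, by simp⟩
  | @step X E B f g d hT φ hB hB' l hl hX ih =>
    obtain ⟨m, obj, fac, ph, h0, rfl, hj, hph⟩ := ih
    refine ⟨m + 1, Function.update obj (m + 1) E, Function.update fac m B, Function.update ph m φ,
      by simpa using h0, by simp, fun j hjm => ?_, fun i j hij hjm => ?_⟩
    · rcases Nat.lt_succ_iff_lt_or_eq.1 hjm with hjm | rfl
      · obtain ⟨h1, h2, ⟨p, hp, hp'⟩, h3⟩ := hj j hjm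
        rw [Function.update_of_ne (by omega), Function.update_of_ne (by omega),
          Function.update_of_ne (by omega), Function.update_of_ne (by omega)]
        exact ⟨h1, h2, ⟨p, List.mem_cons_of_mem _ hp, hp'⟩, h3⟩
      · rw [Function.update_self, Function.update_self, Function.update_self,
          Function.update_of_ne (by omega)]
        exact ⟨hB, hB', ⟨_, List.mem_cons_self .., rfl⟩, f, g, d, hT⟩
    · rcases Nat.lt_succ_iff_lt_or_eq.1 hjm with hjm | rfl
      · rw [Function.update_of_ne (by omega), Function.update_of_ne (by omega)]
        exact hph i j hij hjm
      · rw [Function.update_self, Function.update_of_ne (by omega)]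
        obtain ⟨-, -, ⟨p, hp, hp'⟩, -⟩ := hj i hij
        rw [← hp']
        exact hl p hp

lemma Tower.nonempty_hnFiltration {E : D} {l : List (ℝ × D)} (h : Tower P E l)
    (hE : ¬ IsZero E) : Nonempty (HNFiltration P E) := by
  obtain ⟨m, obj, fac, ph, h0, rfl, hj, hph⟩ := h.exists_sequence
  obtain _ | n := m
  · exact absurd h0 hE
  choose h1 h2 h3 f g d hT using fun j : Fin (n + 1) => hj j j.2
  exact ⟨{  n := n
            phase := fun j => ph j
            phase_strictAnti := fun i j hij => hph i j hij j.2
            obj := fun j => obj j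
            isZero_obj_zero := h0
            iso := Iso.refl _
            factor := fun j => fac j
            factor_mem := h1
            factor_nonzero := h2
            f := f
            g := g
            h := d
            distinguished := hT }⟩

/-! ### Phases and masses read off from an arbitrary tower. -/

namespace StabilityCondition

variable (σ : StabilityCondition D)

lemma P_shift_one {φ : ℝ} {X : D} (h : σ.P φ X) : σ.P (φ + 1) (X⟦(1 : ℤ)⟧) :=
  (σ.shift φ X).2 h

lemma P_of_iso {φ : ℝ} {X Y : D} (h : σ.P φ X) (e : X ≅ Y) : σ.P φ Y :=
  have := σ.closed_iso φ
  ObjectProperty.prop_of_iso _ e h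

lemma P_shift (n : ℤ) {φ : ℝ} {X : D} (h : σ.P φ X) : σ.P (φ + n) (X⟦n⟧) := by
  induction n using Int.induction_on with
  | zero => simpa using σ.P_of_iso h ((shiftFunctorZero D ℤ).app X).symm
  | succ n ih =>
    have := σ.P_of_iso (σ.P_shift_one ih) ((shiftFunctorAdd D (n : ℤ) 1).app X).symm
    rw [add_assoc] at this
    exact_mod_cast this
  | pred n ih =>
    refine (σ.shift _ _).1 ?_
    have h1 := σ.P_of_iso ih ((shiftFunctorAdd' D (-(n : ℤ) - 1) 1 (-n) (by ring)).app X)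
    have h2 : φ + ((-(n : ℤ) : ℤ) : ℝ) = φ + ((-(n : ℤ) - 1 : ℤ) : ℝ) + 1 := by push_cast; ring
    rwa [h2] at h1

lemma P_of_shift (n : ℤ) {φ : ℝ} {X : D} (h : σ.P (φ + n) (X⟦n⟧)) : σ.P φ X := by
  have h1 := σ.P_of_iso (σ.P_shift (-n) h) ((shiftEquiv D n).unitIso.app X).symm
  simpa using h1

lemma exists_tower (E : D) : ∃ l, Tower σ.P E l := by
  by_cases hE : IsZero E
  · exact ⟨[], .zero _ hE⟩
  · exact ⟨_, (σ.hn E hE).tower⟩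

lemma tower_unique {E : D} {l l' : List (ℝ × D)} (h : Tower σ.P E l) (h' : Tower σ.P E l') :
    (l.map fun p => (p.1, K.of p.2)) = l'.map fun p => (p.1, K.of p.2) :=
  h.unique σ.hom_eq_zero (fun _ _ => σ.P_shift_one) h'

variable {σ}

section

variable {E : D} {l : List (ℝ × D)} (h : Tower σ.P E l) (hE : ¬ IsZero E)

include h

lemma map_fst_tower : l.map Prod.fst = (List.ofFn (σ.hn E hE).phase).reverse := by
  have h1 := congrArg (List.map Prod.fst) (σ.tower_unique h (σ.hn E hE).tower)
  rw [List.map_map, List.map_map, List.map_reverse, List.map_ofFn] at h1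
  exact h1

lemma tower_phase_mem {p : ℝ × D} (hp : p ∈ l) :
    σ.phaseMinus E hE ≤ p.1 ∧ p.1 ≤ σ.phasePlus E hE := by
  have h1 : p.1 ∈ l.map Prod.fst := List.mem_map_of_mem hp
  rw [map_fst_tower h hE, List.mem_reverse, List.mem_ofFn] at h1
  obtain ⟨i, hi⟩ := h1
  rw [← hi]
  exact ⟨(σ.hn E hE).phase_strictAnti.antitone (Fin.le_last i),
    (σ.hn E hE).phase_strictAnti.antitone (Fin.zero_le i)⟩

lemma exists_tower_phaseMinus : ∃ p ∈ l, p.1 = σ.phaseMinus E hE := by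
  have h1 : σ.phaseMinus E hE ∈ l.map Prod.fst := by
    rw [map_fst_tower h hE, List.mem_reverse, List.mem_ofFn]
    exact ⟨_, rfl⟩
  exact List.mem_map.1 h1

lemma exists_tower_phasePlus : ∃ p ∈ l, p.1 = σ.phasePlus E hE := by
  have h1 : σ.phasePlus E hE ∈ l.map Prod.fst := by
    rw [map_fst_tower h hE, List.mem_reverse, List.mem_ofFn]
    exact ⟨_, rfl⟩
  exact List.mem_map.1 h1

lemma mass_eq_tower : σ.mass E hE = (l.map fun p => ‖σ.Z (K.of p.2)‖).sum := by
  have h1 := congrArg (fun L => (L.map fun q : ℝ × K D => ‖σ.Z q.2‖).sum)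
    (σ.tower_unique h (σ.hn E hE).tower)
  rw [List.map_map, List.map_map, List.map_reverse, List.sum_reverse, List.map_ofFn,
    List.sum_ofFn] at h1
  exact h1.symm

end

end StabilityCondition

end Bridgeland

/-! ### From a stability function on the heart to a stability condition. -/

namespace Bridgeland

variable {D : Type u} [Category.{v} D] [Preadditive D] [HasZeroObject D] [HasShift D ℤ]
  [∀ n : ℤ, (shiftFunctor D n).Additive] [Pretriangulated D] [IsTriangulated D]
  (t : TStructure D)

/-- The central charge of the objects of the heart. -/
abbrev heartCharge (Z : K D →+ ℂ) (X : t.heart.FullSubcategory) : ℂ := Z (K.of X.obj)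

lemma isAdditiveOn_heartCharge (Z : K D →+ ℂ) : IsAdditiveOn (heartCharge t Z) :=
  isAdditiveOn t Z

/-- A stability function on the heart with Harder-Narasimhan filtrations. -/
structure IsStabilityFunction (Z : K D →+ ℂ) : Prop where
  mem_H : ∀ X : t.heart.FullSubcategory, ¬ IsZero X → heartCharge t Z X ∈ H
  exists_filtration : ∀ X : t.heart.FullSubcategory,
    ∃ l, Filtration (Semistable (heartCharge t Z)) X l

/-- The shifts of semistable objects of the heart. -/
def slice (Z : K D →+ ℂ) (φ : ℝ) : ObjectProperty D := fun E =>
  ∃ (k : ℤ) (X : t.heart.FullSubcategory), Semistable (heartCharge t Z) (φ - k) X ∧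
    Nonempty (E ≅ X.obj⟦k⟧)

variable {t}

omit [IsTriangulated D] in
lemma not_isZero_obj {X : t.heart.FullSubcategory} (hX : ¬ IsZero X) : ¬ IsZero X.obj :=
  fun h => hX (t.isZero_of_isZero_obj h)

omit [IsTriangulated D] in
lemma isZero_obj {X : t.heart.FullSubcategory} (hX : IsZero X) : IsZero X.obj :=
  t.heart.ι.map_isZero hX

omit [IsTriangulated D] in
lemma slice_eq_add (Z : K D →+ ℂ) {φ : ℝ} {k : ℤ} {X : t.heart.FullSubcategory}
    (h : Semistable (heartCharge t Z) (φ - k) X) : k < φ ∧ φ ≤ k + 1 :=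
  ⟨by linarith [h.pos], by linarith [h.le_one]⟩

lemma int_eq_of_mem {φ : ℝ} {k m : ℤ} (h1 : k < φ) (h2 : φ ≤ k + 1) (h3 : m < φ)
    (h4 : φ ≤ m + 1) : k = m := by
  have h5 : (k : ℝ) < m + 1 := by linarith
  have h6 : (m : ℝ) < k + 1 := by linarith
  norm_cast at h5 h6
  lia

variable (t) (Z : K D →+ ℂ)

instance (φ : ℝ) : (slice t Z φ).IsClosedUnderIsomorphisms where
  of_iso := by
    rintro E E' e ⟨k, X, hX, ⟨e'⟩⟩
    exact ⟨k, X, hX, ⟨e.symm ≪≫ e'⟩⟩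

variable {t Z}

omit [IsTriangulated D] in
lemma slice_shift {φ : ℝ} {E : D} (h : slice t Z φ E) (n : ℤ) : slice t Z (φ + n) (E⟦n⟧) := by
  obtain ⟨k, X, hX, ⟨e⟩⟩ := h
  refine ⟨k + n, X, ?_, ⟨(shiftFunctor D n).mapIso e ≪≫ ((shiftFunctorAdd D k n).app X.obj).symm⟩⟩
  push_cast
  rwa [add_sub_add_right_eq_sub]

omit [IsTriangulated D] in
lemma slice_of_shift {φ : ℝ} {E : D} {n : ℤ} (h : slice t Z (φ + n) (E⟦n⟧)) : slice t Z φ E := by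
  have h1 := slice_shift h (-n)
  have h2 := (slice t Z _).prop_of_iso ((shiftEquiv D n).unitIso.app E).symm h1
  simpa using h2

omit [IsTriangulated D] in
lemma slice_of_semistable {φ : ℝ} {X : t.heart.FullSubcategory}
    (h : Semistable (heartCharge t Z) φ X) : slice t Z φ X.obj :=
  ⟨0, X, by simpa using h, ⟨((shiftFunctorZero D ℤ).app X.obj).symm⟩⟩

omit [IsTriangulated D] in
lemma exists_of_slice {φ : ℝ} {E : D} (h : slice t Z φ E) {k : ℤ} (h1 : k < φ) (h2 : φ ≤ k + 1) :
    ∃ X : t.heart.FullSubcategory, Semistable (heartCharge t Z) (φ - k) X ∧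
      Nonempty (E⟦-k⟧ ≅ X.obj) := by
  obtain ⟨k', X, hX, ⟨e⟩⟩ := h
  obtain rfl := int_eq_of_mem h1 h2 (slice_eq_add Z hX).1 (slice_eq_add Z hX).2
  exact ⟨X, hX, ⟨(shiftFunctor D (-k)).mapIso e ≪≫ (shiftEquiv D k).unitIso.symm.app X.obj⟩⟩

omit [IsTriangulated D] in
lemma exists_of_slice_zero {φ : ℝ} {E : D} (h : slice t Z φ E) (h1 : 0 < φ) (h2 : φ ≤ 1) :
    ∃ X : t.heart.FullSubcategory, Semistable (heartCharge t Z) φ X ∧ Nonempty (E ≅ X.obj) := by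
  obtain ⟨k', X, hX, ⟨e⟩⟩ := h
  obtain rfl := int_eq_of_mem (k := 0) (by simpa using h1) (by simpa using h2)
    (slice_eq_add Z hX).1 (slice_eq_add Z hX).2
  exact ⟨X, by simpa using hX, ⟨e ≪≫ (shiftFunctorZero D ℤ).app X.obj⟩⟩

lemma slice_of_isZero (φ : ℝ) {E : D} (hE : IsZero E) : slice t Z φ E := by
  have h1 := Int.ceil_lt_add_one φ
  have h2 := Int.le_ceil φ
  have hX : IsZero (⟨E, t.heart_of_isZero hE⟩ : t.heart.FullSubcategory) :=
    t.isZero_of_isZero_obj hE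
  refine ⟨⌈φ⌉ - 1, ⟨E, t.heart_of_isZero hE⟩, semistable_of_isZero
    (isAdditiveOn_heartCharge t Z) (by push_cast; linarith) (by push_cast; linarith) hX,
    ⟨hE.iso ((shiftFunctor D _).map_isZero hE)⟩⟩

lemma semistable_of_triangle {φ : ℝ} {T : Triangle D} (hT : T ∈ distTriang D)
    {X Y : t.heart.FullSubcategory} (hX : Semistable (heartCharge t Z) φ X)
    (hY : Semistable (heartCharge t Z) φ Y) (e : T.obj₁ ≅ X.obj) (e' : T.obj₃ ≅ Y.obj) :
    ∃ W : t.heart.FullSubcategory, Semistable (heartCharge t Z) φ W ∧ W.obj = T.obj₂ := by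
  have h := t.heart_of_triangle hT (t.heart.prop_of_iso e.symm X.property)
    (t.heart.prop_of_iso e'.symm Y.property)
  have hT' : Triangle.mk (e.inv ≫ T.mor₁) (T.mor₂ ≫ e'.hom) (e'.inv ≫ T.mor₃ ≫ e.hom⟦1⟧') ∈
      distTriang D := by
    refine distinguished_of_iso hT e.symm (Iso.refl _) e'.symm (by simp) (by simp) ?_
    simp [← Functor.map_comp]
  obtain ⟨w, hw⟩ := t.shortExact_of_triangle (X := X) (Y := ⟨T.obj₂, h⟩) (Z := Y)
    (ObjectProperty.homMk (e.inv ≫ T.mor₁)) (ObjectProperty.homMk (T.mor₂ ≫ e'.hom)) _ hT'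
  exact ⟨_, Semistable.ext (isAdditiveOn_heartCharge t Z) hw hX hY, rfl⟩

lemma slice_ext {φ : ℝ} {T : Triangle D} (hT : T ∈ distTriang D) (h₁ : slice t Z φ T.obj₁)
    (h₃ : slice t Z φ T.obj₃) : slice t Z φ T.obj₂ := by
  have h1 := Int.ceil_lt_add_one φ
  have h2 := Int.le_ceil φ
  obtain ⟨k, hk, hk'⟩ : ∃ k : ℤ, (k : ℝ) < φ ∧ φ ≤ k + 1 :=
    ⟨⌈φ⌉ - 1, by push_cast; linarith, by push_cast; linarith⟩
  obtain ⟨X, hX, ⟨e⟩⟩ := exists_of_slice h₁ hk hk'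
  obtain ⟨Y, hY, ⟨e'⟩⟩ := exists_of_slice h₃ hk hk'
  obtain ⟨W, hW, hW'⟩ := semistable_of_triangle (Triangle.shift_distinguished T hT (-k)) hX hY e e'
  have h3 := slice_of_semistable hW
  rw [hW'] at h3
  refine slice_of_shift (n := -k) ?_
  push_cast
  exact h3

/-- Vanishing of morphisms between semistable objects for two central charges. -/
lemma slice_hom_eq_zero {Z' : K D →+ ℂ} (hZ : IsStabilityFunction t Z)
    (hZ' : IsStabilityFunction t Z') {ε : ℝ}
    (hε : ∀ X : t.heart.FullSubcategory, ¬ IsZero X →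
      phase (heartCharge t Z X) ≤ phase (heartCharge t Z' X) + ε)
    {φ₁ φ₂ : ℝ} (hε0 : 0 ≤ ε) (h : φ₂ + ε < φ₁) {A₁ A₂ : D} (h₁ : slice t Z φ₁ A₁)
    (h₂ : slice t Z' φ₂ A₂) (f : A₁ ⟶ A₂) : f = 0 := by
  obtain ⟨k, X, hX, ⟨e⟩⟩ := h₁
  obtain ⟨m, Y, hY, ⟨e'⟩⟩ := h₂
  have h1 := slice_eq_add Z hX
  have h2 := slice_eq_add Z' hY
  -- The phases force `m ≤ k`. For `m < k` the t-structure kills the morphism; for `m = k` the image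
  -- of a nonzero morphism would have incompatible phases.
  have hmk : m ≤ k := by
    have : (m : ℝ) < k + 1 := by linarith
    norm_cast at this
    lia
  suffices hf : e.inv ≫ f ≫ e'.hom = 0 by
    have h3 : f = e.hom ≫ (e.inv ≫ f ≫ e'.hom) ≫ e'.inv := by simp
    rw [h3, hf]; simp
  rcases hmk.lt_or_eq with hmk | rfl
  · have hXh := (t.mem_heart_iff _).1 X.property
    have hYh := (t.mem_heart_iff _).1 Y.property
    have := hXh.1
    have := hYh.2
    exact t.zero_of_isLE_of_isGE _ (-k) (-m) (by lia) (t.isLE_shift X.obj 0 k (-k))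
      (t.isGE_shift Y.obj 0 m (-m))
  · obtain ⟨f', hf'⟩ := (shiftFunctor D m).map_surjective (e.inv ≫ f ≫ e'.hom)
    rw [← hf']
    obtain rfl | hne := eq_or_ne f' 0
    · simp
    obtain ⟨I, hI, hI1, hI2⟩ := Semistable.exists_of_hom_ne_zero (isAdditiveOn_heartCharge t Z')
      hZ.mem_H hZ'.mem_H hX hY (ObjectProperty.homMk f') fun h0 => hne (congrArg (fun x => x.hom) h0)
    linarith [hε I hI]

omit [IsTriangulated D] in
lemma heartCharge_eq_ray {Z : K D →+ ℂ} {E : D} {k : ℤ} {X : t.heart.FullSubcategory}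
    (e : E ≅ X.obj⟦k⟧) : Z (K.of E) = ray k * heartCharge t Z X := by
  rw [K.of_iso e, K.of_shift, map_zsmul, ray_int, zsmul_eq_mul]

lemma slice_charge (hZ : IsStabilityFunction t Z) {φ : ℝ} {E : D} (h : slice t Z φ E)
    (hE : ¬ IsZero E) : ∃ m : ℝ, 0 < m ∧ Z (K.of E) = m * ray φ := by
  obtain ⟨k, X, hX, ⟨e⟩⟩ := h
  have hX0 : ¬ IsZero X := fun h => hE (((shiftFunctor D k).map_isZero (isZero_obj h)).of_iso e)
  have hm := hZ.mem_H X hX0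
  refine ⟨‖heartCharge t Z X‖, norm_pos_iff.2 (ne_zero_of_mem_H hm), ?_⟩
  rw [heartCharge_eq_ray e]
  nth_rw 1 [eq_norm_mul_ray hm]
  rw [hX.phase_eq hm, mul_left_comm, ← ray_add]
  ring_nf

lemma Filtration.tower {Q : ℝ → t.heart.FullSubcategory → Prop} {P : ℝ → ObjectProperty D}
    {X : t.heart.FullSubcategory} {l : List (ℝ × t.heart.FullSubcategory)}
    (h : Filtration Q X l) (hQ : ∀ φ B, Q φ B → P φ B.obj) :
    Tower P X.obj (l.map fun p => (p.1, p.2.obj)) := by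
  induction h with
  | zero X hX => exact .zero _ (isZero_obj hX)
  | step f g w h φ hB hB' l hl hX ih =>
    obtain ⟨δ, hδ⟩ := t.exists_triangle_of_shortExact h
    refine .step _ _ δ hδ φ (hQ _ _ hB) (not_isZero_obj hB') _ (fun p hp => ?_) ih
    obtain ⟨q, hq, rfl⟩ := List.mem_map.1 hp
    exact hl q hq

/-- The object `E` of `D` has the tower given by the filtration of an object of the heart. -/
lemma Filtration.tower_shift {X : t.heart.FullSubcategory}
    {l : List (ℝ × t.heart.FullSubcategory)}
    (h : Filtration (Semistable (heartCharge t Z)) X l) (k : ℤ) {E : D} (e : X.obj⟦k⟧ ≅ E) :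
    Tower (slice t Z) E (l.map fun p => (p.1 + k, p.2.obj⟦k⟧)) := by
  have h1 := ((h.tower fun _ _ => slice_of_semistable).shift k (P' := slice t Z)
    fun φ X hX => slice_shift hX k).of_iso e
  rwa [List.map_map] at h1

omit [IsTriangulated D] in
lemma exists_iso_shift (b : ℤ) {E : D} (h1 : t.IsLE E b) (h2 : t.IsGE E b) :
    ∃ X : t.heart.FullSubcategory, Nonempty (X.obj⟦-b⟧ ≅ E) :=
  ⟨⟨E⟦b⟧, (t.mem_heart_iff _).2 ⟨t.isLE_shift _ b b 0, t.isGE_shift _ b b 0⟩⟩,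
    ⟨((shiftEquiv D b).unitIso.app E).symm⟩⟩

omit [IsTriangulated D] in
lemma norm_charge_shift (Z : K D →+ ℂ) (X : D) (k : ℤ) : ‖Z (K.of (X⟦k⟧))‖ = ‖Z (K.of X)‖ := by
  rw [K.of_shift, map_zsmul]
  rcases Int.units_eq_one_or k.negOnePow with hk | hk <;> simp [hk]

/-- Concatenation of a tower with the filtration of a shifted object of the heart. -/
lemma Tower.concat_filtration {T : Triangle D} {l₁ : List (ℝ × D)}
    (hl₁ : Tower (slice t Z) T.obj₁ l₁) (hT : T ∈ distTriang D) {b : ℤ}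
    (hb₁ : ∀ p ∈ l₁, -((b - 1 : ℤ) : ℝ) < p.1) {X : t.heart.FullSubcategory}
    (e : X.obj⟦-b⟧ ≅ T.obj₃) {l : List (ℝ × t.heart.FullSubcategory)}
    (hl : Filtration (Semistable (heartCharge t Z)) X l) : ∃ l₂,
    Tower (slice t Z) T.obj₂ l₂ ∧ (∀ p ∈ l₂, -(b : ℝ) < p.1) ∧
      (l₂.map fun p => ‖Z (K.of p.2)‖).sum = (l.map fun p => ‖heartCharge t Z p.2‖).sum +
        (l₁.map fun p => ‖Z (K.of p.2)‖).sum := by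
  refine ⟨_, hl₁.concat (hl.tower_shift (-b) e) hT fun p hp q hq => ?_, fun p hp => ?_, ?_⟩
  · obtain ⟨r, hr, rfl⟩ := List.mem_map.1 hq
    have h5 := hb₁ p hp
    have h6 := (hl.forall_mem r hr).1.le_one
    push_cast at h5 ⊢
    linarith
  · rcases List.mem_append.1 hp with hp | hp
    · obtain ⟨q, hq, rfl⟩ := List.mem_map.1 hp
      have h6 := (hl.forall_mem q hq).1.pos
      push_cast
      linarith
    · have h5 := hb₁ p hp
      push_cast at h5
      linarith
  · rw [List.map_append, List.sum_append, List.map_map]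
    congr 2
    exact List.map_congr_left fun p _ => norm_charge_shift Z _ _

lemma exists_tower_slice (ht : ∀ X, t.bounded X) (hZ : IsStabilityFunction t Z) (E : D) :
    ∃ l, Tower (slice t Z) E l := by
  obtain ⟨⟨a, ha⟩, ⟨b, hb⟩⟩ := ht E
  suffices h : ∃ l, Tower (slice t Z) E l ∧ ∀ p ∈ l, -(b : ℝ) < p.1 by
    obtain ⟨l, hl, -⟩ := h
    exact ⟨l, hl⟩
  refine t.bounded_induction (fun b E => ∃ l, Tower (slice t Z) E l ∧ ∀ p ∈ l, -(b : ℝ) < p.1)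
    (fun b X hX => ⟨[], .zero X hX, by simp⟩) (fun b T hT h₁ h₂ h₃ h₄ => ?_) a b E hb ha
  obtain ⟨l₁, hl₁, hb₁⟩ := h₂
  obtain ⟨X, ⟨e⟩⟩ := exists_iso_shift b h₃ h₄
  obtain ⟨l, hl⟩ := hZ.exists_filtration X
  obtain ⟨l₂, hl₂, hb₂, -⟩ := hl₁.concat_filtration hT hb₁ e hl
  exact ⟨l₂, hl₂, hb₂⟩

/-- The stability condition given by a stability function on the heart of a bounded
t-structure. -/
def stabilityCondition (ht : ∀ X, t.bounded X) (hZ : IsStabilityFunction t Z) :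
    StabilityCondition D where
  Z := Z
  P := slice t Z
  closed_iso _ := inferInstance
  closed_finite_sum φ := ObjectProperty.isClosedUnderFiniteProducts_of_ext _
    (fun _ => slice_of_isZero φ) fun _ => slice_ext
  charge _ _ := slice_charge hZ
  shift φ E := ⟨fun h => slice_of_shift (n := 1) (by simpa using h), fun h => by
    simpa using slice_shift h 1⟩
  hom_eq_zero φ₁ φ₂ h A₁ A₂ h₁ h₂ f :=
    slice_hom_eq_zero hZ hZ (ε := 0) (by simp) le_rfl (by simpa using h) h₁ h₂ f
  exists_hn E hE := by
    obtain ⟨l, hl⟩ := exists_tower_slice ht hZ E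
    exact hl.nonempty_hnFiltration hE

lemma heart_stabilityCondition (ht : ∀ X, t.bounded X) (hZ : IsStabilityFunction t Z) :
    (stabilityCondition ht hZ).heart = t.heart := by
  ext E
  constructor
  · intro h
    induction h with
    | zero X hX => exact t.heart_of_isZero hX
    | of X hX =>
      obtain ⟨φ, hφ, hX⟩ := hX
      obtain ⟨Y, -, ⟨e⟩⟩ := exists_of_slice_zero hX hφ.1 hφ.2
      exact t.heart.prop_of_iso e.symm Y.property
    | ext T hT h₁ h₃ ih₁ ih₃ => exact t.heart_of_triangle hT ih₁ ih₃
  · intro h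
    obtain ⟨l, hl⟩ := hZ.exists_filtration ⟨E, h⟩
    refine (hl.tower (P := slice t Z) fun _ _ => slice_of_semistable).prop_of_ext _
      (fun X hX => .zero X hX) (fun p hp => ?_) (fun T hT => .ext T hT)
    obtain ⟨q, hq, rfl⟩ := List.mem_map.1 hp
    have h1 := (hl.forall_mem q hq).1
    exact .of _ ⟨q.1, ⟨h1.pos, h1.le_one⟩, slice_of_semistable h1⟩

end Bridgeland

/-! ### Stability functions from values at the simple objects; local finiteness. -/

namespace Bridgeland

section StrictFiniteLength

variable {C A : Type u} [Category.{v} C] [HasZeroMorphisms C] [Category.{v} A] [Abelian A]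

/-- A strict subobject is a kernel, so containment in it is the vanishing of a composite, which a
faithful functor detects. No exactness of `F` is needed. -/
lemma imageSubobject_map_le_iff (F : C ⥤ A) [F.Faithful] [F.PreservesZeroMorphisms] {X : C}
    (S S' : StrictSubobject X) : imageSubobject (F.map S.1.arrow) ≤ imageSubobject (F.map S'.1.arrow) ↔ S ≤ S' := by
  constructor
  · intro h
    obtain ⟨N⟩ := S'.2
    have h1 : (imageSubobject (F.map S'.1.arrow)).arrow ≫ F.map N.g = 0 := by
      rw [← cancel_epi (factorThruImageSubobject (F.map S'.1.arrow)), comp_zero]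
      rw [imageSubobject_arrow_comp_assoc, ← F.map_comp, N.w, F.map_zero]
    have h2 : S.1.arrow ≫ N.g = 0 := F.map_injective (by
      rw [F.map_comp, F.map_zero, ← imageSubobject_arrow_comp (F.map S.1.arrow), Category.assoc]
      rw [← Subobject.ofLE_arrow h, Category.assoc, h1, comp_zero, comp_zero])
    obtain ⟨d, hd⟩ : ∃ d : (S.1 : C) ⟶ (S'.1 : C), d ≫ S'.1.arrow = S.1.arrow :=
      ⟨_, N.isLimit.fac (KernelFork.ofι _ h2) WalkingParallelPair.zero⟩
    exact Subobject.le_of_comm d hd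
  · intro h
    have h1 : F.map (Subobject.ofLE S.1 S'.1 h) ≫ F.map S'.1.arrow = F.map S.1.arrow := by
      rw [← F.map_comp, Subobject.ofLE_arrow]
    rw [← h1]
    exact imageSubobject_comp_le _ _

/-- A category with a faithful functor to an abelian category of finite length is of finite
length with respect to strict subobjects. -/
lemma isStrictFiniteLengthCategory_of_faithful (F : C ⥤ A) [F.Faithful]
    [F.PreservesZeroMorphisms] (hA : IsFiniteLengthCategory A) :
    IsStrictFiniteLengthCategory C := fun X => by
  have h1 := (hA (F.obj X)).1
  have h2 := (hA (F.obj X)).2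
  have h3 : WellFoundedLT (Subobject (F.obj X)) := inferInstance
  have h4 : WellFoundedGT (Subobject (F.obj X)) := inferInstance
  let e : StrictSubobject X ↪o Subobject (F.obj X) :=
    OrderEmbedding.ofMapLEIff (fun S => imageSubobject (F.map S.1.arrow)) (imageSubobject_map_le_iff F)
  exact ⟨e.strictMono.wellFoundedLT, e.strictMono.wellFoundedGT⟩

end StrictFiniteLength

section Sum

variable {ι : Type*} [Fintype ι] {z : ι → ℂ}

lemma nsmul_mem_H {z : ℂ} (hz : z ∈ H) {m : ℕ} (hm : m ≠ 0) : m • z ∈ H := by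
  obtain ⟨m, rfl⟩ := Nat.exists_eq_succ_of_ne_zero hm
  induction m with
  | zero => simpa using hz
  | succ m ih => rw [Nat.succ_eq_add_one, succ_nsmul]; exact add_mem_H (ih (by simp)) hz

lemma sum_mem_H (hz : ∀ i, z i ∈ H) {c : ι → ℕ} (hc : c ≠ 0) : ∑ i, c i • z i ∈ H := by
  classical
  obtain ⟨i, hi⟩ := Function.ne_iff.1 hc
  have h1 (j : ι) : c j • z j = 0 ∨ c j • z j ∈ H := by
    by_cases hj : c j = 0
    · left; simp [hj]
    · exact Or.inr (nsmul_mem_H (hz j) hj)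
  have h2 : ∑ j ∈ Finset.univ.erase i, c j • z j = 0 ∨
      ∑ j ∈ Finset.univ.erase i, c j • z j ∈ H := by
    refine Finset.sum_induction _ (fun x => x = 0 ∨ x ∈ H) ?_ (Or.inl rfl) fun j _ => h1 j
    rintro a b (rfl | ha) (rfl | hb)
    · simp
    · right; simpa using hb
    · right; simpa using ha
    · exact Or.inr (add_mem_H ha hb)
  rw [← Finset.add_sum_erase _ _ (Finset.mem_univ i)]
  have h3 := nsmul_mem_H (hz i) hi
  rcases h2 with h2 | h2
  · rwa [h2, add_zero]
  · exact add_mem_H h3 h2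

lemma above_sum (φ : ℝ) (c : ι → ℕ) : above φ (∑ i, c i • z i) = ∑ i, c i * above φ (z i) := by
  simp [above, Finset.sum_mul, mul_assoc]

/-- The smallest phase of the `z i` works: `above ε` is nonnegative on each of them, hence on their
combinations. -/
lemma exists_le_phase (hz : ∀ i, z i ∈ H) :
    ∃ ε : ℝ, 0 < ε ∧ ε ≤ 1 ∧ ∀ c : ι → ℕ, c ≠ 0 → ε ≤ phase (∑ i, c i • z i) := by
  obtain ⟨ε, h0, h1, hε⟩ : ∃ ε : ℝ, 0 < ε ∧ ε ≤ 1 ∧ ∀ i, ε ≤ phase (z i) := by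
    rcases isEmpty_or_nonempty ι with h | h
    · exact ⟨1, one_pos, le_rfl, fun i => h.elim i⟩
    · obtain ⟨i, hi⟩ := Finite.exists_min fun i => phase (z i)
      exact ⟨_, phase_pos (hz i), phase_le_one (hz i), hi⟩
  refine ⟨ε, h0, h1, fun c hc => ?_⟩
  rw [← above_nonneg_iff (sum_mem_H hz hc) h0 h1, above_sum]
  exact Finset.sum_nonneg fun i _ => mul_nonneg (Nat.cast_nonneg _)
    ((above_nonneg_iff (hz i) h0 h1).2 (hε i))

lemma above_le_norm (φ : ℝ) (z : ℂ) : above φ z ≤ ‖z‖ := by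
  refine (Complex.im_le_norm _).trans ?_
  rw [norm_mul, norm_ray, mul_one]

/-- The direction `ε / 2` lies strictly below all phases, so `above (ε / 2)` is positive on every `z
i`. Being additive and bounded by the norm, it shows that the combinations do not cancel; its values
at the `z i` are the weights. -/
lemma exists_norm_sub_le (hz : ∀ i, z i ∈ H) :
    ∃ a : ι → ℝ, (∀ i, 0 < a i) ∧ ∀ (w : ι → ℂ) (η : ℝ), 0 ≤ η →
      (∀ i, ‖w i - z i‖ ≤ η * a i) → ∀ c : ι → ℕ,
        ‖∑ i, c i • w i - ∑ i, c i • z i‖ ≤ η * ‖∑ i, c i • z i‖ := by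
  classical
  obtain ⟨ε, h0, h1, hε⟩ := exists_le_phase hz
  have hpos (i : ι) : 0 < above (ε / 2) (z i) := by
    refine above_pos (hz i) (by linarith) ?_
    have := hε (Pi.single i 1) (by simp)
    simp only [Pi.single_apply, ite_smul, one_smul, zero_smul, Finset.sum_ite_eq',
      Finset.mem_univ, if_true] at this
    linarith
  refine ⟨fun i => above (ε / 2) (z i), hpos, fun w η hη hw c => ?_⟩
  refine le_trans ?_ (mul_le_mul_of_nonneg_left (above_le_norm (ε / 2) _) hη)
  rw [above_sum, ← Finset.sum_sub_distrib, Finset.mul_sum]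
  refine (norm_sum_le _ _).trans (Finset.sum_le_sum fun i _ => ?_)
  rw [← smul_sub, nsmul_eq_mul, norm_mul, Complex.norm_natCast]
  have := mul_le_mul_of_nonneg_left (hw i) (Nat.cast_nonneg (α := ℝ) (c i))
  linarith

end Sum

variable {D : Type u} [Category.{v} D] [Preadditive D] [HasZeroObject D] [HasShift D ℤ]
  [∀ n : ℤ, (shiftFunctor D n).Additive] [Pretriangulated D] [IsTriangulated D]
  {t : TStructure D}

/-- The total multiplicity serves as length, and the multiplicities of a quotient are bounded by
those of the object, which leaves finitely many charges. -/
lemma isStabilityFunction_of_multiplicities {ι : Type} [Fintype ι]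
    {c : t.heart.FullSubcategory → ι → ℕ}
    (hc : ∀ T : ShortComplex t.heart.FullSubcategory, T.ShortExact → c T.X₂ = c T.X₁ + c T.X₃)
    (hc0 : ∀ X, c X = 0 → IsZero X) {Z : K D →+ ℂ} {z : ι → ℂ}
    (hZ : ∀ X, heartCharge t Z X = ∑ i, c X i • z i) (hz : ∀ i, z i ∈ H) :
    IsStabilityFunction t Z := by
  classical
  have hH (X : t.heart.FullSubcategory) (hX : ¬ IsZero X) : heartCharge t Z X ∈ H := by
    rw [hZ]
    exact sum_mem_H hz fun h => hX (hc0 X h)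
  refine ⟨hH, exists_filtration (isAdditiveOn_heartCharge t Z) hH
    (len := fun X => ∑ i, (c X i : ℤ)) (fun T hT => ?_) (fun X => ?_) (fun X hX => ?_) fun E => ?_⟩
  · simp [hc T hT, Finset.sum_add_distrib]
  · exact Finset.sum_nonneg fun i _ => by positivity
  · rw [Finset.sum_eq_zero_iff_of_nonneg fun i _ => by positivity] at hX
    exact hc0 X (funext fun i => by simpa using hX i (Finset.mem_univ i))
  · refine ((Set.finite_Icc (0 : ι → ℕ) (c E)).image fun m => ∑ i, m i • z i).subset ?_
    rintro _ ⟨Q, p, hp, rfl⟩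
    have h1 : c E = c (kernel p) + c Q := hc _ (shortExact_kernel p)
    exact ⟨c Q, ⟨fun i => Nat.zero_le _, by rw [h1]; exact fun i => Nat.le_add_left _ _⟩,
      (hZ Q).symm⟩

/-- Nonzero semistable objects have no phase in `(k, k + ε₀)` for an integer `k`. An interval of
length at most `ε₀` therefore meets only one shift of the heart, and its category embeds faithfully
into the heart. -/
lemma isLocallyFinite_stabilityCondition (ht : ∀ X, t.bounded X) {Z : K D →+ ℂ}
    (hZ : IsStabilityFunction t Z) (hA : IsFiniteLengthCategory t.heart.FullSubcategory)
    {ε₀ : ℝ} (hε₀ : 0 < ε₀)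
    (h : ∀ X : t.heart.FullSubcategory, ¬ IsZero X → ε₀ ≤ phase (heartCharge t Z X)) :
    (stabilityCondition ht hZ).IsLocallyFinite := by
  refine ⟨min (ε₀ / 2) (1 / 3), by positivity, (min_le_right _ _).trans_lt (by norm_num),
    fun φ => ?_⟩
  obtain ⟨ε, hε⟩ : ∃ ε, ε = min (ε₀ / 2) (1 / 3) := ⟨_, rfl⟩
  have hε' : ε ≤ ε₀ / 2 := hε ▸ min_le_left _ _
  rw [← hε]
  obtain ⟨k, hk⟩ : ∃ k : ℤ, ∀ ψ ∈ Set.Ioo (φ - ε) (φ + ε), ∀ E, slice t Z ψ E →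
      t.heart (E⟦-k⟧) := by
    by_cases hex : ∃ ψ ∈ Set.Ioo (φ - ε) (φ + ε), ∃ E, slice t Z ψ E ∧ ¬ IsZero E
    · obtain ⟨ψ, hψ, E, ⟨k, X, hX, ⟨e⟩⟩, hE⟩ := hex
      refine ⟨k, fun ψ' hψ' E' hE' => ?_⟩
      by_cases hE0 : IsZero E'
      · exact t.heart_of_isZero ((shiftFunctor D (-k)).map_isZero hE0)
      obtain ⟨k', X', hX', ⟨e'⟩⟩ := hE'
      have h1 : ¬ IsZero X := fun h =>
        hE (((shiftFunctor D k).map_isZero (isZero_obj h)).of_iso e)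
      have h2 : ¬ IsZero X' := fun h =>
        hE0 (((shiftFunctor D k').map_isZero (isZero_obj h)).of_iso e')
      have h3 := h X h1
      have h4 := h X' h2
      rw [hX.phase_eq (hZ.mem_H X h1)] at h3
      rw [hX'.phase_eq (hZ.mem_H X' h2)] at h4
      have h5 := hX.le_one
      have h6 := hX'.le_one
      obtain ⟨h7, h8⟩ := hψ
      obtain ⟨h9, h10⟩ := hψ'
      obtain rfl : k = k' := by
        have h11 : (k : ℝ) < k' + 1 := by linarith
        have h12 : (k' : ℝ) < k + 1 := by linarith
        norm_cast at h11 h12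
        lia
      exact t.heart.prop_of_iso ((shiftFunctor D (-k)).mapIso e' ≪≫
        (shiftEquiv D k).unitIso.symm.app X'.obj).symm X'.property
    · push Not at hex
      exact ⟨0, fun ψ hψ E hE => t.heart_of_isZero
        ((shiftFunctor D _).map_isZero (hex ψ hψ E hE))⟩
  have hP : ∀ E, phaseSubcategory (slice t Z) (Set.Ioo (φ - ε) (φ + ε)) E →
      t.heart (E⟦-k⟧) := by
    intro E hE
    induction hE with
    | zero X hX => exact t.heart_of_isZero ((shiftFunctor D (-k)).map_isZero hX)
    | of X hX =>
      obtain ⟨ψ, hψ, hX⟩ := hX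
      exact hk ψ hψ X hX
    | ext T hT h₁ h₃ ih₁ ih₃ =>
      exact t.heart_of_triangle (Triangle.shift_distinguished T hT (-k)) ih₁ ih₃
  let F := t.heart.lift ((phaseSubcategory (slice t Z) (Set.Ioo (φ - ε) (φ + ε))).ι ⋙
    shiftFunctor D (-k)) fun E => hP _ E.property
  have : F.PreservesZeroMorphisms := ⟨fun X Y => t.heart.ι.map_injective (by
    change (shiftFunctor D (-k)).map (0 : X.obj ⟶ Y.obj) = 0
    exact Functor.map_zero _ _ _)⟩
  have : F.Faithful := ⟨fun {X Y f g} h => ObjectProperty.hom_ext _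
    ((shiftFunctor D (-k)).map_injective (congrArg (fun x => x.hom) h))⟩
  exact (isStrictFiniteLengthCategory_of_faithful F hA :)

end Bridgeland

/-! ### A stability condition is recovered from its heart and its charge. -/

namespace Bridgeland

lemma Filtration.mono {A : Type u} [Category.{v} A] [Abelian A] {P P' : ℝ → A → Prop} {E : A}
    {l : List (ℝ × A)} (h : Filtration P E l) (hP : ∀ p ∈ l, P p.1 p.2 → P' p.1 p.2) :
    Filtration P' E l := by
  induction h with
  | zero X hX => exact .zero X hX
  | step f g w h φ hB hB' l hl hX ih =>
    simp only [List.mem_cons, forall_eq_or_imp] at hP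
    exact .step f g w h φ (hP.1 hB) hB' l hl (ih hP.2)

variable {D : Type u} [Category.{v} D] [Preadditive D] [HasZeroObject D] [HasShift D ℤ]
  [∀ n : ℤ, (shiftFunctor D n).Additive] [Pretriangulated D]

namespace StabilityCondition

variable {t : TStructure D} {σ : StabilityCondition D}

lemma heart_of_P (hσ : σ.heart = t.heart) {φ : ℝ} (h0 : 0 < φ) (h1 : φ ≤ 1) {E : D}
    (hE : σ.P φ E) : t.heart E := by
  rw [← hσ]
  exact .of _ ⟨φ, ⟨h0, h1⟩, hE⟩

lemma hom_heart_eq_zero {E : D} (hE : σ.heart E) {φ : ℝ} {B : D} (hB : σ.P φ B) (hφ : 1 < φ)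
    (f : B ⟶ E) : f = 0 := by
  induction hE with
  | zero X hX => exact hX.eq_of_tgt f 0
  | of X hX =>
    obtain ⟨ψ, hψ, hX⟩ := hX
    exact σ.hom_eq_zero _ _ (hψ.2.trans_lt hφ) _ _ hB hX f
  | ext T hT h₁ h₃ ih₁ ih₃ =>
    obtain ⟨g, hg⟩ := Triangle.coyoneda_exact₂ T hT f (ih₃ _)
    rw [hg, ih₁ g, zero_comp]

lemma heart_hom_eq_zero {E : D} (hE : σ.heart E) {φ : ℝ} {B : D} (hB : σ.P φ B) (hφ : φ ≤ 0)
    (f : E ⟶ B) : f = 0 := by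
  induction hE with
  | zero X hX => exact hX.eq_of_src f 0
  | of X hX =>
    obtain ⟨ψ, hψ, hX⟩ := hX
    exact σ.hom_eq_zero _ _ (hφ.trans_lt hψ.1) _ _ hX hB f
  | ext T hT h₁ h₃ ih₁ ih₃ =>
    obtain ⟨g, hg⟩ := Triangle.yoneda_exact₂ T hT f (ih₁ _)
    rw [hg, ih₃ g, comp_zero]

/-- The phases of a tower are bounded above if there are no morphisms from objects of larger
phase. -/
lemma tower_le_of_hom_eq_zero {E : D} {l : List (ℝ × D)} (h : Tower σ.P E l) {c : ℝ}
    (hE : ∀ φ B, σ.P φ B → c < φ → ∀ f : B ⟶ E, f = 0) : ∀ p ∈ l, p.1 ≤ c := by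
  induction h with
  | zero => simp
  | @step X E B f g d hT φ hB hB' l hl hX ih =>
    have hφ : φ ≤ c := by
      by_contra! hφ
      have h1 : 𝟙 E = 0 := (Tower.step f g d hT φ hB hB' l hl hX).prop_hom_src (fun p hp => by
        refine hE p.1 p.2 ((Tower.step f g d hT φ hB hB' l hl hX).forall_mem p hp).1 ?_
        rcases List.mem_cons.1 hp with rfl | hp
        · exact hφ
        · exact hφ.trans (hl p hp)) _
      exact hX.ne_zero_of_step σ.hom_eq_zero (fun _ _ => σ.P_shift_one) hT hB hB' hl
        (((IsZero.iff_id_eq_zero E).2 h1).eq_of_src g 0)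
    simp only [List.mem_cons, forall_eq_or_imp]
    refine ⟨hφ, ih fun ψ B' hB'' hψ a => ?_⟩
    have h1 : a ≫ f = 0 := hE ψ B' hB'' hψ _
    -- The shift of `a` factors through a morphism from phase `ψ + 1` to phase `φ`, which vanishes
    -- since `φ ≤ c < ψ`.
    obtain ⟨s, hs⟩ : ∃ s : B'⟦(1 : ℤ)⟧ ⟶ B, a⟦(1 : ℤ)⟧' = s ≫ d :=
      Triangle.coyoneda_exact₁ _ hT (a⟦(1 : ℤ)⟧') (by
        change a⟦(1 : ℤ)⟧' ≫ f⟦(1 : ℤ)⟧' = 0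
        rw [← Functor.map_comp, h1, Functor.map_zero])
    rw [σ.hom_eq_zero _ _ (by linarith) _ _ (σ.P_shift_one hB'') hB s, zero_comp] at hs
    exact (shiftFunctor D (1 : ℤ)).map_injective (by rw [hs, Functor.map_zero])

/-- The phases of a tower are bounded below if there are no morphisms to objects of smaller
phase. -/
lemma lt_tower_of_hom_eq_zero {E : D} {l : List (ℝ × D)} (h : Tower σ.P E l) {c : ℝ}
    (hE : ∀ φ B, σ.P φ B → φ ≤ c → ∀ f : E ⟶ B, f = 0) : ∀ p ∈ l, c < p.1 := by
  intro p hp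
  cases h with
  | zero => simp at hp
  | step f g d hT φ hB hB' l hl hX =>
    have hφ : c < φ := by
      by_contra! hφ
      exact hX.ne_zero_of_step σ.hom_eq_zero (fun _ _ => σ.P_shift_one) hT hB hB' hl
        (hE φ _ hB hφ g)
    rcases List.mem_cons.1 hp with rfl | hp
    · exact hφ
    · exact hφ.trans (hl p hp)

lemma mem_Ioc_of_heart {E : D} (hE : σ.heart E) {l : List (ℝ × D)} (h : Tower σ.P E l) :
    ∀ p ∈ l, p.1 ∈ Set.Ioc 0 1 := fun p hp =>
  ⟨lt_tower_of_hom_eq_zero h (fun _ _ hB hφ f => heart_hom_eq_zero hE hB hφ f) p hp,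
    tower_le_of_hom_eq_zero h (fun _ _ hB hφ f => hom_heart_eq_zero hE hB hφ f) p hp⟩

variable [IsTriangulated D]

lemma exists_filtration_of_tower (hσ : σ.heart = t.heart) {E : D} {l : List (ℝ × D)}
    (h : Tower σ.P E l) (hl : ∀ p ∈ l, p.1 ∈ Set.Ioc 0 1) (hE : t.heart E) :
    ∃ l' : List (ℝ × t.heart.FullSubcategory),
      Filtration (fun φ B => σ.P φ B.obj) (⟨E, hE⟩ : t.heart.FullSubcategory) l' ∧
        l = l'.map fun p => (p.1, p.2.obj) := by
  induction h with
  | zero X hX => exact ⟨[], .zero _ (t.isZero_of_isZero_obj hX), rfl⟩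
  | @step X E B f g d hT φ hB hB' l hlφ hX ih =>
    simp only [List.mem_cons, forall_eq_or_imp] at hl
    have hBh : t.heart B := heart_of_P hσ hl.1.1 hl.1.2 hB
    have hXh : t.heart X := hX.prop_of_ext _ (fun _ => t.heart_of_isZero)
      (fun p hp => heart_of_P hσ (hl.2 p hp).1 (hl.2 p hp).2 (hX.forall_mem p hp).1)
      fun _ => t.heart_of_triangle
    obtain ⟨l', hl', rfl⟩ := ih hl.2 hXh
    obtain ⟨w, hw⟩ := t.shortExact_of_triangle (X := ⟨X, hXh⟩) (Y := ⟨E, hE⟩) (Z := ⟨B, hBh⟩)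
      (ObjectProperty.homMk f) (ObjectProperty.homMk g) d hT
    refine ⟨(φ, ⟨B, hBh⟩) :: l', .step _ _ w hw φ hB (fun h => hB' (isZero_obj h)) l' ?_ hl', rfl⟩
    intro p hp
    exact hlφ _ (List.mem_map_of_mem (f := fun p : ℝ × t.heart.FullSubcategory =>
      (p.1, p.2.obj)) hp)

lemma exists_heart_filtration (hσ : σ.heart = t.heart) (X : t.heart.FullSubcategory) :
    ∃ l, Filtration (fun φ B => σ.P φ B.obj) X l ∧ ∀ p ∈ l, p.1 ∈ Set.Ioc 0 1 := by
  obtain ⟨l, hl⟩ := σ.exists_tower X.obj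
  have hl' := mem_Ioc_of_heart (by rw [hσ]; exact X.property) hl
  obtain ⟨l', h, rfl⟩ := exists_filtration_of_tower hσ hl hl' X.property
  exact ⟨l', h, fun p hp => hl' _ (List.mem_map_of_mem (f := fun p :
    ℝ × t.heart.FullSubcategory => (p.1, p.2.obj)) hp)⟩

omit [IsTriangulated D] in
lemma charge_mem_H {φ : ℝ} (hφ : φ ∈ Set.Ioc 0 1) {X : t.heart.FullSubcategory}
    (hX : σ.P φ X.obj) (hX0 : ¬ IsZero X) :
    heartCharge t σ.Z X ∈ H ∧ phase (heartCharge t σ.Z X) = φ := by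
  obtain ⟨m, hm, h⟩ := σ.charge φ _ hX (not_isZero_obj hX0)
  replace h : heartCharge t σ.Z X = m * ray φ := h
  rw [h]
  exact ⟨⟨m, φ, hm, hφ.1, hφ.2, rfl⟩, phase_ray hm hφ.1 hφ.2⟩

lemma heartCharge_mem_H (hσ : σ.heart = t.heart) (X : t.heart.FullSubcategory)
    (hX : ¬ IsZero X) : heartCharge t σ.Z X ∈ H := by
  obtain ⟨l, h, hl⟩ := exists_heart_filtration hσ X
  suffices h' : IsZero X ∨ heartCharge t σ.Z X ∈ H from h'.resolve_left hX
  clear hX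
  induction h with
  | zero X hX => exact Or.inl hX
  | @step X E B f g w h φ hB hB' l hlφ hX ih =>
    simp only [List.mem_cons, forall_eq_or_imp] at hl
    have h1 := (charge_mem_H hl.1 hB hB').1
    have h2 : heartCharge t σ.Z E = heartCharge t σ.Z X + heartCharge t σ.Z B :=
      isAdditiveOn_heartCharge t σ.Z _ h
    right
    rcases ih hl.2 with h3 | h3
    · rwa [h2, (isAdditiveOn_heartCharge t σ.Z).eq_zero h3, zero_add]
    · rw [h2]
      exact add_mem_H h3 h1

lemma above_filtration (φ : ℝ) {X : t.heart.FullSubcategory}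
    {l : List (ℝ × t.heart.FullSubcategory)}
    (h : Filtration (fun φ B => σ.P φ B.obj) X l) (hl : ∀ p ∈ l, p.1 ∈ Set.Ioc 0 1)
    (h0 : 0 < φ) (hφ : ∀ p ∈ l, φ < p.1) : 0 ≤ above φ (heartCharge t σ.Z X) ∧
      (l ≠ [] → 0 < above φ (heartCharge t σ.Z X)) := by
  induction h with
  | zero X hX => simp [(isAdditiveOn_heartCharge t σ.Z).eq_zero hX]
  | @step X E B f g w h ψ hB hB' l hlφ hX ih =>
    simp only [List.mem_cons, forall_eq_or_imp] at hl hφ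
    have h1 := charge_mem_H hl.1 hB hB'
    have h2 : heartCharge t σ.Z E = heartCharge t σ.Z X + heartCharge t σ.Z B :=
      isAdditiveOn_heartCharge t σ.Z _ h
    have h3 := above_pos h1.1 h0 (h1.2.symm ▸ hφ.1)
    have h4 := (ih hl.2 hφ.2).1
    rw [h2, above_add]
    exact ⟨by linarith, fun _ => by linarith⟩

/-- If `X` is in the slice, it maps nontrivially to the last factor of each nonzero quotient, so all
phases there are at least `φ`. If `X` is semistable and nonzero, its last factor is a quotient of
phase at least `φ`; all other factors lie strictly above, and `above φ` vanishes on `X`, so there is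
only one factor, of phase `φ`. -/
lemma P_iff_semistable (hσ : σ.heart = t.heart) {φ : ℝ} (hφ : φ ∈ Set.Ioc 0 1)
    (X : t.heart.FullSubcategory) : σ.P φ X.obj ↔ Semistable (heartCharge t σ.Z) φ X := by
  have hadd := isAdditiveOn_heartCharge t σ.Z
  constructor
  · intro hX
    refine ⟨hφ.1, hφ.2, ?_, fun {Q} p _ => ?_⟩
    · by_cases hX0 : IsZero X
      · rw [hadd.eq_zero hX0, above_zero]
      · obtain ⟨h1, h2⟩ := charge_mem_H hφ hX hX0
        rw [← h2, above_phase h1]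
    · obtain ⟨l, h, hl⟩ := exists_heart_filtration hσ Q
      cases h with
      | zero _ hQ => rw [hadd.eq_zero hQ, above_zero]
      | @step X' _ B f g w h ψ hB hB' l hlψ hX' =>
        simp only [List.mem_cons, forall_eq_or_imp] at hl
        have := h.epi_g
        have hψ : φ ≤ ψ := by
          by_contra! hψ
          have h1 : p ≫ g = 0 := t.heart.ι.map_injective (by
            rw [Functor.map_zero]
            exact σ.hom_eq_zero _ _ hψ _ _ hX hB _)
          exact hB' (IsZero.of_epi_eq_zero (p ≫ g) h1)
        obtain ⟨h1, h2⟩ := charge_mem_H hl.1 hB hB'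
        have h3 : heartCharge t σ.Z Q = heartCharge t σ.Z X' + heartCharge t σ.Z B := hadd _ h
        have h4 := (above_nonneg_iff h1 hφ.1 hφ.2).2 (h2.symm ▸ hψ)
        have h5 := (above_filtration φ hX' hl.2 hφ.1 fun p hp => hψ.trans_lt (hlψ p hp)).1
        rw [h3, above_add]
        linarith
  · intro hX
    obtain ⟨l, h, hl⟩ := exists_heart_filtration hσ X
    cases h with
    | zero _ hX0 =>
      have := σ.closed_finite_sum φ
      exact (σ.P φ).prop_of_isLimit (isZero_obj hX0).isTerminal (by rintro ⟨⟨⟩⟩)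
    | @step X' _ B f g w h ψ hB hB' l hlψ hX' =>
      simp only [List.mem_cons, forall_eq_or_imp] at hl
      have := h.epi_g
      obtain ⟨h1, h2⟩ := charge_mem_H hl.1 hB hB'
      have h0 := hX.above_nonneg g
      have hψ : φ ≤ ψ := by rwa [above_nonneg_iff h1 hφ.1 hφ.2, h2] at h0
      have h3 : heartCharge t σ.Z X = heartCharge t σ.Z X' + heartCharge t σ.Z B := hadd _ h
      have h4 := hX.above_eq
      rw [h3, above_add] at h4
      obtain ⟨h5, h6⟩ := above_filtration φ hX' hl.2 hφ.1 fun p hp => hψ.trans_lt (hlψ p hp)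
      obtain rfl : l = [] := by
        by_contra hl0
        linarith [h6 hl0]
      have hX0 : IsZero X' := by cases hX'; assumption
      obtain rfl : φ = ψ := by
        rw [hadd.eq_zero hX0, above_zero, zero_add, above_eq_zero_iff h1 hφ.1 hφ.2, h2] at h4
        exact h4.symm
      have : Mono g := h.exact.mono_g (hX0.eq_of_src _ _)
      have : IsIso g := isIso_of_mono_of_epi g
      exact σ.P_of_iso hB (t.heart.ι.mapIso (asIso g).symm)

lemma isStabilityFunction (hσ : σ.heart = t.heart) : IsStabilityFunction t σ.Z where
  mem_H := heartCharge_mem_H hσ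
  exists_filtration X := by
    obtain ⟨l, h, hl⟩ := exists_heart_filtration hσ X
    exact ⟨l, h.mono fun p hp hP => (P_iff_semistable hσ (hl p hp) p.2).1 hP⟩

/-- A stability condition is determined by its heart and its central charge. -/
lemma eq_stabilityCondition (ht : ∀ X, t.bounded X) (hσ : σ.heart = t.heart) :
    σ = stabilityCondition ht (isStabilityFunction hσ) := by
  refine StabilityCondition.ext rfl (funext fun φ => ?_)
  ext E
  change σ.P φ E ↔ slice t σ.Z φ E
  have h1 := Int.ceil_lt_add_one φ
  have h2 := Int.le_ceil φ
  obtain ⟨k, hk, hk'⟩ : ∃ k : ℤ, (k : ℝ) < φ ∧ φ ≤ k + 1 :=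
    ⟨⌈φ⌉ - 1, by push_cast; linarith, by push_cast; linarith⟩
  have hφ : φ - k ∈ Set.Ioc (0 : ℝ) 1 := ⟨by linarith, by linarith⟩
  constructor
  · intro h
    have h3 := σ.P_shift (-k) h
    rw [Int.cast_neg, ← sub_eq_add_neg] at h3
    have h4 := slice_of_semistable ((P_iff_semistable hσ hφ
      ⟨E⟦-k⟧, heart_of_P hσ hφ.1 hφ.2 h3⟩).1 h3)
    refine slice_of_shift (n := -k) ?_
    rw [Int.cast_neg, ← sub_eq_add_neg]
    exact h4
  · intro h
    obtain ⟨X, hX, ⟨e⟩⟩ := exists_of_slice h hk hk'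
    refine σ.P_of_shift (-k) ?_
    rw [Int.cast_neg, ← sub_eq_add_neg]
    exact σ.P_of_iso ((P_iff_semistable hσ hφ X).2 hX) e.symm

end StabilityCondition

end Bridgeland

/-! ### Estimates for the metric between conditions with the same heart. -/

namespace Bridgeland

lemma above_sub (φ : ℝ) (z w : ℂ) : above φ (z - w) = above φ z - above φ w := by
  simp only [above, sub_mul, Complex.sub_im]

/-- The lines in the directions `phase z ± ε` have distance `‖z‖ sin(πε)` from `z`; a `w` whose
phase differs by more than `ε` lies beyond one of them. -/
lemma abs_phase_sub_le {z w : ℂ} (hz : z ∈ H) (hw : w ∈ H) {η ε : ℝ} (hε : 0 < ε)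
    (hη : η < Real.sin (Real.pi * ε)) (h : ‖w - z‖ ≤ η * ‖z‖) : |phase w - phase z| ≤ ε := by
  have hπ := Real.pi_pos
  have z0 := phase_pos hz
  have z1 := phase_le_one hz
  have w0 := phase_pos hw
  have w1 := phase_le_one hw
  have hn : 0 < ‖z‖ := norm_pos_iff.2 (ne_zero_of_mem_H hz)
  have hlt := mul_lt_mul_of_pos_right hη hn
  by_contra! h1
  rcases lt_abs.1 h1 with h1 | h1
  · have h2 := above_le_norm (phase z + ε) (w - z)
    rw [above_sub, above_eq hz, above_eq hw, sub_add_cancel_left, mul_neg, Real.sin_neg] at h2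
    have h3 : 0 ≤ ‖w‖ * Real.sin (Real.pi * (phase w - (phase z + ε))) :=
      mul_nonneg (norm_nonneg _) (Real.sin_nonneg_of_nonneg_of_le_pi (by nlinarith) (by nlinarith))
    nlinarith
  · have h2 := above_le_norm (phase z - ε) (z - w)
    rw [above_sub, above_eq hz, above_eq hw, sub_sub_cancel, norm_sub_rev] at h2
    have h3 : ‖w‖ * Real.sin (Real.pi * (phase w - (phase z - ε))) ≤ 0 :=
      mul_nonpos_of_nonneg_of_nonpos (norm_nonneg _)
        (Real.sin_nonpos_of_nonpos_of_neg_pi_le (by nlinarith) (by nlinarith))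
    nlinarith

variable {D : Type u} [Category.{v} D] [Preadditive D] [HasZeroObject D] [HasShift D ℤ]
  [∀ n : ℤ, (shiftFunctor D n).Additive] [Pretriangulated D]

namespace StabilityCondition

section Lipschitz

variable (E : D) (hE : ¬ IsZero E)

lemma ofReal_distAt_le (σ τ : StabilityCondition D) :
    ENNReal.ofReal (distAt σ τ E hE) ≤ edist σ τ :=
  le_iSup₂ (f := fun E hE => ENNReal.ofReal (distAt σ τ E hE)) E hE

lemma continuous_of_le_distAt {f : StabilityCondition D → ℝ}
    (hf : ∀ σ τ, |f τ - f σ| ≤ distAt σ τ E hE) : Continuous f := by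
  have h : LipschitzWith 1 f := LipschitzWith.of_edist_le fun σ τ => by
    rw [edist_comm, edist_dist, Real.dist_eq]
    exact (ENNReal.ofReal_le_ofReal (hf σ τ)).trans (ofReal_distAt_le E hE σ τ)
  exact h.continuous

lemma continuous_phasePlus : Continuous fun σ : StabilityCondition D => σ.phasePlus E hE :=
  continuous_of_le_distAt E hE fun _ _ => (le_max_right _ _).trans (le_max_left _ _)

lemma continuous_mass : Continuous fun σ : StabilityCondition D => σ.mass E hE := by
  have h : Continuous fun σ : StabilityCondition D => Real.log (σ.mass E hE) :=
    continuous_of_le_distAt E hE fun σ τ => by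
      rw [← Real.log_div (τ.mass_pos E hE).ne' (σ.mass_pos E hE).ne']
      exact le_max_right _ _
  exact (Real.continuous_exp.comp h).congr fun σ => Real.exp_log (σ.mass_pos E hE)

end Lipschitz

variable [IsTriangulated D] {t : TStructure D} {Z W : K D →+ ℂ}

/-- Both towers are built along the same truncations, so each mass is a sum over the cohomology
objects and the inequality in the heart can be added up. -/
lemma exists_towers (ht : ∀ X, t.bounded X) (hZ : IsStabilityFunction t Z)
    (hW : IsStabilityFunction t W) {η : ℝ} (hη : ∀ X : t.heart.FullSubcategory,
      ‖heartCharge t W X - heartCharge t Z X‖ ≤ η * ‖heartCharge t Z X‖) (E : D) :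
    ∃ l l', Tower (slice t Z) E l ∧ Tower (slice t W) E l' ∧
      (1 - η) * (l.map fun p => ‖Z (K.of p.2)‖).sum ≤ (l'.map fun p => ‖W (K.of p.2)‖).sum := by
  obtain ⟨⟨a, ha⟩, ⟨b, hb⟩⟩ := ht E
  suffices h : ∃ l l', Tower (slice t Z) E l ∧ Tower (slice t W) E l' ∧
      (∀ p ∈ l, -(b : ℝ) < p.1) ∧ (∀ p ∈ l', -(b : ℝ) < p.1) ∧
      (1 - η) * (l.map fun p => ‖Z (K.of p.2)‖).sum ≤ (l'.map fun p => ‖W (K.of p.2)‖).sum by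
    obtain ⟨l, l', hl, hl', -, -, h⟩ := h
    exact ⟨l, l', hl, hl', h⟩
  refine t.bounded_induction (fun b E => ∃ l l', Tower (slice t Z) E l ∧ Tower (slice t W) E l' ∧
      (∀ p ∈ l, -(b : ℝ) < p.1) ∧ (∀ p ∈ l', -(b : ℝ) < p.1) ∧
      (1 - η) * (l.map fun p => ‖Z (K.of p.2)‖).sum ≤ (l'.map fun p => ‖W (K.of p.2)‖).sum)
    (fun b X hX => ⟨[], [], .zero X hX, .zero X hX, by simp⟩) (fun b T hT h₁ h₂ h₃ h₄ => ?_)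
    a b E hb ha
  obtain ⟨l₁, l₁', hl₁, hl₁', hb₁, hb₁', hm⟩ := h₂
  obtain ⟨X, ⟨e⟩⟩ := exists_iso_shift b h₃ h₄
  obtain ⟨l, hl⟩ := hZ.exists_filtration X
  obtain ⟨l', hl'⟩ := hW.exists_filtration X
  obtain ⟨l₂, hl₂, hb₂, e₂⟩ := hl₁.concat_filtration hT hb₁ e hl
  obtain ⟨l₂', hl₂', hb₂', e₂'⟩ := hl₁'.concat_filtration hT hb₁' e hl'
  refine ⟨l₂, l₂', hl₂, hl₂', hb₂, hb₂', ?_⟩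
  have h5 := hl'.mass_le (isAdditiveOn_heartCharge t W) hZ.mem_H hW.mem_H hη hl
  rw [e₂, e₂', mul_add]
  linarith

lemma mass_le (ht : ∀ X, t.bounded X) (hZ : IsStabilityFunction t Z)
    (hW : IsStabilityFunction t W) {η : ℝ} (hη : ∀ X : t.heart.FullSubcategory,
      ‖heartCharge t W X - heartCharge t Z X‖ ≤ η * ‖heartCharge t Z X‖) (E : D)
    (hE : ¬ IsZero E) :
    (1 - η) * (stabilityCondition ht hZ).mass E hE ≤ (stabilityCondition ht hW).mass E hE := by
  obtain ⟨l, l', hl, hl', h⟩ := exists_towers ht hZ hW hη E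
  rw [mass_eq_tower (σ := stabilityCondition ht hZ) hl hE,
    mass_eq_tower (σ := stabilityCondition ht hW) hl' hE]
  exact h

section Phase

variable (ht : ∀ X, t.bounded X) (hZ : IsStabilityFunction t Z) (hW : IsStabilityFunction t W)
  {ε : ℝ} (hε0 : 0 ≤ ε) (E : D) (hE : ¬ IsZero E)

include hε0

/-- An object that is semistable for `Z` with phase above the bound has no morphisms to the factors
of `E` for `W`, hence none to `E`. -/
lemma phasePlus_le (hε : ∀ X : t.heart.FullSubcategory, ¬ IsZero X →
      phase (heartCharge t Z X) ≤ phase (heartCharge t W X) + ε) :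
    (stabilityCondition ht hZ).phasePlus E hE ≤ (stabilityCondition ht hW).phasePlus E hE + ε := by
  obtain ⟨l, hl⟩ := (stabilityCondition ht hZ).exists_tower E
  obtain ⟨l', hl'⟩ := (stabilityCondition ht hW).exists_tower E
  obtain ⟨p, hp, hpE⟩ := exists_tower_phasePlus hl hE
  rw [← hpE]
  refine tower_le_of_hom_eq_zero hl (fun φ B hB hφ f => hl'.prop_hom_tgt (fun q hq g => ?_) f) p hp
  exact slice_hom_eq_zero hZ hW hε hε0 (by linarith [(tower_phase_mem hl' hE hq).2]) hB
    (hl'.forall_mem q hq).1 g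

lemma phaseMinus_le (hε : ∀ X : t.heart.FullSubcategory, ¬ IsZero X →
      phase (heartCharge t Z X) ≤ phase (heartCharge t W X) + ε) :
    (stabilityCondition ht hZ).phaseMinus E hE ≤
      (stabilityCondition ht hW).phaseMinus E hE + ε := by
  obtain ⟨l, hl⟩ := (stabilityCondition ht hZ).exists_tower E
  obtain ⟨l', hl'⟩ := (stabilityCondition ht hW).exists_tower E
  obtain ⟨p, hp, hpE⟩ := exists_tower_phaseMinus hl' hE
  rw [← hpE, ← sub_le_iff_le_add]
  -- The vanishing of morphisms needs a strict gap, so the bound is tested on all smaller `c`.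
  refine le_of_forall_lt fun c hc => lt_tower_of_hom_eq_zero hl' (fun φ B hB hφ f =>
    hl.prop_hom_src (fun q hq g => ?_) f) p hp
  exact slice_hom_eq_zero hZ hW hε hε0 (by linarith [(tower_phase_mem hl hE hq).1])
    (hl.forall_mem q hq).1 hB g

end Phase

/-- Stability conditions with the same heart are close if their central charges are. -/
lemma edist_le (ht : ∀ X, t.bounded X) (hZ : IsStabilityFunction t Z)
    (hW : IsStabilityFunction t W) {η ε : ℝ} (hε : 0 < ε) (hsin : η < Real.sin (Real.pi * ε))
    (hexp : Real.exp (-ε) ≤ 1 - η)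
    (h : ∀ X : t.heart.FullSubcategory,
      ‖heartCharge t W X - heartCharge t Z X‖ ≤ η * ‖heartCharge t Z X‖)
    (h' : ∀ X : t.heart.FullSubcategory,
      ‖heartCharge t Z X - heartCharge t W X‖ ≤ η * ‖heartCharge t W X‖) :
    edist (stabilityCondition ht hZ) (stabilityCondition ht hW) ≤ ENNReal.ofReal ε := by
  have hp (X : t.heart.FullSubcategory) (hX : ¬ IsZero X) :=
    abs_sub_le_iff.1 (abs_phase_sub_le (hZ.mem_H X hX) (hW.mem_H X hX) hε hsin (h X))
  have hp1 (X : t.heart.FullSubcategory) (hX : ¬ IsZero X) :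
      phase (heartCharge t W X) ≤ phase (heartCharge t Z X) + ε := by linarith [(hp X hX).1]
  have hp2 (X : t.heart.FullSubcategory) (hX : ¬ IsZero X) :
      phase (heartCharge t Z X) ≤ phase (heartCharge t W X) + ε := by linarith [(hp X hX).2]
  refine iSup₂_le fun E hE => ENNReal.ofReal_le_ofReal (max_le (max_le ?_ ?_) ?_)
  · rw [abs_sub_le_iff]
    constructor
    · linarith [phaseMinus_le ht hW hZ hε.le E hE hp1]
    · linarith [phaseMinus_le ht hZ hW hε.le E hE hp2]
  · rw [abs_sub_le_iff]
    constructor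
    · linarith [phasePlus_le ht hW hZ hε.le E hE hp1]
    · linarith [phasePlus_le ht hZ hW hε.le E hE hp2]
  · have hlog {a b : ℝ} (ha : 0 < a) (hb : 0 < b) (hab : (1 - η) * a ≤ b) :
        Real.log a - Real.log b ≤ ε := by
      have h1 : Real.exp (-ε) * a ≤ b := (mul_le_mul_of_nonneg_right hexp ha.le).trans hab
      have h2 := Real.log_le_log (by positivity) h1
      rw [Real.log_mul (Real.exp_ne_zero _) ha.ne', Real.log_exp] at h2
      linarith
    rw [Real.log_div (mass_pos _ E hE).ne' (mass_pos _ E hE).ne', abs_sub_le_iff]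
    exact ⟨hlog (mass_pos _ E hE) (mass_pos _ E hE) (mass_le ht hW hZ h' E hE),
      hlog (mass_pos _ E hE) (mass_pos _ E hE) (mass_le ht hZ hW h E hE)⟩

/-- A relative error `η ≤ 1/2` with respect to `Z` is a relative error of at most `2η` with respect
to `W`; this makes the hypothesis of `edist_le` symmetric. -/
lemma exists_edist_le {ε : ℝ} (hε : 0 < ε) (hε1 : ε < 1) : ∃ η : ℝ, 0 < η ∧
    ∀ (t : TStructure D) (ht : ∀ X, t.bounded X) (Z W : K D →+ ℂ) (hZ : IsStabilityFunction t Z)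
      (hW : IsStabilityFunction t W), (∀ X : t.heart.FullSubcategory,
        ‖heartCharge t W X - heartCharge t Z X‖ ≤ η * ‖heartCharge t Z X‖) →
      edist (stabilityCondition ht hZ) (stabilityCondition ht hW) ≤ ENNReal.ofReal ε := by
  have hπ := Real.pi_pos
  have hs : 0 < Real.sin (Real.pi * ε) := Real.sin_pos_of_pos_of_lt_pi (by positivity) (by nlinarith)
  have he : Real.exp (-ε) < 1 := by simpa using hε
  obtain ⟨η, h0, h1⟩ : ∃ η : ℝ, 0 < η ∧
      η < min (min (Real.sin (Real.pi * ε) / 2) ((1 - Real.exp (-ε)) / 2)) (1 / 2) :=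
    exists_between (lt_min (lt_min (by linarith) (by linarith)) (by norm_num))
  rw [lt_min_iff, lt_min_iff] at h1
  refine ⟨η, h0, fun t ht Z W hZ hW h => edist_le ht hZ hW (η := 2 * η) hε (by linarith)
    (by linarith) (fun X => (h X).trans ?_) fun X => ?_⟩
  · exact mul_le_mul_of_nonneg_right (by linarith) (norm_nonneg _)
  · have h2 := h X
    have h3 := norm_sub_norm_le (heartCharge t Z X) (heartCharge t W X)
    rw [norm_sub_rev] at h2
    have h4 := mul_le_mul_of_nonneg_right h1.2.le (norm_nonneg (heartCharge t Z X))
    refine h2.trans ?_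
    rw [mul_comm 2 η, mul_assoc]
    exact mul_le_mul_of_nonneg_left (by linarith) h0.le

end StabilityCondition

end Bridgeland

/-! ### Continuity of the charge and the homeomorphism. -/

namespace Bridgeland

variable {D : Type u} [Category.{v} D] [Preadditive D] [HasZeroObject D] [HasShift D ℤ]
  [∀ n : ℤ, (shiftFunctor D n).Additive] [Pretriangulated D] [IsTriangulated D]
  {t : TStructure D}

lemma stabilityCondition_congr (ht : ∀ X, t.bounded X) {Z W : K D →+ ℂ}
    (hZ : IsStabilityFunction t Z) (hW : IsStabilityFunction t W) (h : Z = W) :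
    stabilityCondition ht hZ = stabilityCondition ht hW := by
  subst h; rfl

namespace StabilityCondition

lemma P_of_simple {σ : StabilityCondition D} (hσ : σ.heart = t.heart)
    (S : t.heart.FullSubcategory) [Simple S] : σ.P (phase (heartCharge t σ.Z S)) S.obj := by
  have hS := heartCharge_mem_H hσ S (Simple.not_isZero S)
  rw [P_iff_semistable hσ ⟨phase_pos hS, phase_le_one hS⟩]
  refine ⟨phase_pos hS, phase_le_one hS, above_phase hS, fun {Q} p _ => ?_⟩
  by_cases hp : p = 0
  · rw [(isAdditiveOn_heartCharge t σ.Z).eq_zero (IsZero.of_epi_eq_zero p hp), above_zero]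
  · have : IsIso p := isIso_of_epi_of_nonzero hp
    rw [← (isAdditiveOn_heartCharge t σ.Z).iso (asIso p), above_phase hS]

/-- A simple object is its own Harder-Narasimhan factor, so its charge is expressed by two
quantities that the metric controls. -/
lemma charge_simple {σ : StabilityCondition D} (hσ : σ.heart = t.heart)
    (S : t.heart.FullSubcategory) [Simple S] (hS : ¬ IsZero S.obj) :
    σ.Z (K.of S.obj) = σ.mass S.obj hS * ray (σ.phasePlus S.obj hS) := by
  have h := Tower.single (P_of_simple hσ S) hS
  obtain ⟨p, hp, hpE⟩ := exists_tower_phasePlus h hS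
  rw [mass_eq_tower h hS, ← hpE, List.mem_singleton.1 hp]
  simpa using eq_norm_mul_ray (heartCharge_mem_H hσ S (Simple.not_isZero S))

end StabilityCondition

open StabilityCondition

lemma continuous_charge_simple (S : t.heart.FullSubcategory) [Simple S] :
    Continuous fun σ : U t.heart => σ.1.1.Z (K.of S.obj) := by
  have hS := not_isZero_obj (Simple.not_isZero S)
  have hc : Continuous fun σ : U t.heart => σ.1.1 :=
    continuous_subtype_val.comp continuous_subtype_val
  have h1 := (continuous_mass S.obj hS).comp hc
  have h2 := (continuous_phasePlus S.obj hS).comp hc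
  have h3 : Continuous ray := by unfold ray; fun_prop
  exact ((Complex.continuous_ofReal.comp h1).mul (h3.comp h2)).congr
    fun σ => (charge_simple σ.2 S hS).symm

end Bridgeland

open Bridgeland Bridgeland.StabilityCondition

theorem lemma5 {D : Type u} [Category.{v} D] [Preadditive D] [HasZeroObject D] [HasShift D ℤ]
    [∀ n : ℤ, (shiftFunctor D n).Additive] [Pretriangulated D] [IsTriangulated D]
    (t : TStructure D) (ht : ∀ X : D, t.bounded X)
    (hA : Bridgeland.IsFiniteLengthCategory t.heart.FullSubcategory)
    (n : ℕ) (S : Fin n → t.heart.FullSubcategory)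
    (hS : ∀ i, Simple (S i))
    (hS_inj : ∀ i j, Nonempty (S i ≅ S j) → i = j)
    (hS_surj : ∀ T : t.heart.FullSubcategory, Simple T → ∃ i, Nonempty (T ≅ S i)) :
    Function.Bijective
      (fun (W : Bridgeland.K D →+ ℂ) (i : Fin n) => W (Bridgeland.K.of (S i).obj)) ∧
    ∃ F : Bridgeland.U t.heart ≃ₜ (Fin n → Bridgeland.H),
      ∀ (σ : Bridgeland.U t.heart) (i : Fin n),
        (F σ i : ℂ) = σ.1.1.Z (Bridgeland.K.of (S i).obj) := by
  have hbij := bijective_eval_simples t ht hA S hS hS_inj hS_surj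
  refine ⟨hbij, ?_⟩
  obtain ⟨c, hc, hcS, hc0, hl⟩ := exists_multiplicities hA hS hS_inj hS_surj
  have hZ (W : K D →+ ℂ) (X : t.heart.FullSubcategory) :
      heartCharge t W X = ∑ i, c X i • W (K.of (S i).obj) := hl _ (isAdditiveOn t W) X
  choose V hV using fun w : Fin n → H => hbij.2 fun i => (w i : ℂ)
  replace hV (w : Fin n → H) (i : Fin n) : V w (K.of (S i).obj) = w i := congrFun (hV w) i
  have hV' (w : Fin n → H) (X : t.heart.FullSubcategory) :
      heartCharge t (V w) X = ∑ i, c X i • (w i : ℂ) := by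
    rw [hZ]
    exact Finset.sum_congr rfl fun i _ => by rw [hV]
  have hstab (w : Fin n → H) : IsStabilityFunction t (V w) :=
    isStabilityFunction_of_multiplicities hc hc0 (hV' w) fun i => (w i).2
  have hfin (w : Fin n → H) : (stabilityCondition ht (hstab w)).IsLocallyFinite := by
    obtain ⟨ε, h0, -, hε⟩ := exists_le_phase fun i => (w i).2
    refine isLocallyFinite_stabilityCondition ht (hstab w) hA h0 fun X hX => ?_
    rw [hV']
    exact hε _ fun h => hX (hc0 X h)
  let G (w : Fin n → H) : U t.heart := ⟨⟨stabilityCondition ht (hstab w), hfin w⟩,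
    heart_stabilityCondition ht (hstab w)⟩
  have hG : Continuous G := by
    refine Continuous.subtype_mk (Continuous.subtype_mk ?_ _) _
    refine continuous_iff_continuousAt.2 fun z => EMetric.tendsto_nhds.2 fun δ hδ => ?_
    obtain ⟨ε, hε, hε1, hεδ⟩ : ∃ ε : ℝ, 0 < ε ∧ ε < 1 ∧ ENNReal.ofReal ε < δ := by
      obtain ⟨r, hr, hrδ⟩ := ENNReal.lt_iff_exists_nnreal_btwn.1 hδ
      have hr' : (0 : ℝ) < r := by exact_mod_cast hr
      refine ⟨min r (1 / 2), by positivity, (min_le_right _ _).trans_lt (by norm_num), ?_⟩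
      refine lt_of_le_of_lt (ENNReal.ofReal_le_ofReal (min_le_left _ _)) ?_
      rwa [ENNReal.ofReal_coe_nnreal]
    obtain ⟨η, hη, hη'⟩ := exists_edist_le (D := D) hε hε1
    -- The weights convert the uniform relative error `η` into a neighbourhood of `z` in the finite
    -- product.
    obtain ⟨a, ha, ha'⟩ := exists_norm_sub_le fun i => (z i).2
    have hev : ∀ᶠ w in nhds z, ∀ i, ‖(w i : ℂ) - z i‖ ≤ η * a i := by
      refine Filter.eventually_all.2 fun i => ?_
      have h1 : Continuous fun w : Fin n → H => ‖(w i : ℂ) - z i‖ := by fun_prop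
      have h2 := h1.tendsto z
      rw [sub_self, norm_zero] at h2
      exact (h2.eventually (gt_mem_nhds (mul_pos hη (ha i)))).mono fun _ h => h.le
    filter_upwards [hev] with w hw
    rw [edist_comm]
    refine lt_of_le_of_lt (hη' t ht _ _ (hstab z) (hstab w) fun X => ?_) hεδ
    rw [hV', hV']
    exact ha' _ η hη.le hw _
  refine ⟨{ toFun := fun σ i => ⟨σ.1.1.Z (K.of (S i).obj),
              heartCharge_mem_H σ.2 (S i) (have := hS i; Simple.not_isZero (S i))⟩
            invFun := G
            left_inv := fun σ => ?_
            right_inv := fun w => funext fun i => Subtype.ext (hV w i)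
            continuous_toFun := continuous_pi fun i => ?_
            continuous_invFun := hG }, fun σ i => rfl⟩
  -- The two charges agree at the simple objects, hence on `K(D)`; equality of hearts then gives
  -- equality of the stability conditions.
  · refine Subtype.ext (Subtype.ext ?_)
    exact (stabilityCondition_congr ht (hstab _) (isStabilityFunction σ.2)
      (hbij.1 (funext fun i => hV _ i))).trans (eq_stabilityCondition ht σ.2).symm
  · have := hS i
    exact (continuous_charge_simple (S i)).subtype_mk _
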